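/- Let $d\in\{2,3\}$ and let $\overline\Omega=\bigcup_{k=1}^N\overline{\Omega}^{(k)}\subset\mathbb R^d$ be a multipatch domain with non-overlapping, geometrically matching patches $\Omega^{(k)}=G^{(k)}((0,1)^d)$: two different closed patches meet along common closed sides, edges or vertices. Each $G^{(k)}$ is a tensor-product B-spline map for open knot vectors (degrees $\ge 1$, interior knots of multiplicity at most the degree), injective on $[0,1]^d$; the meshes of different patches are unrelated. The Dirichlet boundary $\Gamma_D$ is a union of patch sides that are not shared by two patches. Let $V_h^{(k)}$ be the span of those functions $\check N_i^{(k)}=N_i^{(k)}\circ (G^{(k)})^{-1}$, $N_i^{(k)}$ the tensor-product B-splines for the knots of patch $k$, that vanish on the sides of patch $k$ in $\Gamma_D$. Let $\mathcal I_{\mathcal F}^{(k)}$ be the set of the $l\neq k$ such that the patches $k$ and $l$ share a side (edge for $d=2$, face for $d=3$), $F^{(kl)}$ the common sides, and $\Gamma^{(k)}=\bigcup_{l\in\mathcal I_{\mathcal F}^{(k)}}F^{(kl)}$. Let $h^{(k)}$ be the mesh size (largest cell diameter) and $H^{(k)}$ the diameter of patch $k$, $h^{(kl)}=2h^{(k)}h^{(l)}/(h^{(k)}+h^{(l)})$,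 let $\alpha^{(k)}>0$ be constants, and let $\delta>0$ be the penalty parameter. For $l\in\mathcal I_{\mathcal F}^{(k)}$ let $V_h^{(k)}(F^{(lk)})\subset V_h^{(l)}$ be the span of the basis functions of $V_h^{(l)}$ that do not vanish identically on $F^{(lk)}=F^{(kl)}$. Put $V_{h,e}^{(k)}=V_h^{(k)}\times\prod_{l\in\mathcal I_{\mathcal F}^{(k)}}V_h^{(k)}(F^{(lk)})$, with elements $u=(u^{(k)},(u^{(l)})_l)$. Let $W^{(k)}\subset V_{h,e}^{(k)}$ be the subspace of those $u$ whose component $u^{(k)}$ is in the span of the basis functions of $V_h^{(k)}$ that do not vanish identically on $\Gamma^{(k)}$, and let $V_{I,h}^{(k)}\subset V_{h,e}^{(k)}$ be the subspace of those $u$ with $u^{(k)}=0$ on $\Gamma^{(k)}$ and $u^{(l)}=0$ for all $l$. Define, for $u,v\in V_{h,e}^{(k)}$ and $n$ the outer unit normal of $\Omega^{(k)}$, $$a^{(k)}(u,v)=\int_{\Omega^{(k)}}\alpha^{(k)}\nabla u^{(k)}\cdot\nabla v^{(k)}\,dx,\qquad p^{(k)}(u,v)=\sum_{l\in\mathcal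 I_{\mathcal F}^{(k)}}\int_{F^{(kl)}}\frac{\delta\alpha^{(k)}}{2h^{(kl)}}(u^{(l)}-u^{(k)})(v^{(l)}-v^{(k)})\,ds,$$ $$s^{(k)}(u,v)=\sum_{l\in\mathcal I_{\mathcal F}^{(k)}}\int_{F^{(kl)}}\frac{\alpha^{(k)}}2\Big(\frac{\partial u^{(k)}}{\partial n}(v^{(l)}-v^{(k)})+\frac{\partial v^{(k)}}{\partial n}(u^{(l)}-u^{(k)})\Big)ds,$$ $a_e^{(k)}=a^{(k)}+s^{(k)}+p^{(k)}$ and $d^{(k)}=a^{(k)}+p^{(k)}$. For $u_{B_e}\in W^{(k)}$, the extended (standard) discrete harmonic extension $\mathcal H_e^{(k)}u_{B_e}$ ($\mathcal H^{(k)}u_{B_e}$) is the $w\in V_{h,e}^{(k)}$ with $w^{(k)}=u_{B_e}^{(k)}$ on $\Gamma^{(k)}$, $w^{(l)}=u_{B_e}^{(l)}$ for all $l\in\mathcal I_{\mathcal F}^{(k)}$, and $a_e^{(k)}(w,v)=0$ (respectively $a^{(k)}(w,v)=0$) for all $v\in V_{I,h}^{(k)}$. Let patch $k$ have at least one interface side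 or Dirichlet side, let its geometry be regular with constant $\kappa$ ($\|\nabla G^{(k)}\|\le\kappa H^{(k)}$ and $\|(\nabla G^{(k)})^{-1}\|\le\kappa/H^{(k)}$, up to the boundary), let its mesh be quasi-uniform with constant $\theta$ (each knot span is at most $\theta$ times as long as each nonempty one), and let its spline degrees be at most $P$. Then there exist positive constants $\delta_0$ and $C$, depending only on $d$, $P$, $\kappa$, $\theta$, and not on $\delta$, $N$, the mesh sizes $h$, the diameters $H$, the coefficients $\alpha$ or $u_{B_e}$, such that for all $\delta\ge\delta_0$ and all $u_{B_e}\in W^{(k)}$ both extensions exist uniquely and $$d^{(k)}(\mathcal H^{(k)}u_{B_e},\mathcal H^{(k)}u_{B_e})\le d^{(k)}(\mathcal H_e^{(k)}u_{B_e},\mathcal H_e^{(k)}u_{B_e})\le C\,d^{(k)}(\mathcal H^{(k)}u_{B_e},\mathcal H^{(k)}u_{B_e}).$$ -/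

import Mathlib

open MeasureTheory

noncomputable section

namespace IgA

/-- Euclidean space `ℝ^d`, used both for the parameter domain and for the physical domain. -/
abbrev E (d : ℕ) := EuclideanSpace ℝ (Fin d)

/-! ### B-splines -/

/-- An open knot vector on `[0,1]`, of degree `deg ≥ 1`, with `n` basis functions.  The knot vector
proper consists of `knot 0, …, knot (n + deg)`; the sequence is continued by the value `1`. -/
structure KnotVector where
  deg : ℕ
  one_le_deg : 1 ≤ deg
  n : ℕ
  deg_lt_n : deg < n
  knot : ℕ → ℝ
  mono : Monotone knot
  knot_first : ∀ i, i ≤ deg → knot i = 0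
  knot_last : ∀ i, n ≤ i → knot i = 1
  /-- Interior knots have multiplicity at most `deg` (so that all splines are continuous), and the
  end knots `0` and `1` have multiplicity exactly `deg + 1`. -/
  mult_le : ∀ i, 1 ≤ i → i < n → knot i < knot (i + deg)

/-- The univariate B-spline `N_{i,p}` for the knots `t`, by the Cox-de Boor recursion (with the
convention `0/0 = 0`).  The degree-zero functions are indicators of the half-open knot spans; the
last nonempty span is closed at the right end point `1`. -/
def bspline (t : ℕ → ℝ) : ℕ → ℕ → ℝ → ℝ
  | 0, i, x =>
      open Classical in
      if (t i ≤ x ∧ x < t (i + 1)) ∨ (t i < x ∧ x = t (i + 1) ∧ x = 1) then 1 else 0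
  | p + 1, i, x =>
      (x - t i) / (t (i + p + 1) - t i) * bspline t p i x
        + (t (i + p + 2) - x) / (t (i + p + 2) - t (i + 1)) * bspline t p (i + 1) x

/-- Multi-indices of the tensor-product B-splines. -/
abbrev MultiIndex {d : ℕ} (kv : Fin d → KnotVector) := (ι : Fin d) → Fin (kv ι).n

/-- The tensor-product B-spline with multi-index `i`. -/
def tbspline {d : ℕ} (kv : Fin d → KnotVector) (i : MultiIndex kv) (ξ : E d) : ℝ :=
  ∏ ι, bspline (kv ι).knot (kv ι).deg (i ι) (ξ ι)

/-- The geometrical mapping with control points `P`. -/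
def geoMap {d : ℕ} (kv : Fin d → KnotVector) (P : MultiIndex kv → E d) (ξ : E d) : E d :=
  ∑ i, tbspline kv i ξ • P i

/-! ### The parameter domain and its sides -/

/-- The closed parameter domain `[0,1]^d`. -/
def cube (d : ℕ) : Set (E d) := {ξ | ∀ ι, ξ ι ∈ Set.Icc (0 : ℝ) 1}

/-- The open parameter domain `(0,1)^d`. -/
def openCube (d : ℕ) : Set (E d) := {ξ | ∀ ι, ξ ι ∈ Set.Ioo (0 : ℝ) 1}

/-- A side of the parameter domain: `(ι, false)` is `ξ_ι = 0` and `(ι, true)` is `ξ_ι = 1`. -/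
abbrev Side (d : ℕ) := Fin d × Bool

/-- The fixed value of the coordinate `s.1` on the side `s`. -/
def Side.val {d : ℕ} (s : Side d) : ℝ := if s.2 then 1 else 0

/-- The closed facet of the cube on which all the sides in `S` meet (a side, an edge, a vertex). -/
def facet {d : ℕ} (S : Set (Side d)) : Set (E d) := {ξ ∈ cube d | ∀ s ∈ S, ξ s.1 = s.val}

/-- The closed side `s` as a set. -/
def Side.set {d : ℕ} (s : Side d) : Set (E d) := {ξ ∈ cube d | ξ s.1 = s.val}

/-- The parametrization of the side `s` by the remaining `d - 1` coordinates. -/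
def Side.embed {d : ℕ} (s : Side d) (η : {j : Fin d // j ≠ s.1} → ℝ) : E d :=
  WithLp.toLp 2 fun j => if h : j = s.1 then s.val else η ⟨j, h⟩

/-- The outer unit normal of the cube on the side `s`. -/
def Side.cubeNormal {d : ℕ} (s : Side d) : E d :=
  EuclideanSpace.single s.1 (if s.2 then (1 : ℝ) else -1)

/-! ### A single patch -/

/-- A patch: knot vectors, and control points of a geometrical mapping that is injective on the
closed parameter domain. -/
structure Patch (d : ℕ) where
  kv : Fin d → KnotVector
  ctrl : MultiIndex kv → E d
  inj : Set.InjOn (geoMap kv ctrl) (cube d)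

namespace Patch

variable {d : ℕ} (Q : Patch d)

/-- The geometrical mapping `G`. -/
def G : E d → E d := geoMap Q.kv Q.ctrl

/-- The inverse of `G` on the closed patch. -/
def Ginv : E d → E d := Function.invFunOn Q.G (cube d)

/-- The Jacobian of `G` (one-sided at the boundary of the parameter domain). -/
def DG (ξ : E d) : E d →L[ℝ] E d := fderivWithin ℝ Q.G (cube d) ξ

/-- The (open) patch `Ω = G((0,1)^d)`. -/
def Ω : Set (E d) := Q.G '' openCube d

/-- The closed patch. -/
def Ωbar : Set (E d) := Q.G '' cube d

/-- The patch diameter `H`. -/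
def H : ℝ := Metric.diam Q.Ω

/-- The cell of the parameter mesh with index `i` (degenerate if a knot is repeated). -/
def cell (i : MultiIndex Q.kv) : Set (E d) :=
  {ξ | ∀ ι, ξ ι ∈ Set.Icc ((Q.kv ι).knot (i ι)) ((Q.kv ι).knot ((i ι : ℕ) + 1))}

/-- The mesh size `h`: the largest diameter of a cell of the physical mesh.  (Degenerate cells are
contained in proper ones, so they do not change the value.) -/
def h : ℝ := ⨆ i : MultiIndex Q.kv, Metric.diam (Q.G '' Q.cell i)

/-- The B-spline basis function `N_i ∘ G⁻¹` on the closed patch, extended by zero. -/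
def basis (i : MultiIndex Q.kv) : E d → ℝ :=
  Q.Ωbar.indicator fun x => tbspline Q.kv i (Q.Ginv x)

/-- The physical gradient on the closed patch: the usual gradient at interior points, the one-sided
gradient (the trace of the gradient) at boundary points. -/
def grad (u : E d → ℝ) (x : E d) : E d := gradientWithin u Q.Ωbar x

/-- The outer unit normal of the patch at a point `x` of the image of the side `s`: the direction
of `DG^{-T} n̂`. -/
def normal (s : Side d) (x : E d) : E d :=
  let w := (ContinuousLinearMap.adjoint (Q.DG (Q.Ginv x)).inverse) s.cubeNormal
  ‖w‖⁻¹ • w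

/-- The normal derivative at a point `x` of the image of the side `s`. -/
def normalDeriv (s : Side d) (u : E d → ℝ) (x : E d) : ℝ :=
  inner ℝ (Q.grad u x) (Q.normal s x)

/-- The surface element of the side `s` (the square root of the Gram determinant of the tangent
vectors of the parametrization `G ∘ s.embed`). -/
def surfaceElement (s : Side d) (ξ : E d) : ℝ :=
  Real.sqrt (Matrix.gram ℝ fun j : {j : Fin d // j ≠ s.1} =>
    Q.DG ξ (EuclideanSpace.single (j : Fin d) (1 : ℝ))).det

/-- The surface integral of `f` over the image of the side `s`. -/
def sideIntegral (s : Side d) (f : E d → ℝ) : ℝ :=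
  ∫ η in {η : {j : Fin d // j ≠ s.1} → ℝ | ∀ j, η j ∈ Set.Icc (0 : ℝ) 1},
    f (Q.G (s.embed η)) * Q.surfaceElement s (s.embed η)

/-- The geometry is regular with constant `κ`: the Jacobian of `G` is bounded by `κ H`, and its
inverse by `κ / H`, where `H` is the patch diameter. -/
def GeometryRegular (κ : ℝ) : Prop :=
  ∀ ξ ∈ cube d, DifferentiableWithinAt ℝ Q.G (cube d) ξ →
    ∀ v : E d, ‖Q.DG ξ v‖ ≤ κ * Q.H * ‖v‖ ∧ Q.H * ‖v‖ ≤ κ * ‖Q.DG ξ v‖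

/-- The mesh is quasi-uniform with constant `θ`: every knot span is at most `θ` times as long as
every nonempty knot span. -/
def QuasiUniform (θ : ℝ) : Prop :=
  ∀ ι ι' : Fin d, ∀ i j : ℕ, (Q.kv ι).knot i < (Q.kv ι).knot (i + 1) →
    (Q.kv ι').knot (j + 1) - (Q.kv ι').knot j ≤
      θ * ((Q.kv ι).knot (i + 1) - (Q.kv ι).knot i)

end Patch

/-! ### Multipatch domains -/

/-- A multipatch domain with `N` non-overlapping, geometrically matching patches; the meshes of
different patches are unrelated.  `dirichlet k` is the set of those sides of the patch `k` that form
the Dirichlet boundary. -/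
structure MultiPatch (d N : ℕ) where
  patch : Fin N → Patch d
  disjoint : ∀ k l, k ≠ l → Disjoint (patch k).Ω (patch l).Ω
  /-- Two closed patches meet along common (closed) sides, edges or vertices. -/
  matching : ∀ k l, k ≠ l → ∀ x ∈ (patch k).Ωbar ∩ (patch l).Ωbar,
    ∃ S T : Set (Side d), S.Nonempty ∧ T.Nonempty ∧ x ∈ (patch k).G '' facet S ∧
      (patch k).G '' facet S = (patch l).G '' facet T
  dirichlet : Fin N → Set (Side d)
  /-- Dirichlet sides are not shared with another patch. -/
  dirichlet_boundary : ∀ k, ∀ s ∈ dirichlet k, ∀ l, l ≠ k → ∀ t : Side d,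
    (patch k).G '' s.set ≠ (patch l).G '' t.set

namespace MultiPatch

variable {d N : ℕ} (M : MultiPatch d N)

/-- The sides of the patch `k` that are also sides of the patch `l`. -/
def sharedSides (k l : Fin N) : Finset (Side d) :=
  open Classical in
  Finset.univ.filter fun s => ∃ t : Side d, (M.patch k).G '' s.set = (M.patch l).G '' t.set

/-- The set `I_F^{(k)}` of the patches that have a common edge / face (2D / 3D) with patch `k`. -/
def neighbors (k : Fin N) : Finset (Fin N) :=
  open Classical in
  Finset.univ.filter fun l => l ≠ k ∧ (M.sharedSides k l).Nonempty

/-- The common edge / face `F^{(kl)}`. -/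
def F (k l : Fin N) : Set (E d) := ⋃ s ∈ M.sharedSides k l, (M.patch k).G '' s.set

/-- The interface `Γ^{(k)}` of patch `k`. -/
def Γ (k : Fin N) : Set (E d) := ⋃ l ∈ M.neighbors k, M.F k l

/-- The surface integral over `F^{(kl)}`; the integrand may depend on the side (through the
normal). -/
def faceIntegral (k l : Fin N) (f : Side d → E d → ℝ) : ℝ :=
  ∑ s ∈ M.sharedSides k l, (M.patch k).sideIntegral s (f s)

/-- The basis functions of patch `k` that vanish on the Dirichlet boundary. -/
def basisSet (k : Fin N) : Set (E d → ℝ) :=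
  {φ | ∃ i, φ = (M.patch k).basis i ∧
    ∀ s ∈ M.dirichlet k, ∀ x ∈ (M.patch k).G '' s.set, φ x = 0}

/-- The patch space `V_h^{(k)}` (including the Dirichlet conditions). -/
def V (k : Fin N) : Submodule ℝ (E d → ℝ) := Submodule.span ℝ (M.basisSet k)

/-- The span of the basis functions of patch `l` whose support (the set where the function does not
vanish) meets the set `A`. -/
def Vsupp (l : Fin N) (A : Set (E d)) : Submodule ℝ (E d → ℝ) :=
  Submodule.span ℝ {φ ∈ M.basisSet l | (Function.support φ ∩ A).Nonempty}

/-- The space `V_{h,e}^{(k)} = V_h^{(k)} × ∏_l V_h^{(k)}(F^{(lk)})` of the extended patch.  Its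
elements are families `u`, where `u k` is the component on the patch `k` and `u l`, for a neighbor
`l`, is the component on `F^{(lk)}`; all the other components are zero. -/
def Vext (k : Fin N) : Submodule ℝ (Fin N → E d → ℝ) :=
  open Classical in
  Submodule.pi Set.univ fun l =>
    if l = k then M.V k else if l ∈ M.neighbors k then M.Vsupp l (M.F l k) else ⊥

/-- The space `W^{(k)}` of interface functions, spanned by the basis functions that do not vanish
on the extended interface. -/
def W (k : Fin N) : Submodule ℝ (Fin N → E d → ℝ) :=
  open Classical in
  Submodule.pi Set.univ fun l =>
    if l = k then M.Vsupp k (M.Γ k)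
    else if l ∈ M.neighbors k then M.Vsupp l (M.F l k) else ⊥

/-- The interior space `V_{I,h}^{(k)}`: the functions in `V_h^{(k)}` that vanish on the interface,
as a subspace of `V_{h,e}^{(k)}` (with vanishing components on the neighbors). -/
def VI (k : Fin N) : Submodule ℝ (Fin N → E d → ℝ) where
  carrier := {v | v k ∈ M.V k ∧ (∀ x ∈ M.Γ k, v k x = 0) ∧ ∀ l, l ≠ k → v l = 0}
  add_mem' := by
    rintro a b ⟨ha, ha', ha''⟩ ⟨hb, hb', hb''⟩
    refine ⟨Submodule.add_mem _ ha hb, fun x hx => ?_, fun l hl => ?_⟩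
    · simp [ha' x hx, hb' x hx]
    · simp [ha'' l hl, hb'' l hl]
  zero_mem' := ⟨Submodule.zero_mem _, fun _ _ => rfl, fun _ _ => rfl⟩
  smul_mem' := by
    rintro c a ⟨ha, ha', ha''⟩
    refine ⟨Submodule.smul_mem _ c ha, fun x hx => ?_, fun l hl => ?_⟩
    · simp [ha' x hx]
    · simp [ha'' l hl]

/-- The harmonic average `h^{(kl)}` of the mesh sizes. -/
def hAvg (k l : Fin N) : ℝ :=
  2 * (M.patch k).h * (M.patch l).h / ((M.patch k).h + (M.patch l).h)

/-- The bilinear form `a^{(k)}`. -/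
def a (α : Fin N → ℝ) (k : Fin N) (u v : Fin N → E d → ℝ) : ℝ :=
  ∫ x in (M.patch k).Ω,
    α k * inner ℝ ((M.patch k).grad (u k) x) ((M.patch k).grad (v k) x)

/-- The bilinear form `s^{(k)}` (consistency and symmetry terms). -/
def s (α : Fin N → ℝ) (k : Fin N) (u v : Fin N → E d → ℝ) : ℝ :=
  ∑ l ∈ M.neighbors k, M.faceIntegral k l fun σ x =>
    α k / 2 * ((M.patch k).normalDeriv σ (u k) x * (v l x - v k x)
      + (M.patch k).normalDeriv σ (v k) x * (u l x - u k x))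

/-- The penalty form `p^{(k)}`. -/
def p (α : Fin N → ℝ) (δ : ℝ) (k : Fin N) (u v : Fin N → E d → ℝ) : ℝ :=
  ∑ l ∈ M.neighbors k, M.faceIntegral k l fun _ x =>
    δ * α k / (2 * M.hAvg k l) * ((u l x - u k x) * (v l x - v k x))

/-- The interior penalty form `a_e^{(k)} = a^{(k)} + s^{(k)} + p^{(k)}`. -/
def ae (α : Fin N → ℝ) (δ : ℝ) (k : Fin N) (u v : Fin N → E d → ℝ) : ℝ :=
  M.a α k u v + M.s α k u v + M.p α δ k u v

/-- The form `d^{(k)} = a^{(k)} + p^{(k)}` of the broken energy norm. -/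
def dForm (α : Fin N → ℝ) (δ : ℝ) (k : Fin N) (u v : Fin N → E d → ℝ) : ℝ :=
  M.a α k u v + M.p α δ k u v

/-- `w` is the discrete harmonic extension of the interface function `u`, in the sense of the form
`B`: it lies in `V_{h,e}^{(k)}`, it is `B`-orthogonal to `V_{I,h}^{(k)}`, and it agrees with `u` on
the extended interface, i.e. on `Γ^{(k)}` and in all the components on the neighboring faces. -/
def IsHarmonicExtension (B : (Fin N → E d → ℝ) → (Fin N → E d → ℝ) → ℝ) (k : Fin N)
    (u w : Fin N → E d → ℝ) : Prop :=
  w ∈ M.Vext k ∧ (∀ v ∈ M.VI k, B w v = 0) ∧ (∀ x ∈ M.Γ k, w k x = u k x) ∧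
    ∀ l ∈ M.neighbors k, w l = u l

end MultiPatch

end IgA

end

namespace IgA

open Polynomial Set Filter Topology

/-! ### Polynomial pieces of B-splines -/

/-! Let w be the standard and w_e the extended extension, and v = w - w_e. Both have the same
interface data, so v lies in `VI`: it has no neighbor components and no jump on the interface. Hence
p(w, w) = p(w_e, w_e). When v is the test function, the penalty and one half of s drop out; what is
left of s is `consistency`, which pairs the normal derivative of v with the jump of w_e.

From a(w, v) = 0 follows the Pythagorean identity a(w_e, w_e) = a(w, w) + a(v, v), which is the left
inequality. From a_e(w_e, v) = 0 follows a(v, v) = consistency(w_e, v). Young's inequality with a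
weight proportional to h^(k) and an inverse trace inequality with constant K bound this by a(v, v)/2
+ (K/2) p(w_e, w_e), so a(v, v) ≤ K p(w_e, w_e) and C = 1 + K (`dForm_estimates`). The neighboring
meshes enter only through h^(kl) ≤ 2 h^(k), and δ ≥ 1 suffices (`jumpSq_le_p`).

For solvability, both forms coincide with a on `VI`, whatever δ is. There a is definite: zero energy
means constant on the patch (`eq_of_energy_eq_zero`), and the function vanishes on an interface or
Dirichlet side. The space is finite-dimensional, so injectivity gives surjectivity onto the dual
(`existsUnique_harmonicExtension`).

The inverse trace inequality (`sideIntegral_normalDeriv_le`) rests on finite differences. On a cell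
the pulled-back gradient is annihilated by differences of order P + 1, so its value on the side is a
fixed combination of its values at equally spaced points further inside. Squaring, and integrating
over the spacing and over the side, bounds the trace by the volume integral. Regularity of the
geometry transfers this to the patch, and the powers of H cancel.

The constant must not depend on N, so the sum over neighbors has to be a sum over at most 2d sides.
This needs the fact that a side is shared with only one other patch (`eq_of_mem_sharedSides`): by a
Sard argument, almost every point of a shared side has a regular transition map, and next to such a
point each neighbor covers an outward segment in the coordinates of the given patch, so two
neighbors would overlap. -/

/-- The polynomial with which the B-spline of degree `p` and index `i` coincides on the `j`-th knot
span. -/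
noncomputable def splinePiece (t : ℕ → ℝ) (j : ℕ) : ℕ → ℕ → ℝ[X]
  | 0, i => if i = j then 1 else 0
  | p + 1, i =>
      C ((t (i + p + 1) - t i)⁻¹) * (X - C (t i)) * splinePiece t j p i
        + C ((t (i + p + 2) - t (i + 1))⁻¹) * (C (t (i + p + 2)) - X) * splinePiece t j p (i + 1)

theorem natDegree_splinePiece_le (t : ℕ → ℝ) (j p i : ℕ) :
    (splinePiece t j p i).natDegree ≤ p := by
  induction p generalizing i with
  | zero => unfold splinePiece; split_ifs <;> simp
  | succ p ih =>
    have key : ∀ (a : ℝ) (q r : ℝ[X]), q.natDegree ≤ 1 → r.natDegree ≤ p →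
        (C a * q * r).natDegree ≤ p + 1 := by
      intro a q r hq hr
      refine natDegree_mul_le.trans ?_
      have := natDegree_C_mul_le a q
      omega
    unfold splinePiece
    refine natDegree_add_le_of_degree_le (key _ _ _ ?_ (ih _)) (key _ _ _ ?_ (ih _))
    · exact (natDegree_X_sub_C_le _)
    · refine (natDegree_sub_le _ _).trans (by simp)

theorem eval_splinePiece_succ (t : ℕ → ℝ) (j p i : ℕ) (x : ℝ) :
    (splinePiece t j (p + 1) i).eval x =
      (x - t i) / (t (i + p + 1) - t i) * (splinePiece t j p i).eval x
        + (t (i + p + 2) - x) / (t (i + p + 2) - t (i + 1))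
          * (splinePiece t j p (i + 1)).eval x := by
  simp only [splinePiece, eval_add, eval_mul, eval_C, eval_sub, eval_X]
  ring

/-- Functions and pieces obey the same recursion, so only the degree-zero case carries information
about the knots. -/
theorem bspline_eq_eval_splinePiece_of_zero {t : ℕ → ℝ} {j : ℕ} {x : ℝ}
    (h : ∀ i, bspline t 0 i x = if i = j then 1 else 0) (p i : ℕ) :
    bspline t p i x = (splinePiece t j p i).eval x := by
  induction p generalizing i with
  | zero => rw [h]; unfold splinePiece; split_ifs <;> simp
  | succ p ih => rw [eval_splinePiece_succ, bspline, ih, ih]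

theorem bspline_eq_eval_splinePiece {t : ℕ → ℝ} (ht : Monotone t) (h1 : ∀ i, t i ≤ 1) {j : ℕ}
    {x : ℝ} (hx : x ∈ Ico (t j) (t (j + 1)) ∨ (t j < x ∧ x = t (j + 1) ∧ x = 1)) (p i : ℕ) :
    bspline t p i x = (splinePiece t j p i).eval x := by
  refine bspline_eq_eval_splinePiece_of_zero (fun i => ?_) p i
  unfold bspline
  by_cases hij : i = j
  · subst hij
    simp only [mem_Ico] at hx
    rw [if_pos hx, if_pos rfl]
  · rw [if_neg hij, if_neg]
    rcases lt_or_gt_of_ne hij with hlt | hlt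
    · have h2 : t (i + 1) ≤ t j := ht hlt
      have h3 : t j ≤ x ∧ (x = t j → x < 1) := by
        rcases hx with hx | hx
        · exact ⟨hx.1, fun _ => hx.2.trans_le (h1 _)⟩
        · exact ⟨hx.1.le, fun h => absurd h hx.1.ne'⟩
      rintro (⟨_, h4⟩ | ⟨_, h4, h5⟩)
      · linarith [h3.1]
      · have : x = t j := by linarith [h3.1]
        linarith [h3.2 this]
    · have h2 : t (j + 1) ≤ t i := ht hlt
      have h3 : x ≤ t (j + 1) ∧ (x = t (j + 1) → x = 1) := by
        rcases hx with hx | hx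
        · exact ⟨hx.2.le, fun h => absurd h hx.2.ne⟩
        · exact ⟨hx.2.1.le, fun _ => hx.2.2⟩
      rintro (⟨h4, h6⟩ | ⟨h6, h4, h5⟩)
      · have : x = t (j + 1) := by linarith [h3.1]
        linarith [h3.2 this, h1 (i + 1)]
      · linarith [h3.1]

/-- At a knot, the piece of the span ending there keeps a Kronecker delta as long as the degree is
at most the multiplicity: in each step the surviving weight is 1 and the only competing weight is 0.
The mirror statement follows; the two deltas coincide exactly when degree and multiplicity are
equal. -/
theorem eval_splinePiece_left {t : ℕ → ℝ} {j m : ℕ} {x : ℝ} (hj : t j < x)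
    (hx : ∀ i, j + 1 ≤ i → i ≤ j + m → t i = x) {p : ℕ} (hp : p ≤ m) (i : ℕ) :
    (splinePiece t j p i).eval x = if i = j then 1 else 0 := by
  induction p generalizing i with
  | zero => unfold splinePiece; split_ifs <;> simp
  | succ p ih =>
    rw [eval_splinePiece_succ, ih (by omega), ih (by omega)]
    by_cases h : i = j
    · subst h
      rw [hx (i + p + 1) (by omega) (by omega)]
      simp [div_self (sub_pos.2 hj).ne']
    · by_cases h' : i + 1 = j
      · subst h'
        rw [hx (i + p + 2) (by omega) (by omega)]
        simp
      · simp [h, h']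

theorem eval_splinePiece_right {t : ℕ → ℝ} {j m : ℕ} {x : ℝ} (hj : x < t (j + m + 1))
    (hx : ∀ i, j + 1 ≤ i → i ≤ j + m → t i = x) {p : ℕ} (hp : p ≤ m) (i : ℕ) :
    (splinePiece t (j + m) p i).eval x = if i + p = j + m then 1 else 0 := by
  induction p generalizing i with
  | zero => unfold splinePiece; simp only [add_zero]; split_ifs <;> simp
  | succ p ih =>
    rw [eval_splinePiece_succ, ih (by omega), ih (by omega)]
    by_cases h : i + (p + 1) = j + m
    · rw [if_neg (by omega), if_pos (by omega), if_pos h, hx (i + 1) (by omega) (by omega),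
        show i + p + 2 = j + m + 1 by omega, mul_zero, mul_one, zero_add,
        div_self (sub_pos.2 hj).ne']
    · rw [if_neg h, if_neg (by omega : ¬ i + 1 + p = j + m), mul_zero, add_zero]
      split_ifs with h'
      · rw [hx i (by omega) (by omega)]
        simp
      · simp

/-- The pieces on both sides of a knot of multiplicity `m ≤ p` agree at this knot. -/
theorem eval_splinePiece_eq {t : ℕ → ℝ} {j m : ℕ} {x : ℝ} (hj : t j < x)
    (hj' : x < t (j + m + 1)) (hx : ∀ i, j + 1 ≤ i → i ≤ j + m → t i = x) {p : ℕ} (hp : m ≤ p)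
    (i : ℕ) : (splinePiece t j p i).eval x = (splinePiece t (j + m) p i).eval x := by
  induction p, hp using Nat.le_induction generalizing i with
  | base =>
    rw [eval_splinePiece_left hj hx le_rfl, eval_splinePiece_right hj' hx le_rfl]
    simp
  | succ p _ ih => rw [eval_splinePiece_succ, eval_splinePiece_succ, ih, ih]

/-! ### Knot spans of an open knot vector, and B-splines on closed spans. -/

namespace KnotVector

variable (K : KnotVector)

theorem knot_le_one (i : ℕ) : K.knot i ≤ 1 :=
  (K.mono (le_max_left i K.n)).trans (K.knot_last _ (le_max_right _ _)).le

theorem knot_nonneg (i : ℕ) : 0 ≤ K.knot i :=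
  (K.knot_first 0 (Nat.zero_le _)).ge.trans (K.mono (Nat.zero_le i))

theorem lt_n_of_knot_lt {j : ℕ} (hj : K.knot j < K.knot (j + 1)) : j < K.n := by
  by_contra h
  rw [K.knot_last j (by omega), K.knot_last (j + 1) (by omega)] at hj
  exact lt_irrefl _ hj

theorem exists_span_Ico {x : ℝ} (h0 : 0 ≤ x) (h1 : x < 1) :
    ∃ j, x ∈ Ico (K.knot j) (K.knot (j + 1)) := by
  have hex : ∃ j, x < K.knot j := ⟨K.n, by rwa [K.knot_last _ le_rfl]⟩
  classical
  have h2 := Nat.find_spec hex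
  have h3 : Nat.find hex ≠ 0 := by
    intro h
    rw [h, K.knot_first 0 (Nat.zero_le _)] at h2
    linarith
  obtain ⟨j, hj⟩ := Nat.exists_eq_succ_of_ne_zero h3
  refine ⟨j, not_lt.1 (Nat.find_min hex (by omega)), ?_⟩
  rwa [hj] at h2

theorem last_span : K.knot (K.n - 1) < 1 ∧ K.knot (K.n - 1 + 1) = 1 := by
  have h1 := K.one_le_deg
  have h2 := K.deg_lt_n
  refine ⟨?_, K.knot_last _ (by omega)⟩
  have := K.mult_le (K.n - 1) (by omega) (by omega)
  rwa [K.knot_last (K.n - 1 + K.deg) (by omega)] at this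

/-- Every point of `[0,1]` lies in a nonempty closed knot span; a point that is not an interior
knot has this span as a neighborhood within `[0,1]`. -/
theorem exists_span {x : ℝ} (hx : x ∈ Icc (0 : ℝ) 1) :
    ∃ j, K.knot j < K.knot (j + 1) ∧ x ∈ Icc (K.knot j) (K.knot (j + 1)) ∧
      ((x = 0 ∨ x = 1 ∨ ∀ i, x ≠ K.knot i) →
        Icc (K.knot j) (K.knot (j + 1)) ∈ 𝓝[Icc 0 1] x) := by
  rcases hx.2.lt_or_eq with h1 | rfl
  · obtain ⟨j, hj⟩ := K.exists_span_Ico hx.1 h1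
    refine ⟨j, hj.1.trans_lt hj.2, ⟨hj.1, hj.2.le⟩, ?_⟩
    rintro (rfl | rfl | h)
    · have : K.knot j = 0 := le_antisymm hj.1 (K.knot_nonneg j)
      rw [this] at hj ⊢
      refine mem_of_superset (inter_mem_nhdsWithin _ (Iio_mem_nhds hj.2)) ?_
      rintro y ⟨hy, hy'⟩
      exact ⟨hy.1, le_of_lt hy'⟩
    · exact absurd h1 (lt_irrefl _)
    · exact mem_nhdsWithin_of_mem_nhds (Icc_mem_nhds (hj.1.lt_of_ne (h j).symm) hj.2)
  · obtain ⟨h2, h3⟩ := K.last_span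
    refine ⟨K.n - 1, by rwa [h3], ⟨h2.le, h3.ge⟩, fun _ => ?_⟩
    rw [h3]
    refine mem_of_superset (inter_mem_nhdsWithin _ (Ioi_mem_nhds h2)) ?_
    rintro y ⟨hy, hy'⟩
    exact ⟨le_of_lt hy', hy.2⟩

/-- The issue is the right end point, where the half-open convention evaluates the B-spline with the
next nonempty span. The multiplicity bound makes the two pieces agree there, so closed cells can be
used throughout. -/
theorem bspline_eq_eval {j : ℕ} (hj : K.knot j < K.knot (j + 1)) (i : ℕ) {x : ℝ}
    (hx : x ∈ Icc (K.knot j) (K.knot (j + 1))) :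
    bspline K.knot K.deg i x = (splinePiece K.knot j K.deg i).eval x := by
  rcases hx.2.lt_or_eq with h1 | h1
  · exact bspline_eq_eval_splinePiece K.mono K.knot_le_one (Or.inl ⟨hx.1, h1⟩) _ _
  rcases (K.knot_le_one (j + 1)).lt_or_eq with h2 | h2
  -- At an interior knot the next nonempty span is number `j + m`, where `m` is the multiplicity of
  -- that knot.
  · obtain ⟨j', hj'⟩ := K.exists_span_Ico (K.knot_nonneg (j + 1)) h2
    have hjj : j < j' := by
      by_contra h
      have := K.mono (show j' + 1 ≤ j + 1 by omega)
      linarith [hj'.2]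
    obtain ⟨m, rfl⟩ := Nat.exists_eq_add_of_le hjj.le
    have hknot : ∀ i, j + 1 ≤ i → i ≤ j + m → K.knot i = x := fun i hi hi' =>
      le_antisymm ((K.mono hi').trans (hj'.1.trans h1.ge)) (h1.le.trans (K.mono hi))
    have hn : j + 1 < K.n := by
      by_contra h
      rw [K.knot_last (j + 1) (by omega)] at h2
      exact lt_irrefl _ h2
    have hm : m ≤ K.deg := by
      by_contra h
      have h3 := K.mult_le (j + 1) (by omega) hn
      have h4 := K.mono (show j + 1 + K.deg ≤ j + m by omega)
      linarith [hj'.1]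
    rw [eval_splinePiece_eq (h1 ▸ hj) (h1 ▸ hj'.2) hknot hm]
    refine bspline_eq_eval_splinePiece K.mono K.knot_le_one (Or.inl ?_) _ _
    rwa [h1]
  · exact bspline_eq_eval_splinePiece K.mono K.knot_le_one
      (Or.inr ⟨h1 ▸ hj, h1, h1.trans h2⟩) _ _

end KnotVector

end IgA

namespace IgA

open Set Filter Topology Finset

variable {d : ℕ} {F : Type*} [NormedAddCommGroup F] [NormedSpace ℝ F]

/-! ### Pieces of tensor-product splines -/

/-- This is the n-th forward difference with step `h`, reduced to step 1 by an affine substitution.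
-/
theorem _root_.Polynomial.sum_choose_mul_eval_eq_zero {q : Polynomial ℝ} {n : ℕ}
    (hq : q.natDegree < n) (x h : ℝ) :
    ∑ i ∈ range (n + 1), ((-1 : ℝ) ^ (n - i) * n.choose i) * q.eval (x + i * h) = 0 := by
  have h1 : (q.comp (Polynomial.C h * Polynomial.X + Polynomial.C x)).natDegree < n := by
    refine lt_of_le_of_lt Polynomial.natDegree_comp_le ?_
    have : (Polynomial.C h * Polynomial.X + Polynomial.C x).natDegree ≤ 1 :=
      Polynomial.natDegree_linear_le
    nlinarith
  have h2 := congrFun (Polynomial.fwdDiff_iter_eq_zero_of_degree_lt h1) 0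
  rw [fwdDiff_iter_eq_sum_shift] at h2
  simp only [Pi.zero_apply] at h2
  rw [← h2]
  refine sum_congr rfl fun i _ => ?_
  simp only [Polynomial.eval_comp, Polynomial.eval_add, Polynomial.eval_mul, Polynomial.eval_C,
    Polynomial.eval_X, zsmul_eq_mul, nsmul_eq_mul, mul_one, zero_add]
  push_cast
  rw [mul_comm (i : ℝ) h, add_comm x]

/-- A continuously differentiable function all of whose finite differences of order `n` in the
coordinate directions vanish; an example is a polynomial of coordinate degree less than `n`. -/
structure IsPiece (n : ℕ) (f : E d → F) : Prop where
  contDiff : ContDiff ℝ 1 f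
  diff : ∀ (ι : Fin d) (ξ : E d) (τ : ℝ), ∑ i ∈ range (n + 1),
    ((-1 : ℝ) ^ (n - i) * n.choose i) • f (ξ + (i * τ) • EuclideanSpace.single ι (1 : ℝ)) = 0

namespace IsPiece

variable {n : ℕ} {f g : E d → F}

theorem zero : IsPiece n (0 : E d → F) := ⟨contDiff_const, by simp⟩

theorem add (hf : IsPiece n f) (hg : IsPiece n g) : IsPiece n (f + g) :=
  ⟨hf.contDiff.add hg.contDiff, fun ι ξ τ => by
    simp only [Pi.add_apply, smul_add, sum_add_distrib, hf.diff, hg.diff, add_zero]⟩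

theorem clm_comp {F' : Type*} [NormedAddCommGroup F'] [NormedSpace ℝ F'] (L : F →L[ℝ] F')
    (hf : IsPiece n f) : IsPiece n fun ξ => L (f ξ) :=
  ⟨L.contDiff.comp hf.contDiff, fun ι ξ τ => by
    simp only [← map_smul, ← map_sum, hf.diff, map_zero]⟩

theorem differentiable (hf : IsPiece n f) : Differentiable ℝ f :=
  hf.contDiff.differentiable (by simp)

theorem continuous_fderiv (hf : IsPiece n f) : Continuous (fderiv ℝ f) :=
  hf.contDiff.continuous_fderiv (by simp)

/-- The difference identity holds at every base point, so it may be differentiated. This makes the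
inverse estimate available for gradients without differentiating polynomials explicitly. -/
theorem diff_fderiv (hf : IsPiece n f) (ι : Fin d) (ξ : E d) (τ : ℝ) :
    ∑ i ∈ range (n + 1), ((-1 : ℝ) ^ (n - i) * n.choose i) •
      fderiv ℝ f (ξ + (i * τ) • EuclideanSpace.single ι (1 : ℝ)) = 0 := by
  have h1 : HasFDerivAt (fun ξ => ∑ i ∈ range (n + 1), ((-1 : ℝ) ^ (n - i) * n.choose i) •
      f (ξ + (i * τ) • EuclideanSpace.single ι (1 : ℝ)))
      (∑ i ∈ range (n + 1), ((-1 : ℝ) ^ (n - i) * n.choose i) •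
      fderiv ℝ f (ξ + (i * τ) • EuclideanSpace.single ι (1 : ℝ))) ξ := by
    refine HasFDerivAt.fun_sum fun i _ => HasFDerivAt.const_smul ?_ _
    exact (hasFDerivAt_comp_add_right _).2 (hf.differentiable _).hasFDerivAt
  have h2 : (fun ξ => ∑ i ∈ range (n + 1), ((-1 : ℝ) ^ (n - i) * n.choose i) •
      f (ξ + (i * τ) • EuclideanSpace.single ι (1 : ℝ))) = fun _ => 0 :=
    funext fun ξ => hf.diff ι ξ τ
  rw [h2] at h1
  exact h1.unique (hasFDerivAt_const _ _)

/-- A shift in one coordinate changes one factor only, so the univariate identity applies. -/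
theorem prod_eval {q : Fin d → Polynomial ℝ} (hq : ∀ ι, (q ι).natDegree < n) :
    IsPiece n fun ξ : E d => ∏ ι, (q ι).eval (ξ ι) := by
  refine ⟨contDiff_prod fun ι _ => ?_, fun ι ξ τ => ?_⟩
  · exact (by simpa using (q ι).contDiff_aeval (𝕜 := ℝ) 1 : ContDiff ℝ 1 fun x : ℝ => (q ι).eval x).comp (EuclideanSpace.proj (𝕜 := ℝ) ι).contDiff
  · have h : ∀ i : ℕ, ∏ j, (q j).eval ((ξ + ((i : ℝ) * τ) • EuclideanSpace.single ι (1 : ℝ)) j) =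
        (q ι).eval (ξ ι + i * τ) * ∏ j ∈ univ.erase ι, (q j).eval (ξ j) := by
      intro i
      rw [← mul_prod_erase univ _ (mem_univ ι)]
      congr 1
      · simp
      · refine prod_congr rfl fun j hj => ?_
        simp [(mem_erase.1 hj).1]
    simp only [h, smul_eq_mul, ← mul_assoc, ← sum_mul]
    rw [Polynomial.sum_choose_mul_eval_eq_zero (hq ι), zero_mul]

end IsPiece

/-! ### The parameter domain -/

theorem continuous_coord (ι : Fin d) : Continuous fun ξ : E d => ξ ι :=
  (EuclideanSpace.proj (𝕜 := ℝ) ι).continuous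

theorem isCompact_box (a b : Fin d → ℝ) : IsCompact {ξ : E d | ∀ ι, ξ ι ∈ Icc (a ι) (b ι)} := by
  have h := (isCompact_univ_pi fun ι => isCompact_Icc (a := a ι) (b := b ι)).image
    (PiLp.continuous_toLp 2 fun _ : Fin d => ℝ)
  convert h using 1
  ext ξ
  constructor
  · intro hξ
    exact ⟨ξ.ofLp, fun ι _ => hξ ι, rfl⟩
  · rintro ⟨η, hη, rfl⟩ ι
    exact hη ι (mem_univ ι)

theorem convex_box (a b : Fin d → ℝ) : Convex ℝ {ξ : E d | ∀ ι, ξ ι ∈ Icc (a ι) (b ι)} := by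
  rw [ofPred_forall]
  exact convex_iInter fun ι =>
    (convex_Icc _ _).linear_preimage (EuclideanSpace.proj (𝕜 := ℝ) ι).toLinearMap

theorem isOpen_openBox (a b : Fin d → ℝ) : IsOpen {ξ : E d | ∀ ι, ξ ι ∈ Ioo (a ι) (b ι)} := by
  rw [ofPred_forall]
  exact isOpen_iInter_of_finite fun ι => isOpen_Ioo.preimage (continuous_coord ι)

theorem closure_openBox {a b : Fin d → ℝ} (h : ∀ ι, a ι < b ι) :
    {ξ : E d | ∀ ι, ξ ι ∈ Icc (a ι) (b ι)} ⊆ closure {ξ : E d | ∀ ι, ξ ι ∈ Ioo (a ι) (b ι)} := by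
  intro ξ hξ
  have h1 : ξ.ofLp ∈ closure (univ.pi fun ι => Ioo (a ι) (b ι)) := by
    rw [closure_pi_set]
    intro ι _
    exact (closure_Ioo (h ι).ne).ge (hξ ι)
  have h2 := image_closure_subset_closure_image (PiLp.continuous_toLp 2 fun _ : Fin d => ℝ)
    (mem_image_of_mem _ h1)
  refine closure_mono ?_ h2
  rintro _ ⟨η, hη, rfl⟩ ι
  exact hη ι (mem_univ ι)

theorem isCompact_cube : IsCompact (cube d) := isCompact_box (fun _ => 0) fun _ => 1

theorem isOpen_openCube : IsOpen (openCube d) := isOpen_openBox (fun _ => 0) fun _ => 1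

theorem openCube_subset_cube : openCube d ⊆ cube d := fun _ hξ ι => Ioo_subset_Icc_self (hξ ι)

theorem convex_cube : Convex ℝ (cube d) := convex_box (fun _ => 0) fun _ => 1

theorem openCube_nonempty : (openCube d).Nonempty :=
  ⟨WithLp.toLp 2 fun _ => 1 / 2, fun ι => by norm_num⟩

theorem uniqueDiffOn_cube : UniqueDiffOn ℝ (cube d) :=
  uniqueDiffOn_convex convex_cube
    (openCube_nonempty.mono (interior_maximal openCube_subset_cube isOpen_openCube))

theorem volume_hyperplane (ι : Fin d) (a : ℝ) : volume {ξ : E d | ξ ι = a} = 0 := by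
  have h := (PiLp.volume_preserving_ofLp (Fin d)).measure_preimage
    (s := {x : Fin d → ℝ | x ι = a}) (measurableSet_eq_fun (measurable_pi_apply ι)
      measurable_const).nullMeasurableSet
  rw [volume_pi, Measure.pi_hyperplane] at h
  exact h

/-! ### Cells of a patch -/

namespace Patch

variable (Q : Patch d)

/-- The cell with index `c` is not degenerate. -/
def Proper (c : MultiIndex Q.kv) : Prop :=
  ∀ ι, (Q.kv ι).knot (c ι) < (Q.kv ι).knot ((c ι : ℕ) + 1)

theorem cell_subset_cube (c : MultiIndex Q.kv) : Q.cell c ⊆ cube d := fun _ hξ ι =>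
  ⟨((Q.kv ι).knot_nonneg _).trans (hξ ι).1, (hξ ι).2.trans ((Q.kv ι).knot_le_one _)⟩

theorem isCompact_cell (c : MultiIndex Q.kv) : IsCompact (Q.cell c) := isCompact_box _ _

theorem convex_cell (c : MultiIndex Q.kv) : Convex ℝ (Q.cell c) := convex_box _ _

/-- Every point of the cube lies in a proper cell, which is a neighborhood of the point within the
cube if no coordinate is an interior knot. -/
theorem exists_cell {ξ : E d} (hξ : ξ ∈ cube d) :
    ∃ c, Q.Proper c ∧ ξ ∈ Q.cell c ∧
      ((∀ ι, ξ ι = 0 ∨ ξ ι = 1 ∨ ∀ i, ξ ι ≠ (Q.kv ι).knot i) → Q.cell c ∈ 𝓝[cube d] ξ) := by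
  choose j hj hj' hj'' using fun ι => (Q.kv ι).exists_span (hξ ι)
  refine ⟨fun ι => ⟨j ι, (Q.kv ι).lt_n_of_knot_lt (hj ι)⟩, hj, hj', fun h => ?_⟩
  have h1 : ∀ ι, ∀ᶠ ζ in 𝓝[cube d] ξ,
      ζ ι ∈ Icc ((Q.kv ι).knot (j ι)) ((Q.kv ι).knot (j ι + 1)) := fun ι =>
    ((continuous_coord ι).continuousWithinAt.tendsto_nhdsWithin
      (fun ζ (hζ : ζ ∈ cube d) => hζ ι)) (hj'' ι (h ι))
  exact eventually_all.2 h1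

/-- The points of the closed parameter domain that have a proper cell as a neighborhood within the
parameter domain. -/
def reg : Set (E d) := {ξ ∈ cube d | ∃ c, Q.Proper c ∧ Q.cell c ∈ 𝓝[cube d] ξ}

theorem reg_subset_cube : Q.reg ⊆ cube d := fun _ h => h.1

theorem mem_reg {ξ : E d} (hξ : ξ ∈ cube d)
    (h : ∀ ι, ξ ι = 0 ∨ ξ ι = 1 ∨ ∀ i, ξ ι ≠ (Q.kv ι).knot i) : ξ ∈ Q.reg := by
  obtain ⟨c, hc, _, hc'⟩ := Q.exists_cell hξ
  exact ⟨hξ, c, hc, hc' h⟩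

theorem reg_mem_nhdsWithin {ξ : E d} (hξ : ξ ∈ Q.reg) : Q.reg ∈ 𝓝[cube d] ξ := by
  obtain ⟨_, c, hc, hc'⟩ := hξ
  filter_upwards [eventually_eventually_nhdsWithin.2 hc', self_mem_nhdsWithin] with ζ h1 h2
  exact ⟨h2, c, hc, h1⟩

theorem isOpen_reg_inter : IsOpen (Q.reg ∩ openCube d) := by
  rw [isOpen_iff_mem_nhds]
  rintro ξ ⟨h1, h2⟩
  have h3 : openCube d ∈ 𝓝 ξ := isOpen_openCube.mem_nhds h2
  have h4 : 𝓝[cube d] ξ = 𝓝 ξ :=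
    nhdsWithin_eq_nhds.2 (mem_of_superset h3 openCube_subset_cube)
  exact inter_mem (h4 ▸ Q.reg_mem_nhdsWithin h1) h3

theorem openCell_subset_reg {c : MultiIndex Q.kv} (hc : Q.Proper c) :
    {ξ : E d | ∀ ι, ξ ι ∈ Ioo ((Q.kv ι).knot (c ι)) ((Q.kv ι).knot ((c ι : ℕ) + 1))} ⊆
      Q.reg ∩ openCube d := by
  intro ξ hξ
  have h1 : ξ ∈ Q.cell c := fun ι => Ioo_subset_Icc_self (hξ ι)
  refine ⟨⟨Q.cell_subset_cube c h1, c, hc, mem_nhdsWithin_of_mem_nhds ?_⟩, fun ι =>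
    ⟨((Q.kv ι).knot_nonneg _).trans_lt (hξ ι).1, (hξ ι).2.trans_le ((Q.kv ι).knot_le_one _)⟩⟩
  exact mem_of_superset ((isOpen_openBox _ _).mem_nhds hξ) fun ζ hζ ι => Ioo_subset_Icc_self (hζ ι)

/-- The exceptional set lies in countably many knot hyperplanes; the boundary is included because 0
and 1 are knots. -/
theorem volume_cube_diff_reg : volume (cube d \ (Q.reg ∩ openCube d)) = 0 := by
  have h : cube d \ (Q.reg ∩ openCube d) ⊆ ⋃ ι : Fin d, ⋃ i : ℕ, {ξ | ξ ι = (Q.kv ι).knot i} := by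
    rintro ξ ⟨h1, h2⟩
    by_contra h3
    simp only [mem_iUnion, mem_ofPred_eq, not_exists] at h3
    refine h2 ⟨Q.mem_reg h1 fun ι => Or.inr (Or.inr (h3 ι)), fun ι =>
      ⟨(h1 ι).1.lt_of_ne fun h => ?_, (h1 ι).2.lt_of_ne fun h => ?_⟩⟩
    · exact h3 ι 0 (by rw [(Q.kv ι).knot_first 0 (Nat.zero_le _), h])
    · exact h3 ι (Q.kv ι).n (by rw [(Q.kv ι).knot_last _ le_rfl, h])
  refine measure_mono_null h ?_
  simp only [measure_iUnion_null_iff]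
  exact fun ι i => volume_hyperplane ι _

/-! ### Functions that are smooth on each cell -/

/-- The function coincides on every proper closed cell with a smooth function whose finite
differences of order `n` vanish. -/
def IsCellwise (n : ℕ) (f : E d → F) : Prop :=
  ∀ c, Q.Proper c → ∃ g, IsPiece n g ∧ EqOn f g (Q.cell c)

namespace IsCellwise

variable {Q} {n : ℕ} {f g : E d → F}

theorem zero : Q.IsCellwise n (0 : E d → F) := fun _ _ => ⟨0, IsPiece.zero, fun _ _ => rfl⟩

theorem add (hf : Q.IsCellwise n f) (hg : Q.IsCellwise n g) : Q.IsCellwise n (f + g) := by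
  intro c hc
  obtain ⟨f', hf', hf''⟩ := hf c hc
  obtain ⟨g', hg', hg''⟩ := hg c hc
  exact ⟨f' + g', hf'.add hg', fun ξ hξ => by simp [hf'' hξ, hg'' hξ]⟩

theorem clm_comp {F' : Type*} [NormedAddCommGroup F'] [NormedSpace ℝ F'] (L : F →L[ℝ] F')
    (hf : Q.IsCellwise n f) : Q.IsCellwise n fun ξ => L (f ξ) := by
  intro c hc
  obtain ⟨f', hf', hf''⟩ := hf c hc
  exact ⟨_, hf'.clm_comp L, fun ξ hξ => by simp [hf'' hξ]⟩

theorem sum {κ : Type*} (s : Finset κ) {f : κ → E d → F} (hf : ∀ i ∈ s, Q.IsCellwise n (f i)) :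
    Q.IsCellwise n (∑ i ∈ s, f i) :=
  Finset.sum_induction f (Q.IsCellwise n) (fun _ _ => add) zero hf

theorem congr (hf : Q.IsCellwise n f) (h : EqOn f g (cube d)) : Q.IsCellwise n g := by
  intro c hc
  obtain ⟨f', hf', hf''⟩ := hf c hc
  exact ⟨f', hf', fun ξ hξ => (h (Q.cell_subset_cube c hξ)).symm.trans (hf'' hξ)⟩

/-- Finitely many closed cells cover the cube, and agreement on closed cells makes the pieces glue.
-/
theorem continuousOn (hf : Q.IsCellwise n f) : ContinuousOn f (cube d) := by
  have h1 : cube d = ⋃ c : {c // Q.Proper c}, Q.cell c := by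
    ext ξ
    constructor
    · intro hξ
      obtain ⟨c, hc, hc', _⟩ := Q.exists_cell hξ
      exact mem_iUnion.2 ⟨⟨c, hc⟩, hc'⟩
    · intro hξ
      obtain ⟨c, hc⟩ := mem_iUnion.1 hξ
      exact Q.cell_subset_cube _ hc
  rw [h1]
  refine (locallyFinite_of_finite _).continuousOn_iUnion (fun c => (Q.isCompact_cell _).isClosed)
    fun c => ?_
  obtain ⟨f', hf', hf''⟩ := hf c c.2
  exact hf'.contDiff.continuous.continuousOn.congr hf''

theorem hasFDerivWithinAt_of_eqOn {c : MultiIndex Q.kv} {ξ : E d}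
    (hc : Q.cell c ∈ 𝓝[cube d] ξ) (hξ : ξ ∈ cube d) (hg : DifferentiableAt ℝ g ξ)
    (h : EqOn f g (Q.cell c)) : HasFDerivWithinAt f (fderiv ℝ g ξ) (cube d) ξ :=
  hg.hasFDerivAt.hasFDerivWithinAt.congr_of_eventuallyEq (mem_of_superset hc h)
    (h (mem_of_mem_nhdsWithin hξ hc))

theorem fderivWithin_of_eqOn {c : MultiIndex Q.kv} {ξ : E d}
    (hc : Q.cell c ∈ 𝓝[cube d] ξ) (hξ : ξ ∈ cube d) (hg : DifferentiableAt ℝ g ξ)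
    (h : EqOn f g (Q.cell c)) : fderivWithin ℝ f (cube d) ξ = fderiv ℝ g ξ :=
  (hasFDerivWithinAt_of_eqOn hc hξ hg h).fderivWithin (uniqueDiffOn_cube ξ hξ)

theorem hasFDerivWithinAt (hf : Q.IsCellwise n f) {ξ : E d} (hξ : ξ ∈ Q.reg) :
    HasFDerivWithinAt f (fderivWithin ℝ f (cube d) ξ) (cube d) ξ := by
  obtain ⟨hξ', c, hc, hc'⟩ := hξ
  obtain ⟨f', hf', hf''⟩ := hf c hc
  exact (hasFDerivWithinAt_of_eqOn hc' hξ'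
    (hf'.differentiable ξ) hf'').differentiableWithinAt.hasFDerivWithinAt

theorem continuousOn_fderivWithin (hf : Q.IsCellwise n f) :
    ContinuousOn (fderivWithin ℝ f (cube d)) Q.reg := by
  intro ξ hξ
  obtain ⟨hξ', c, hc, hc'⟩ := hξ
  obtain ⟨f', hf', hf''⟩ := hf c hc
  refine (ContinuousWithinAt.congr_of_eventuallyEq (f := fderiv ℝ f')
    hf'.continuous_fderiv.continuousWithinAt ?_
    (fderivWithin_of_eqOn hc' hξ' (hf'.differentiable ξ) hf'')).mono Q.reg_subset_cube
  filter_upwards [eventually_eventually_nhdsWithin.2 hc', self_mem_nhdsWithin] with ζ h1 h2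
  exact fderivWithin_of_eqOn h1 h2 (hf'.differentiable ζ) hf''

theorem bounded_fderivWithin (hf : Q.IsCellwise n f) :
    ∃ C : ℝ, ∀ ξ ∈ Q.reg, ‖fderivWithin ℝ f (cube d) ξ‖ ≤ C := by
  classical
  have h1 : ∀ c : MultiIndex Q.kv, ∃ C : ℝ, 0 ≤ C ∧ (Q.Proper c → ∀ ξ ∈ Q.reg,
      Q.cell c ∈ 𝓝[cube d] ξ → ‖fderivWithin ℝ f (cube d) ξ‖ ≤ C) := by
    intro c
    by_cases hc : Q.Proper c
    · obtain ⟨f', hf', hf''⟩ := hf c hc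
      obtain ⟨C, hC⟩ := (Q.isCompact_cell c).exists_bound_of_continuousOn
        hf'.continuous_fderiv.continuousOn
      refine ⟨max C 0, le_max_right _ _, fun _ ξ hξ hξ' => ?_⟩
      rw [fderivWithin_of_eqOn hξ' hξ.1 (hf'.differentiable ξ) hf'']
      exact (hC ξ (mem_of_mem_nhdsWithin hξ.1 hξ')).trans (le_max_left _ _)
    · exact ⟨0, le_rfl, fun h => absurd h hc⟩
  choose C hC0 hC using h1
  refine ⟨∑ c, C c, fun ξ hξ => ?_⟩
  obtain ⟨hξ', c, hc, hc'⟩ := id hξ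
  exact (hC c hc ξ hξ hc').trans (single_le_sum (fun c _ => hC0 c) (mem_univ c))

end IsCellwise

theorem isCellwise_tbspline {P : ℕ} (hP : ∀ ι, (Q.kv ι).deg ≤ P) (i : MultiIndex Q.kv) :
    Q.IsCellwise (P + 1) (tbspline Q.kv i) := by
  intro c hc
  refine ⟨_, IsPiece.prod_eval (q := fun ι => splinePiece (Q.kv ι).knot (c ι) (Q.kv ι).deg (i ι))
    fun ι => ?_, fun ξ hξ => ?_⟩
  · exact Nat.lt_succ_of_le ((natDegree_splinePiece_le _ _ _ _).trans (hP ι))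
  · exact prod_congr rfl fun ι _ => (Q.kv ι).bspline_eq_eval (hc ι) _ (hξ ι)

theorem isCellwise_G {P : ℕ} (hP : ∀ ι, (Q.kv ι).deg ≤ P) : Q.IsCellwise (P + 1) Q.G := by
  have h : Q.G = ∑ i, fun ξ => (ContinuousLinearMap.toSpanSingleton ℝ (Q.ctrl i))
      (tbspline Q.kv i ξ) := by
    ext1 ξ
    simp [Patch.G, geoMap]
  rw [h]
  exact IsCellwise.sum _ fun i _ => (Q.isCellwise_tbspline hP i).clm_comp _

theorem exists_deg_le : ∃ P, ∀ ι, (Q.kv ι).deg ≤ P :=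
  ⟨∑ ι, (Q.kv ι).deg, fun ι => single_le_sum (f := fun ι => (Q.kv ι).deg)
    (fun _ _ => Nat.zero_le _) (mem_univ ι)⟩

end Patch

end IgA

namespace IgA

open Set Filter Topology Finset

variable {d : ℕ}

/-- The matrix entries in the standard basis are at most `‖A‖`, and the Leibniz formula has `d!`
terms. -/
theorem _root_.ContinuousLinearMap.abs_det_le (A : E d →L[ℝ] E d) :
    |A.det| ≤ d.factorial * ‖A‖ ^ d := by
  classical
  have h1 : A.det = (LinearMap.toMatrix (EuclideanSpace.basisFun (Fin d) ℝ).toBasis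
      (EuclideanSpace.basisFun (Fin d) ℝ).toBasis A).det := by
    rw [LinearMap.det_toMatrix]
  rw [h1]
  refine (Matrix.det_le (abv := AbsoluteValue.abs) (x := ‖A‖) fun i j => ?_).trans (by simp)
  rw [LinearMap.toMatrix_apply]
  simp only [OrthonormalBasis.coe_toBasis, EuclideanSpace.basisFun_apply,
    OrthonormalBasis.coe_toBasis_repr_apply, EuclideanSpace.basisFun_repr]
  refine (PiLp.norm_apply_le _ i).trans ((A.le_opNorm _).trans ?_)
  simp

namespace Patch

variable (Q : Patch d)

/-! ### The geometrical mapping and its inverse -/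

theorem continuousOn_G : ContinuousOn Q.G (cube d) := by
  obtain ⟨P, hP⟩ := Q.exists_deg_le
  exact (Q.isCellwise_G hP).continuousOn

theorem isCompact_Ωbar : IsCompact Q.Ωbar := isCompact_cube.image_of_continuousOn Q.continuousOn_G

theorem Ginv_G {ξ : E d} (hξ : ξ ∈ cube d) : Q.Ginv (Q.G ξ) = ξ :=
  Q.inj.leftInvOn_invFunOn hξ

theorem Ginv_mem {x : E d} (hx : x ∈ Q.Ωbar) : Q.Ginv x ∈ cube d :=
  Function.invFunOn_mem hx

theorem G_Ginv {x : E d} (hx : x ∈ Q.Ωbar) : Q.G (Q.Ginv x) = x :=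
  Function.invFunOn_eq hx

theorem G_mem_Ωbar {ξ : E d} (hξ : ξ ∈ cube d) : Q.G ξ ∈ Q.Ωbar := mem_image_of_mem _ hξ

theorem Ω_subset_Ωbar : Q.Ω ⊆ Q.Ωbar := image_mono openCube_subset_cube

/-- A continuous injection of a compact set is closed: the preimage of a closed set under the
inverse is the image of a compact set. -/
theorem continuousOn_Ginv : ContinuousOn Q.Ginv Q.Ωbar := by
  rw [continuousOn_iff_isClosed]
  intro t ht
  refine ⟨Q.G '' (t ∩ cube d), ((isCompact_cube.inter_left ht).image_of_continuousOn
    (Q.continuousOn_G.mono inter_subset_right)).isClosed, ?_⟩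
  ext x
  constructor
  · rintro ⟨h1, h2⟩
    exact ⟨⟨Q.Ginv x, ⟨h1, Q.Ginv_mem h2⟩, Q.G_Ginv h2⟩, h2⟩
  · rintro ⟨⟨ξ, h1, rfl⟩, h2⟩
    refine ⟨?_, h2⟩
    rw [Set.mem_preimage, Q.Ginv_G h1.2]
    exact h1.1

theorem Ginv_mem_openCube {x : E d} (hx : x ∈ Q.Ω) : Q.Ginv x ∈ openCube d := by
  obtain ⟨ξ, hξ, rfl⟩ := hx
  rwa [Q.Ginv_G (openCube_subset_cube hξ)]

theorem hasFDerivWithinAt_G {ξ : E d} (hξ : ξ ∈ Q.reg) :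
    HasFDerivWithinAt Q.G (Q.DG ξ) (cube d) ξ := by
  obtain ⟨P, hP⟩ := Q.exists_deg_le
  exact (Q.isCellwise_G hP).hasFDerivWithinAt hξ

theorem continuousOn_DG : ContinuousOn Q.DG Q.reg := by
  obtain ⟨P, hP⟩ := Q.exists_deg_le
  exact (Q.isCellwise_G hP).continuousOn_fderivWithin

theorem exists_mem_cell : ∃ c, Q.Proper c := by
  obtain ⟨ξ, hξ⟩ := openCube_nonempty (d := d)
  obtain ⟨c, hc, _⟩ := Q.exists_cell (openCube_subset_cube hξ)
  exact ⟨c, hc⟩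

theorem reg_inter_openCube_nonempty : (Q.reg ∩ openCube d).Nonempty := by
  obtain ⟨c, hc⟩ := Q.exists_mem_cell
  refine Nonempty.mono (Q.openCell_subset_reg hc) ?_
  exact ⟨WithLp.toLp 2 fun ι => ((Q.kv ι).knot (c ι) + (Q.kv ι).knot ((c ι : ℕ) + 1)) / 2,
    fun ι => ⟨by have := hc ι; simp only; linarith, by have := hc ι; simp only; linarith⟩⟩

theorem H_pos (hd : 0 < d) : 0 < Q.H := by
  have h1 : (WithLp.toLp 2 fun _ => 1 / 2 : E d) ∈ openCube d := fun ι => by norm_num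
  have h2 : (WithLp.toLp 2 fun _ => 1 / 3 : E d) ∈ openCube d := fun ι => by norm_num
  have h3 : Q.G (WithLp.toLp 2 fun _ => 1 / 2) ≠ Q.G (WithLp.toLp 2 fun _ => 1 / 3) := by
    intro h
    have := congrArg (fun ξ : E d => ξ ⟨0, hd⟩)
      (Q.inj (openCube_subset_cube h1) (openCube_subset_cube h2) h)
    norm_num at this
  exact (dist_pos.2 h3).trans_le (Metric.dist_le_diam_of_mem
    (Q.isCompact_Ωbar.isBounded.subset Q.Ω_subset_Ωbar) (mem_image_of_mem _ h1)
    (mem_image_of_mem _ h2))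

variable {Q} {κ : ℝ}

theorem GeometryRegular.norm_DG_apply_le (h : Q.GeometryRegular κ) {ξ : E d} (hξ : ξ ∈ Q.reg)
    (v : E d) : ‖Q.DG ξ v‖ ≤ κ * Q.H * ‖v‖ :=
  (h ξ hξ.1 (Q.hasFDerivWithinAt_G hξ).differentiableWithinAt v).1

theorem GeometryRegular.norm_DG_le (h : Q.GeometryRegular κ) (hκ : 0 ≤ κ) {ξ : E d}
    (hξ : ξ ∈ Q.reg) : ‖Q.DG ξ‖ ≤ κ * Q.H :=
  ContinuousLinearMap.opNorm_le_bound _ (mul_nonneg hκ Metric.diam_nonneg)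
    (h.norm_DG_apply_le hξ)

theorem GeometryRegular.exists_equiv (h : Q.GeometryRegular κ) (hd : 0 < d) {ξ : E d}
    (hξ : ξ ∈ Q.reg) : ∃ A : E d ≃L[ℝ] E d, (A : E d →L[ℝ] E d) = Q.DG ξ := by
  have h1 : Function.Injective (Q.DG ξ : E d →ₗ[ℝ] E d) := by
    rw [← LinearMap.ker_eq_bot, LinearMap.ker_eq_bot']
    intro v hv
    have h2 := (h ξ hξ.1 (Q.hasFDerivWithinAt_G hξ).differentiableWithinAt v).2
    have h3 : Q.DG ξ v = 0 := hv
    rw [h3, norm_zero, mul_zero] at h2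
    have h4 := Q.H_pos hd
    exact norm_eq_zero.1 (le_antisymm (by nlinarith [norm_nonneg v]) (norm_nonneg v))
  refine ⟨(LinearEquiv.ofInjectiveEndo _ h1).toContinuousLinearEquiv, ?_⟩
  ext1 v
  rfl

theorem GeometryRegular.norm_inverse_le (h : Q.GeometryRegular κ) (hκ : 0 ≤ κ) (hd : 0 < d)
    {ξ : E d} (hξ : ξ ∈ Q.reg) : ‖(Q.DG ξ).inverse‖ ≤ κ / Q.H := by
  have hH := Q.H_pos hd
  refine ContinuousLinearMap.opNorm_le_bound _ (by positivity) fun v => ?_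
  obtain ⟨A, hA⟩ := h.exists_equiv hd hξ
  have h1 := (h ξ hξ.1 (Q.hasFDerivWithinAt_G hξ).differentiableWithinAt (A.symm v)).2
  have h2 : Q.DG ξ (A.symm v) = v := by rw [← hA]; simp
  rw [h2] at h1
  rw [← hA, ContinuousLinearMap.inverse_equiv, div_mul_eq_mul_div, le_div_iff₀ hH, mul_comm]
  exact h1

/-- Apply the upper bound for determinants to the inverse Jacobian. -/
theorem GeometryRegular.le_abs_det (h : Q.GeometryRegular κ) (hκ : 0 < κ) (hd : 0 < d)
    {ξ : E d} (hξ : ξ ∈ Q.reg) : Q.H ^ d ≤ d.factorial * κ ^ d * |(Q.DG ξ).det| := by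
  have hH := Q.H_pos hd
  have h1 := h.norm_inverse_le hκ.le hd hξ
  obtain ⟨A, hA⟩ := h.exists_equiv hd hξ
  rw [← hA, ContinuousLinearMap.inverse_equiv] at h1
  have h2 := (A.symm : E d →L[ℝ] E d).abs_det_le
  have h3 : (A.symm : E d →L[ℝ] E d).det * (A : E d →L[ℝ] E d).det = 1 := by
    have := LinearEquiv.det_symm_mul_det A.toLinearEquiv
    exact this
  have h4 : |(A.symm : E d →L[ℝ] E d).det| * |(A : E d →L[ℝ] E d).det| = 1 := by
    rw [← abs_mul, h3, abs_one]
  rw [← hA]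
  have h5 : |(A.symm : E d →L[ℝ] E d).det| ≤ d.factorial * (κ / Q.H) ^ d :=
    h2.trans (by gcongr)
  have h6 : 1 ≤ d.factorial * (κ / Q.H) ^ d * |(A : E d →L[ℝ] E d).det| := by
    rw [← h4]; gcongr
  rw [div_pow] at h6
  calc Q.H ^ d ≤ Q.H ^ d * (d.factorial * (κ ^ d / Q.H ^ d) * |(A : E d →L[ℝ] E d).det|) :=
        le_mul_of_one_le_right (by positivity) h6
    _ = _ := by field_simp

/-- Positivity of `κ` is not assumed; the lower bound at a single regular point forces it. -/
theorem GeometryRegular.pos (h : Q.GeometryRegular κ) (hd : 0 < d) : 0 < κ := by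
  obtain ⟨ξ, hξ, _⟩ := Q.reg_inter_openCube_nonempty
  have h1 := (h ξ hξ.1 (Q.hasFDerivWithinAt_G hξ).differentiableWithinAt
    (EuclideanSpace.single ⟨0, hd⟩ (1 : ℝ))).2
  have hH := Q.H_pos hd
  simp only [PiLp.norm_single, norm_one, mul_one] at h1
  by_contra hκ
  nlinarith [norm_nonneg (Q.DG ξ (EuclideanSpace.single ⟨0, hd⟩ (1 : ℝ)))]

theorem GeometryRegular.continuousOn_inverse (h : Q.GeometryRegular κ) (hd : 0 < d) :
    ContinuousOn (fun ξ => (Q.DG ξ).inverse) Q.reg := by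
  intro ξ hξ
  obtain ⟨A, hA⟩ := h.exists_equiv hd hξ
  have h1 : ContinuousAt (ContinuousLinearMap.inverse : (E d →L[ℝ] E d) → _) (Q.DG ξ) := by
    rw [← hA]
    exact (contDiffAt_map_inverse (n := 0) A).continuousAt
  exact h1.comp_continuousWithinAt (Q.continuousOn_DG ξ hξ)

/-- The inverse is already known to be continuous, so invertibility of the one-sided derivative
suffices, at boundary points as well. -/
theorem GeometryRegular.hasFDerivWithinAt_Ginv (h : Q.GeometryRegular κ) (hd : 0 < d) {ξ : E d}
    (hξ : ξ ∈ Q.reg) : HasFDerivWithinAt Q.Ginv (Q.DG ξ).inverse Q.Ωbar (Q.G ξ) := by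
  obtain ⟨A, hA⟩ := h.exists_equiv hd hξ
  rw [← hA, ContinuousLinearMap.inverse_equiv]
  have hx := Q.G_mem_Ωbar hξ.1
  refine HasFDerivWithinAt.of_local_left_inverse (t := cube d) (f := Q.G) ?_ ?_ hx ?_
  · exact (Q.continuousOn_Ginv _ hx).tendsto_nhdsWithin fun x hx => Q.Ginv_mem hx
  · rw [Q.Ginv_G hξ.1, hA]
    exact Q.hasFDerivWithinAt_G hξ
  · filter_upwards [self_mem_nhdsWithin] with x hx using Q.G_Ginv hx

/-- Without this the one-sided gradient on the closed patch would not be determined. An invertible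
derivative transports the property from the cube. -/
theorem GeometryRegular.uniqueDiffWithinAt (h : Q.GeometryRegular κ) (hd : 0 < d) {ξ : E d}
    (hξ : ξ ∈ Q.reg) : UniqueDiffWithinAt ℝ Q.Ωbar (Q.G ξ) := by
  obtain ⟨A, hA⟩ := h.exists_equiv hd hξ
  exact (hA ▸ Q.hasFDerivWithinAt_G hξ).uniqueDiffWithinAt_of_continuousLinearEquiv A
    (uniqueDiffOn_cube ξ hξ.1)

/-! ### Gradients -/

variable {P : ℕ} {u v : E d → ℝ}

/-- The chain rule: the derivative on the closed patch in terms of the derivative of the pullback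
to the parameter domain. -/
theorem GeometryRegular.hasFDerivWithinAt (h : Q.GeometryRegular κ) (hd : 0 < d)
    (hu : Q.IsCellwise P (u ∘ Q.G)) {ξ : E d} (hξ : ξ ∈ Q.reg) :
    HasFDerivWithinAt u ((fderivWithin ℝ (u ∘ Q.G) (cube d) ξ).comp (Q.DG ξ).inverse)
      Q.Ωbar (Q.G ξ) := by
  have h1 := h.hasFDerivWithinAt_Ginv hd hξ
  have h2 := hu.hasFDerivWithinAt hξ
  have hx := Q.G_mem_Ωbar hξ.1
  nth_rewrite 2 [← Q.Ginv_G hξ.1] at h2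
  refine (h2.comp (Q.G ξ) h1 fun x hx => Q.Ginv_mem hx).congr (fun x hx => ?_) ?_
  · simp [Q.G_Ginv hx]
  · simp [Q.G_Ginv hx]

theorem GeometryRegular.grad_eq (h : Q.GeometryRegular κ) (hd : 0 < d)
    (hu : Q.IsCellwise P (u ∘ Q.G)) {ξ : E d} (hξ : ξ ∈ Q.reg) :
    Q.grad u (Q.G ξ) = (InnerProductSpace.toDual ℝ (E d)).symm
      ((fderivWithin ℝ (u ∘ Q.G) (cube d) ξ).comp (Q.DG ξ).inverse) := by
  rw [grad, gradientWithin,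
    (h.hasFDerivWithinAt hd hu hξ).fderivWithin (h.uniqueDiffWithinAt hd hξ)]

theorem GeometryRegular.grad_add (h : Q.GeometryRegular κ) (hd : 0 < d)
    (hu : Q.IsCellwise P (u ∘ Q.G)) (hv : Q.IsCellwise P (v ∘ Q.G)) {ξ : E d} (hξ : ξ ∈ Q.reg) :
    Q.grad (u + v) (Q.G ξ) = Q.grad u (Q.G ξ) + Q.grad v (Q.G ξ) := by
  simp only [grad, gradientWithin]
  rw [fderivWithin_add (h.uniqueDiffWithinAt hd hξ)
    (h.hasFDerivWithinAt hd hu hξ).differentiableWithinAt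
    (h.hasFDerivWithinAt hd hv hξ).differentiableWithinAt, map_add]

theorem GeometryRegular.grad_smul (h : Q.GeometryRegular κ) (hd : 0 < d)
    (hu : Q.IsCellwise P (u ∘ Q.G)) (c : ℝ) {ξ : E d} (hξ : ξ ∈ Q.reg) :
    Q.grad (c • u) (Q.G ξ) = c • Q.grad u (Q.G ξ) := by
  simp only [grad, gradientWithin]
  rw [fderivWithin_const_smul (h.uniqueDiffWithinAt hd hξ)
    (h.hasFDerivWithinAt hd hu hξ).differentiableWithinAt, map_smul]

theorem GeometryRegular.continuousOn_grad (h : Q.GeometryRegular κ) (hd : 0 < d)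
    (hu : Q.IsCellwise P (u ∘ Q.G)) : ContinuousOn (fun ξ => Q.grad u (Q.G ξ)) Q.reg := by
  have h1 : ContinuousOn (fun ξ => (InnerProductSpace.toDual ℝ (E d)).symm
      ((fderivWithin ℝ (u ∘ Q.G) (cube d) ξ).comp (Q.DG ξ).inverse)) Q.reg :=
    (InnerProductSpace.toDual ℝ (E d)).symm.continuous.comp_continuousOn
      (hu.continuousOn_fderivWithin.clm_comp (h.continuousOn_inverse hd))
  exact h1.congr fun ξ hξ => h.grad_eq hd hu hξ

theorem GeometryRegular.norm_grad_le (h : Q.GeometryRegular κ) (hd : 0 < d)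
    (hu : Q.IsCellwise P (u ∘ Q.G)) {ξ : E d} (hξ : ξ ∈ Q.reg) :
    ‖Q.grad u (Q.G ξ)‖ ≤ κ / Q.H * ‖fderivWithin ℝ (u ∘ Q.G) (cube d) ξ‖ := by
  rw [h.grad_eq hd hu hξ, LinearIsometryEquiv.norm_map, mul_comm]
  exact (ContinuousLinearMap.opNorm_comp_le _ _).trans
    (mul_le_mul_of_nonneg_left (h.norm_inverse_le (h.pos hd).le hd hξ) (norm_nonneg _))

theorem GeometryRegular.norm_fderivWithin_le (h : Q.GeometryRegular κ) (hd : 0 < d)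
    (hu : Q.IsCellwise P (u ∘ Q.G)) {ξ : E d} (hξ : ξ ∈ Q.reg) :
    ‖fderivWithin ℝ (u ∘ Q.G) (cube d) ξ‖ ≤ κ * Q.H * ‖Q.grad u (Q.G ξ)‖ := by
  rw [h.grad_eq hd hu hξ, LinearIsometryEquiv.norm_map, mul_comm]
  obtain ⟨A, hA⟩ := h.exists_equiv hd hξ
  have h1 : fderivWithin ℝ (u ∘ Q.G) (cube d) ξ =
      ((fderivWithin ℝ (u ∘ Q.G) (cube d) ξ).comp (Q.DG ξ).inverse).comp (Q.DG ξ) := by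
    rw [← hA, ContinuousLinearMap.inverse_equiv]
    ext1 v
    simp
  nth_rewrite 1 [h1]
  exact (ContinuousLinearMap.opNorm_comp_le _ _).trans
    (mul_le_mul_of_nonneg_left (h.norm_DG_le (h.pos hd).le hξ) (norm_nonneg _))

theorem GeometryRegular.bounded_grad (h : Q.GeometryRegular κ) (hd : 0 < d)
    (hu : Q.IsCellwise P (u ∘ Q.G)) : ∃ C : ℝ, ∀ ξ ∈ Q.reg, ‖Q.grad u (Q.G ξ)‖ ≤ C := by
  obtain ⟨C, hC⟩ := hu.bounded_fderivWithin
  have h1 : 0 ≤ κ / Q.H := div_nonneg (h.pos hd).le Metric.diam_nonneg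
  exact ⟨κ / Q.H * C, fun ξ hξ => (h.norm_grad_le hd hu hξ).trans
    (mul_le_mul_of_nonneg_left (hC ξ hξ) h1)⟩

/-! ### Normals and surface elements -/

theorem norm_normal_le (s : Side d) (x : E d) : ‖Q.normal s x‖ ≤ 1 := by
  simp only [normal, norm_smul, norm_inv, norm_norm]
  exact inv_mul_le_one

theorem abs_normalDeriv_le (s : Side d) (u : E d → ℝ) (x : E d) :
    |Q.normalDeriv s u x| ≤ ‖Q.grad u x‖ :=
  (abs_real_inner_le_norm _ _).trans (mul_le_of_le_one_right (norm_nonneg _) (norm_normal_le s x))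

theorem GeometryRegular.continuousOn_normal (h : Q.GeometryRegular κ) (hd : 0 < d)
    (s : Side d) : ContinuousOn (fun ξ => Q.normal s (Q.G ξ)) Q.reg := by
  have h1 : ContinuousOn (fun ξ => ContinuousLinearMap.adjoint (Q.DG ξ).inverse s.cubeNormal)
      Q.reg :=
    (ContinuousLinearMap.adjoint.continuous.comp_continuousOn
      (h.continuousOn_inverse hd)).clm_apply continuousOn_const
  have h2 : ∀ ξ ∈ Q.reg, ContinuousLinearMap.adjoint (Q.DG ξ).inverse s.cubeNormal ≠ 0 := by
    intro ξ hξ h3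
    obtain ⟨A, hA⟩ := h.exists_equiv hd hξ
    -- The vector is nonzero because its pairing with `A n` is the squared length of the cube normal
    -- `n`.
    have h4 : inner ℝ (ContinuousLinearMap.adjoint (Q.DG ξ).inverse s.cubeNormal)
        (A s.cubeNormal) = inner ℝ s.cubeNormal s.cubeNormal := by
      rw [ContinuousLinearMap.adjoint_inner_left, ← hA, ContinuousLinearMap.inverse_equiv]
      simp
    rw [h3, inner_zero_left, eq_comm, inner_self_eq_zero, Side.cubeNormal] at h4
    have := congrArg (fun ξ : E d => ξ s.1) h4
    simp only [PiLp.single_apply, if_true, PiLp.zero_apply] at this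
    split_ifs at this <;> norm_num at this
  refine ContinuousOn.congr ((h1.norm.inv₀ fun ξ hξ => norm_ne_zero_iff.2 (h2 ξ hξ)).smul h1)
    fun ξ hξ => ?_
  simp only [normal, Q.Ginv_G hξ.1]
  rfl

theorem continuousOn_surfaceElement (s : Side d) : ContinuousOn (Q.surfaceElement s) Q.reg := by
  unfold surfaceElement
  refine Real.continuous_sqrt.comp_continuousOn ?_
  simp only [Matrix.det_apply, Matrix.gram_apply]
  refine continuousOn_finsetSum _ fun σ _ => ContinuousOn.const_smul ?_ _
  refine continuousOn_finsetProd _ fun j _ => ?_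
  exact (Q.continuousOn_DG.clm_apply continuousOn_const).inner
    (Q.continuousOn_DG.clm_apply continuousOn_const)

theorem surfaceElement_nonneg (s : Side d) (ξ : E d) : 0 ≤ Q.surfaceElement s ξ :=
  Real.sqrt_nonneg _

/-- The Gram matrix has size `d - 1` and entries at most `(κ H)²`. The square root of the resulting
factorial is replaced by the factorial itself. -/
theorem GeometryRegular.surfaceElement_le (h : Q.GeometryRegular κ) (hd : 0 < d) (s : Side d)
    {ξ : E d} (hξ : ξ ∈ Q.reg) :
    Q.surfaceElement s ξ ≤ (d - 1).factorial * (κ * Q.H) ^ (d - 1) := by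
  have hb : 0 ≤ κ * Q.H := mul_nonneg (h.pos hd).le Metric.diam_nonneg
  have h1 : ∀ j : Fin d, ‖Q.DG ξ (EuclideanSpace.single j (1 : ℝ))‖ ≤ κ * Q.H := fun j =>
    (h.norm_DG_apply_le hξ _).trans (by simp)
  have h2 := Matrix.det_le (abv := AbsoluteValue.abs) (x := (κ * Q.H) ^ 2)
    (A := Matrix.gram ℝ fun j : {j : Fin d // j ≠ s.1} =>
      Q.DG ξ (EuclideanSpace.single (j : Fin d) (1 : ℝ))) fun i j => by
    rw [Matrix.gram_apply, sq]
    exact (abs_real_inner_le_norm _ _).trans (mul_le_mul (h1 _) (h1 _) (norm_nonneg _) hb)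
  have h3 : Fintype.card {j : Fin d // j ≠ s.1} = d - 1 := by
    rw [Fintype.card_subtype_compl]
    simp
  rw [h3, nsmul_eq_mul] at h2
  refine Real.sqrt_le_iff.2 ⟨by positivity, (le_abs_self _).trans (h2.trans ?_)⟩
  rw [mul_pow (_ : ℝ) (_ ^ (d - 1)), ← pow_mul, ← pow_mul, mul_comm 2 (d - 1)]
  gcongr
  exact_mod_cast Nat.le_self_pow (by norm_num) _

/-! ### The mesh size -/

theorem diam_le_h (c : MultiIndex Q.kv) : Metric.diam (Q.G '' Q.cell c) ≤ Q.h :=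
  le_ciSup (f := fun c => Metric.diam (Q.G '' Q.cell c)) (finite_range _).bddAbove c

variable (Q) in
theorem h_pos (hd : 0 < d) : 0 < Q.h := by
  obtain ⟨c, hc⟩ := Q.exists_mem_cell
  refine lt_of_lt_of_le ?_ (diam_le_h c)
  have h1 : (WithLp.toLp 2 fun ι => (Q.kv ι).knot (c ι) : E d) ∈ Q.cell c := fun ι =>
    ⟨le_rfl, (hc ι).le⟩
  have h2 : (WithLp.toLp 2 fun ι => (Q.kv ι).knot ((c ι : ℕ) + 1) : E d) ∈ Q.cell c := fun ι =>
    ⟨(hc ι).le, le_rfl⟩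
  have h3 := fun h => (hc ⟨0, hd⟩).ne (congrArg (fun ξ : E d => ξ ⟨0, hd⟩)
    (Q.inj (Q.cell_subset_cube c h1) (Q.cell_subset_cube c h2) h))
  exact (dist_pos.2 h3).trans_le (Metric.dist_le_diam_of_mem
    (Q.isCompact_Ωbar.isBounded.subset (image_mono (Q.cell_subset_cube c)))
    (mem_image_of_mem _ h1) (mem_image_of_mem _ h2))

theorem exists_proper_superset (c : MultiIndex Q.kv) : ∃ c', Q.Proper c' ∧ Q.cell c ⊆ Q.cell c' := by
  have h : ∀ ι, ∃ j : Fin (Q.kv ι).n, (Q.kv ι).knot j < (Q.kv ι).knot ((j : ℕ) + 1) ∧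
      Icc ((Q.kv ι).knot (c ι)) ((Q.kv ι).knot ((c ι : ℕ) + 1)) ⊆
        Icc ((Q.kv ι).knot j) ((Q.kv ι).knot ((j : ℕ) + 1)) := by
    intro ι
    rcases ((Q.kv ι).mono (Nat.le_succ (c ι))).lt_or_eq with h | h
    · exact ⟨c ι, h, Subset.rfl⟩
    · obtain ⟨j, h1, h2, _⟩ := (Q.kv ι).exists_span
        ⟨(Q.kv ι).knot_nonneg (c ι), (Q.kv ι).knot_le_one (c ι)⟩
      refine ⟨⟨j, (Q.kv ι).lt_n_of_knot_lt h1⟩, h1, ?_⟩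
      have h3 : (Q.kv ι).knot ((c ι : ℕ) + 1) = (Q.kv ι).knot (c ι) := h.symm
      rw [h3, Set.Icc_self, Set.singleton_subset_iff]
      exact h2
  choose c' h1 h2 using h
  exact ⟨c', h1, fun ξ hξ ι => h2 ι (hξ ι)⟩

/-- The Jacobian bound on the open cell passes to the closed cell by continuity of the derivative of
the piece; then the mean value inequality applies, the cell being convex. -/
theorem GeometryRegular.dist_le (h : Q.GeometryRegular κ) (hd : 0 < d) {c : MultiIndex Q.kv}
    (hc : Q.Proper c) {ξ ζ : E d} (hξ : ξ ∈ Q.cell c) (hζ : ζ ∈ Q.cell c) :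
    dist (Q.G ξ) (Q.G ζ) ≤ κ * Q.H * dist ξ ζ := by
  obtain ⟨P, hP⟩ := Q.exists_deg_le
  obtain ⟨g, hg, hg'⟩ := Q.isCellwise_G hP c hc
  have hb : 0 ≤ κ * Q.H := mul_nonneg (h.pos hd).le Metric.diam_nonneg
  have h1 : Q.cell c ⊆ {ξ | ‖fderiv ℝ g ξ‖ ≤ κ * Q.H} := by
    refine (closure_openBox hc).trans (closure_minimal (fun ξ hξ => ?_)
      (isClosed_le hg.continuous_fderiv.norm continuous_const))
    have h2 := Q.openCell_subset_reg hc hξ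
    have h3 : Q.cell c ∈ 𝓝 ξ := mem_of_superset ((isOpen_openBox _ _).mem_nhds hξ)
      fun ζ hζ ι => Ioo_subset_Icc_self (hζ ι)
    have h4 := h.norm_DG_le (h.pos hd).le h2.1
    rwa [DG, IsCellwise.fderivWithin_of_eqOn (mem_nhdsWithin_of_mem_nhds h3) h2.1.1
      (hg.differentiable ξ) hg'] at h4
  rw [dist_comm, dist_comm ξ, dist_eq_norm, dist_eq_norm, hg' hξ, hg' hζ]
  exact (Q.convex_cell c).norm_image_sub_le_of_norm_hasFDerivWithin_le
    (fun ξ _ => (hg.differentiable ξ).hasFDerivAt.hasFDerivWithinAt) h1 hξ hζ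

theorem GeometryRegular.h_le (h : Q.GeometryRegular κ) (hd : 0 < d) {L : ℝ} (hL : 0 ≤ L)
    (hL' : ∀ ι i, (Q.kv ι).knot (i + 1) - (Q.kv ι).knot i ≤ L) :
    Q.h ≤ κ * Q.H * (√d * L) := by
  have hb : 0 ≤ κ * Q.H := mul_nonneg (h.pos hd).le Metric.diam_nonneg
  have : Nonempty (MultiIndex Q.kv) := ⟨Q.exists_mem_cell.choose⟩
  refine ciSup_le fun c => Metric.diam_le_of_forall_dist_le (by positivity) ?_
  rintro _ ⟨ξ, hξ, rfl⟩ _ ⟨ζ, hζ, rfl⟩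
  obtain ⟨c', hc', hcc⟩ := exists_proper_superset c
  refine (h.dist_le hd hc' (hcc hξ) (hcc hζ)).trans (mul_le_mul_of_nonneg_left ?_ hb)
  rw [EuclideanSpace.dist_eq, Real.sqrt_le_left (by positivity), mul_pow,
    Real.sq_sqrt (Nat.cast_nonneg _)]
  refine (Finset.sum_le_card_nsmul _ _ (L ^ 2) fun ι _ => ?_).trans (by simp)
  have h1 := hL' ι (c ι)
  have h2 := hξ ι
  have h3 := hζ ι
  refine pow_le_pow_left₀ dist_nonneg ?_ 2
  rw [Real.dist_eq, abs_le]
  constructor <;> linarith [h2.1, h2.2, h3.1, h3.2]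

end Patch

end IgA

namespace IgA

open Set Filter Topology Finset

variable {d : ℕ}

namespace Patch

variable {Q : Patch d} {κ : ℝ} {P : ℕ} {u v : E d → ℝ}

/-! ### Integrals over the patch -/

-- Differentiable maps preserve null sets, but `G` is only differentiable cell by cell, so the set
-- is split first.
variable (Q) in
theorem volume_image_eq_zero {S : Set (E d)} (hS : S ⊆ cube d) (h0 : volume S = 0) :
    volume (Q.G '' S) = 0 := by
  obtain ⟨P, hP⟩ := Q.exists_deg_le
  have h1 : Q.G '' S ⊆ ⋃ c : {c // Q.Proper c}, Q.G '' (S ∩ Q.cell c) := by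
    rintro _ ⟨ξ, hξ, rfl⟩
    obtain ⟨c, hc, hc', _⟩ := Q.exists_cell (hS hξ)
    exact mem_iUnion.2 ⟨⟨c, hc⟩, mem_image_of_mem _ ⟨hξ, hc'⟩⟩
  refine measure_mono_null h1 (measure_iUnion_null fun c => ?_)
  obtain ⟨g, hg, hg'⟩ := Q.isCellwise_G hP c c.2
  refine addHaar_image_eq_zero_of_differentiableOn_of_addHaar_eq_zero volume ?_
    (measure_mono_null inter_subset_left h0)
  exact hg.differentiable.differentiableOn.congr fun ξ hξ => hg' hξ.2

variable (Q) in
/-- The points of the open parameter domain in the interior of a cell. -/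
def core : Set (E d) := Q.reg ∩ openCube d

theorem measurableSet_core : MeasurableSet Q.core := Q.isOpen_reg_inter.measurableSet

theorem core_subset_cube : Q.core ⊆ cube d := fun _ h => h.1.1

variable (Q) in
theorem cube_ae_eq_core : (cube d : Set (E d)) =ᵐ[volume] Q.core :=
  (ae_eq_set.2 ⟨Q.volume_cube_diff_reg, by
    rw [Set.sdiff_eq_empty.2 core_subset_cube, measure_empty]⟩)

variable (Q) in
theorem Ω_ae_eq_image_core : Q.Ω =ᵐ[volume] Q.G '' Q.core := by
  refine ae_eq_set.2 ⟨?_, ?_⟩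
  · refine measure_mono_null ?_ (Q.volume_image_eq_zero Set.sdiff_subset Q.volume_cube_diff_reg)
    rintro _ ⟨⟨ξ, hξ, rfl⟩, h⟩
    exact mem_image_of_mem _ ⟨openCube_subset_cube hξ, fun h' => h (mem_image_of_mem _ h')⟩
  · have h : Q.G '' Q.core ⊆ Q.Ω := image_mono inter_subset_right
    rw [Set.sdiff_eq_empty.2 h, measure_empty]

theorem hasFDerivWithinAt_core {ξ : E d} (hξ : ξ ∈ Q.core) :
    HasFDerivWithinAt Q.G (Q.DG ξ) Q.core ξ :=
  (Q.hasFDerivWithinAt_G hξ.1).mono core_subset_cube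

variable (Q) in
theorem setIntegral_Ω (f : E d → ℝ) :
    ∫ x in Q.Ω, f x = ∫ ξ in Q.core, |(Q.DG ξ).det| * f (Q.G ξ) := by
  rw [setIntegral_congr_set Q.Ω_ae_eq_image_core,
    integral_image_eq_integral_abs_det_fderiv_smul volume measurableSet_core
      (fun ξ hξ => hasFDerivWithinAt_core hξ) (Q.inj.mono core_subset_cube)]
  rfl

theorem integrableOn_Ω_iff {f : E d → ℝ} :
    IntegrableOn f Q.Ω ↔ IntegrableOn (fun ξ => |(Q.DG ξ).det| * f (Q.G ξ)) Q.core := by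
  rw [integrableOn_congr_set_ae Q.Ω_ae_eq_image_core,
    integrableOn_image_iff_integrableOn_abs_det_fderiv_smul volume measurableSet_core
      (fun ξ hξ => hasFDerivWithinAt_core hξ) (Q.inj.mono core_subset_cube)]
  rfl

theorem volume_core_lt_top : volume Q.core < ⊤ :=
  (measure_mono core_subset_cube).trans_lt isCompact_cube.measure_lt_top

theorem integrableOn_core_of_continuousOn {f : E d → ℝ} (hf : ContinuousOn f Q.reg) {C : ℝ}
    (hC : ∀ ξ ∈ Q.reg, |f ξ| ≤ C) : IntegrableOn f Q.core := by
  refine IntegrableOn.of_bound volume_core_lt_top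
    ((hf.mono inter_subset_left).aestronglyMeasurable measurableSet_core) C ?_
  filter_upwards [ae_restrict_mem measurableSet_core] with ξ hξ using hC ξ hξ.1

theorem continuousOn_abs_det : ContinuousOn (fun ξ => |(Q.DG ξ).det|) Q.reg :=
  (ContinuousLinearMap.continuous_det.comp_continuousOn Q.continuousOn_DG).abs

theorem GeometryRegular.abs_det_le (h : Q.GeometryRegular κ) (hd : 0 < d) {ξ : E d}
    (hξ : ξ ∈ Q.reg) : |(Q.DG ξ).det| ≤ d.factorial * (κ * Q.H) ^ d := by
  refine (Q.DG ξ).abs_det_le.trans ?_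
  gcongr
  exact h.norm_DG_le (h.pos hd).le hξ

theorem GeometryRegular.integrableOn_inner_grad (h : Q.GeometryRegular κ) (hd : 0 < d)
    (hu : Q.IsCellwise P (u ∘ Q.G)) (hv : Q.IsCellwise P (v ∘ Q.G)) :
    IntegrableOn (fun x => inner ℝ (Q.grad u x) (Q.grad v x)) Q.Ω := by
  rw [integrableOn_Ω_iff]
  obtain ⟨C, hC⟩ := h.bounded_grad hd hu
  obtain ⟨C', hC'⟩ := h.bounded_grad hd hv
  refine integrableOn_core_of_continuousOn (continuousOn_abs_det.mul
    ((h.continuousOn_grad hd hu).inner (h.continuousOn_grad hd hv)))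
    (C := d.factorial * (κ * Q.H) ^ d * (C * C')) fun ξ hξ => ?_
  have hC0 : 0 ≤ C := (norm_nonneg _).trans (hC ξ hξ)
  rw [abs_mul, abs_abs]
  exact mul_le_mul (h.abs_det_le hd hξ) ((abs_real_inner_le_norm _ _).trans
    (mul_le_mul (hC ξ hξ) (hC' ξ hξ) (norm_nonneg _) hC0)) (abs_nonneg _)
    ((abs_nonneg _).trans (h.abs_det_le hd hξ))

theorem IsCellwise.integrableOn_fderivWithin {f : E d → ℝ} (hf : Q.IsCellwise P f) :
    IntegrableOn (fun ξ => ‖fderivWithin ℝ f (cube d) ξ‖ ^ 2) (cube d) := by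
  rw [integrableOn_congr_set_ae Q.cube_ae_eq_core]
  obtain ⟨C, hC⟩ := hf.bounded_fderivWithin
  refine integrableOn_core_of_continuousOn (hf.continuousOn_fderivWithin.norm.pow 2)
    (C := C ^ 2) fun ξ hξ => ?_
  rw [abs_of_nonneg (by positivity)]
  exact pow_le_pow_left₀ (norm_nonneg _) (hC ξ hξ) 2

/-- The energy of the pullback is bounded by the energy on the patch. -/
theorem GeometryRegular.integral_fderivWithin_le (h : Q.GeometryRegular κ) (hd : 0 < d)
    (hu : Q.IsCellwise P (u ∘ Q.G)) :
    Q.H ^ d * ∫ ξ in cube d, ‖fderivWithin ℝ (u ∘ Q.G) (cube d) ξ‖ ^ 2 ≤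
      (κ * Q.H) ^ 2 * (d.factorial * κ ^ d) * ∫ x in Q.Ω, inner ℝ (Q.grad u x) (Q.grad u x) := by
  have h1 := integrableOn_Ω_iff.1 (h.integrableOn_inner_grad hd hu hu)
  have h2 := hu.integrableOn_fderivWithin
  rw [setIntegral_Ω, setIntegral_congr_set Q.cube_ae_eq_core, ← integral_const_mul,
    ← integral_const_mul]
  rw [integrableOn_congr_set_ae Q.cube_ae_eq_core] at h2
  refine setIntegral_mono_on (h2.const_mul _) (h1.const_mul _) measurableSet_core fun ξ hξ => ?_
  rw [real_inner_self_eq_norm_sq]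
  have h3 := h.norm_fderivWithin_le hd hu hξ.1
  have h4 := h.le_abs_det (h.pos hd) hd hξ.1
  calc Q.H ^ d * ‖fderivWithin ℝ (u ∘ Q.G) (cube d) ξ‖ ^ 2
      ≤ d.factorial * κ ^ d * |(Q.DG ξ).det| * (κ * Q.H * ‖Q.grad u (Q.G ξ)‖) ^ 2 := by
        have := (h.pos hd)
        gcongr
    _ = _ := by ring

/-- A function of vanishing energy is constant on the patch. -/
theorem GeometryRegular.eq_of_energy_eq_zero (h : Q.GeometryRegular κ) (hd : 0 < d)
    (hu : Q.IsCellwise P (u ∘ Q.G))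
    (h0 : ∫ x in Q.Ω, inner ℝ (Q.grad u x) (Q.grad u x) = 0) {x y : E d} (hx : x ∈ Q.Ωbar)
    (hy : y ∈ Q.Ωbar) : u x = u y := by
  have h1 := h.integral_fderivWithin_le hd hu
  have hH := Q.H_pos hd
  rw [h0, mul_zero, setIntegral_congr_set Q.cube_ae_eq_core] at h1
  have h2 : ∫ ξ in Q.core, ‖fderivWithin ℝ (u ∘ Q.G) (cube d) ξ‖ ^ 2 = 0 :=
    le_antisymm (nonpos_of_mul_nonpos_right h1 (by positivity))
      (integral_nonneg fun _ => by positivity)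
  have hint := hu.integrableOn_fderivWithin
  rw [integrableOn_congr_set_ae Q.cube_ae_eq_core] at hint
  rw [integral_eq_zero_iff_of_nonneg (fun _ => by positivity) hint] at h2
  -- Vanishing almost everywhere becomes vanishing everywhere, as the derivative is continuous on
  -- the open set `core`.
  have h3 : EqOn (fun ξ => ‖fderivWithin ℝ (u ∘ Q.G) (cube d) ξ‖ ^ 2) (fun _ => 0) Q.core :=
    Measure.eqOn_open_of_ae_eq h2 Q.isOpen_reg_inter
      ((hu.continuousOn_fderivWithin.norm.pow 2).mono inter_subset_left) continuousOn_const
  have h4 : ∀ c, Q.Proper c → ∃ b, ∀ ξ ∈ Q.cell c, u (Q.G ξ) = b := by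
    intro c hc
    obtain ⟨g, hg, hg'⟩ := hu c hc
    have h5 : Q.cell c ⊆ {ξ | ‖fderiv ℝ g ξ‖ ≤ 0} := by
      refine (closure_openBox hc).trans (closure_minimal (fun ξ hξ => ?_)
        (isClosed_le hg.continuous_fderiv.norm continuous_const))
      have h2 := Q.openCell_subset_reg hc hξ
      have h6 : Q.cell c ∈ 𝓝 ξ := mem_of_superset ((isOpen_openBox _ _).mem_nhds hξ)
        fun ζ hζ ι => Ioo_subset_Icc_self (hζ ι)
      have h4 := h3 h2
      simp only at h4
      rw [IsCellwise.fderivWithin_of_eqOn (mem_nhdsWithin_of_mem_nhds h6) h2.1.1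
        (hg.differentiable ξ) hg'] at h4
      exact (pow_eq_zero_iff two_ne_zero).1 h4 |>.le
    rcases (Q.cell c).eq_empty_or_nonempty with he | ⟨ζ, hζ⟩
    · exact ⟨0, by simp [he]⟩
    · refine ⟨u (Q.G ζ), fun ξ hξ => ?_⟩
      have h6 := (Q.convex_cell c).norm_image_sub_le_of_norm_hasFDerivWithin_le
        (fun ξ _ => (hg.differentiable ξ).hasFDerivAt.hasFDerivWithinAt) h5 hζ hξ
      rw [zero_mul, ← hg' hζ, ← hg' hξ] at h6
      exact sub_eq_zero.1 (norm_le_zero_iff.1 h6)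
  -- One value per cell gives finitely many values, and a connected set of reals with finitely many
  -- points is a single point. No chain of adjacent cells is needed.
  have h5 : ((u ∘ Q.G) '' cube d).Finite := by
    choose! b hb using h4
    refine (finite_range b).subset ?_
    rintro _ ⟨ξ, hξ, rfl⟩
    obtain ⟨c, hc, hc', _⟩ := Q.exists_cell hξ
    exact ⟨c, (hb c hc ξ hc').symm⟩
  have h6 : ((u ∘ Q.G) '' cube d).Subsingleton := by
    by_contra h7
    exact (convex_cube.isPreconnected.image _ hu.continuousOn).infinite_of_nontrivial
      (Set.not_subsingleton_iff.1 h7) h5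
  have h7 := h6 (mem_image_of_mem _ (Q.Ginv_mem hx)) (mem_image_of_mem _ (Q.Ginv_mem hy))
  simpa [Q.G_Ginv hx, Q.G_Ginv hy] using h7

end Patch

end IgA

namespace IgA

open Set Filter Topology Finset

variable {d : ℕ}

/-! ### Sides of the parameter domain -/

namespace Side

variable (s : Side d)

/-- The parameter domain of a side. -/
def box : Set ({j : Fin d // j ≠ s.1} → ℝ) := {η | ∀ j, η j ∈ Icc (0 : ℝ) 1}

/-- The point with tangential coordinates `η` and normal coordinate `τ`. -/
def join (η : {j : Fin d // j ≠ s.1} → ℝ) (τ : ℝ) : E d :=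
  WithLp.toLp 2 fun j => if h : j = s.1 then τ else η ⟨j, h⟩

theorem join_same (η : {j : Fin d // j ≠ s.1} → ℝ) (τ : ℝ) : s.join η τ s.1 = τ := by simp [join]

theorem join_ne (η : {j : Fin d // j ≠ s.1} → ℝ) (τ : ℝ) {j : Fin d} (h : j ≠ s.1) :
    s.join η τ j = η ⟨j, h⟩ := by simp [join, h]

theorem embed_eq_join (η : {j : Fin d // j ≠ s.1} → ℝ) : s.embed η = s.join η s.val := rfl

theorem val_mem : s.val ∈ Icc (0 : ℝ) 1 := by unfold val; split_ifs <;> norm_num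

theorem val_eq : s.val = 0 ∨ s.val = 1 := by unfold val; split_ifs <;> simp

theorem join_mem_cube {η : {j : Fin d // j ≠ s.1} → ℝ} {τ : ℝ} (hη : η ∈ s.box)
    (hτ : τ ∈ Icc (0 : ℝ) 1) : s.join η τ ∈ cube d := by
  intro j
  by_cases h : j = s.1
  · subst h; rwa [join_same]
  · rw [join_ne _ _ _ h]; exact hη ⟨j, h⟩

theorem embed_mem_set {η : {j : Fin d // j ≠ s.1} → ℝ} (hη : η ∈ s.box) : s.embed η ∈ s.set :=
  ⟨s.join_mem_cube hη s.val_mem, s.join_same _ _⟩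

theorem continuous_join : Continuous fun p : ({j : Fin d // j ≠ s.1} → ℝ) × ℝ =>
    s.join p.1 p.2 := by
  refine (PiLp.continuous_toLp 2 fun _ : Fin d => ℝ).comp (continuous_pi fun j => ?_)
  by_cases h : j = s.1
  · simp only [h, dite_true]; exact continuous_snd
  · simp only [h, dite_false]; exact (continuous_apply _).comp continuous_fst

theorem continuous_embed : Continuous s.embed :=
  s.continuous_join.comp (continuous_id.prodMk continuous_const)

theorem join_add (η : {j : Fin d // j ≠ s.1} → ℝ) (τ τ' : ℝ) :
    s.join η (τ + τ') = s.join η τ + τ' • EuclideanSpace.single s.1 (1 : ℝ) := by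
  ext j
  by_cases h : j = s.1
  · subst h; simp [join_same]
  · simp [join_ne _ _ _ h, h]

theorem measurePreserving_join : MeasurePreserving
    (fun p : ({j : Fin d // j ≠ s.1} → ℝ) × ℝ => s.join p.1 p.2) (volume.prod volume) volume := by
  have huniq : Unique {j : Fin d // ¬ j ≠ s.1} :=
    ⟨⟨⟨s.1, by simp⟩⟩, fun j => Subtype.ext (not_not.1 j.2)⟩
  have h1 := (measurePreserving_piUnique (X := fun _ : {j : Fin d // ¬ j ≠ s.1} => ℝ)
    fun _ => volume).symm
  have h2 := (measurePreserving_piEquivPiSubtypeProd (fun _ : Fin d => (volume : Measure ℝ))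
    (fun j => j ≠ s.1)).symm
  have h3 := (PiLp.volume_preserving_toLp (Fin d)).comp
    (h2.comp ((MeasurePreserving.id _).prod h1))
  refine (congrArg (fun f => MeasurePreserving f (volume.prod volume) volume) ?_).mpr h3
  funext p
  ext j
  by_cases h : j = s.1
  · subst h
    rw [join_same]
    simp [Equiv.piEquivPiSubtypeProd, MeasurableEquiv.piEquivPiSubtypeProd,
      MeasurableEquiv.piUnique]
  · rw [join_ne _ _ _ h]
    simp [Equiv.piEquivPiSubtypeProd, MeasurableEquiv.piEquivPiSubtypeProd,
      MeasurableEquiv.piUnique, h]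

theorem measurableSet_box : MeasurableSet s.box := by
  rw [box, ofPred_forall]
  exact MeasurableSet.iInter fun j => measurable_pi_apply j measurableSet_Icc

theorem volume_box_lt_top : volume s.box < ⊤ := by
  have h : s.box = univ.pi fun _ => Icc (0 : ℝ) 1 :=
    Set.ext fun η => ⟨fun h j _ => h j, fun h j => h j (mem_univ j)⟩
  rw [h, volume_pi_pi]
  simp

theorem preimage_join_cube :
    (fun p : ({j : Fin d // j ≠ s.1} → ℝ) × ℝ => s.join p.1 p.2) ⁻¹' cube d =
      s.box ×ˢ Icc (0 : ℝ) 1 := by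
  ext p
  constructor
  · intro h
    refine ⟨fun j => ?_, ?_⟩
    · have := h j
      rwa [join_ne _ _ _ j.2] at this
    · have := h s.1
      rwa [join_same] at this
  · exact fun h => s.join_mem_cube h.1 h.2

theorem measurableSet_cube : MeasurableSet (cube d) := isCompact_cube.isClosed.measurableSet

theorem integrableOn_join {f : E d → ℝ} (hf : IntegrableOn f (cube d)) :
    IntegrableOn (fun p : ({j : Fin d // j ≠ s.1} → ℝ) × ℝ => f (s.join p.1 p.2))
      (s.box ×ˢ Icc (0 : ℝ) 1) (volume.prod volume) := by
  have h := (s.measurePreserving_join.restrict_preimage measurableSet_cube).integrable_comp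
    (g := f) hf.aestronglyMeasurable |>.2 hf
  rwa [s.preimage_join_cube] at h

/-- Fubini's theorem with the coordinate normal to the side as inner variable. -/
theorem setIntegral_cube {f : E d → ℝ} (hf : IntegrableOn f (cube d)) :
    ∫ ξ in cube d, f ξ = ∫ η in s.box, ∫ τ in Icc (0 : ℝ) 1, f (s.join η τ) := by
  rw [← setIntegral_prod _ (s.integrableOn_join hf), ← s.preimage_join_cube]
  have h := s.measurePreserving_join.restrict_preimage measurableSet_cube
  have h1 : AEStronglyMeasurable f (Measure.map (fun p : ({j : Fin d // j ≠ s.1} → ℝ) × ℝ =>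
    s.join p.1 p.2) ((volume.prod volume).restrict
    ((fun p : ({j : Fin d // j ≠ s.1} → ℝ) × ℝ => s.join p.1 p.2) ⁻¹' cube d))) := by
    rw [h.map_eq]; exact hf.aestronglyMeasurable
  rw [← integral_map h.measurable.aemeasurable h1, h.map_eq]

theorem ae_integrableOn_join {f : E d → ℝ} (hf : IntegrableOn f (cube d)) :
    ∀ᵐ η ∂volume.restrict s.box, IntegrableOn (fun τ => f (s.join η τ)) (Icc 0 1) := by
  have h := s.integrableOn_join hf
  rw [IntegrableOn, ← Measure.prod_restrict] at h
  exact h.prod_right_ae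

theorem integrableOn_integral_join {f : E d → ℝ} (hf : IntegrableOn f (cube d)) :
    IntegrableOn (fun η => ∫ τ in Icc (0 : ℝ) 1, f (s.join η τ)) s.box := by
  have h := s.integrableOn_join hf
  rw [IntegrableOn, ← Measure.prod_restrict] at h
  exact h.integral_prod_left

/-- Almost no point of a side has a coordinate that is a knot. -/
theorem ae_forall_ne_knot (kv : Fin d → KnotVector) :
    ∀ᵐ η ∂volume.restrict s.box, ∀ (j : {j : Fin d // j ≠ s.1}) (i : ℕ), η j ≠ (kv j).knot i := by
  refine ae_restrict_of_ae ?_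
  rw [ae_all_iff]
  intro j
  rw [ae_all_iff]
  intro i
  exact measure_eq_zero_iff_ae_notMem.1
    (Measure.pi_hyperplane (fun _ => (volume : Measure ℝ)) j ((kv j).knot i))

end Side

end IgA

namespace IgA

open Set Filter Topology Finset

variable {d : ℕ}

/-! ### An inverse trace inequality -/

/-- Integrate the pointwise bound over `τ`. Each substitution `(i + 1) τ` gains a factor `1 / (i +
1) ≤ 1` and stays in `[0, ℓ]`, so each of the `n` samples costs at most the full integral; the
second factor `n` comes from the length `ℓ / n` of the range of `τ`. -/
theorem mul_le_integral_of_forall_le_sum {f : ℝ → ℝ} (hf : ∀ x, 0 ≤ f x)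
    (hint : IntegrableOn f (Set.Icc 0 1)) {n : ℕ} (hn : 0 < n) {ℓ A K : ℝ} (hℓ : 0 < ℓ)
    (hℓ1 : ℓ ≤ 1) (hK : 0 ≤ K)
    (h : ∀ τ ∈ Set.Ioo 0 (ℓ / n), A ≤ K * ∑ i ∈ range n, f (((i + 1 : ℕ) : ℝ) * τ)) :
    ℓ * A ≤ K * n ^ 2 * ∫ τ in Set.Icc (0 : ℝ) 1, f τ := by
  have hn' : (0 : ℝ) < n := Nat.cast_pos.2 hn
  set a : ℝ := ℓ / n with ha
  have ha0 : 0 < a := by positivity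
  have h01 : IntervalIntegrable f volume 0 1 :=
    (intervalIntegrable_iff_integrableOn_Icc_of_le zero_le_one).2 hint
  have hsub : ∀ i ∈ range n, ((i + 1 : ℕ) : ℝ) * a ≤ 1 := by
    intro i hi
    have : ((i + 1 : ℕ) : ℝ) ≤ n := Nat.cast_le.2 (Finset.mem_range.1 hi)
    calc ((i + 1 : ℕ) : ℝ) * a ≤ n * a := by gcongr
      _ = ℓ := by rw [ha]; field_simp
      _ ≤ 1 := hℓ1
  have hi1 : ∀ i ∈ range n, IntervalIntegrable f volume 0 (((i + 1 : ℕ) : ℝ) * a) := by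
    intro i hi
    refine h01.mono_set ?_
    rw [Set.uIcc_of_le (by positivity), Set.uIcc_of_le zero_le_one]
    exact Set.Icc_subset_Icc_right (hsub i hi)
  have hi2 : ∀ i ∈ range n, IntervalIntegrable (fun τ => f (((i + 1 : ℕ) : ℝ) * τ)) volume 0 a := by
    intro i hi
    have := (hi1 i hi).comp_mul_left (c := ((i + 1 : ℕ) : ℝ))
    rwa [zero_div, mul_div_cancel_left₀ _ (by positivity)] at this
  have hi3 : ∀ i ∈ range n, ∫ τ in (0 : ℝ)..a, f (((i + 1 : ℕ) : ℝ) * τ) ≤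
      ∫ τ in (0 : ℝ)..1, f τ := by
    intro i hi
    rw [intervalIntegral.integral_comp_mul_left _ (by positivity), mul_zero, smul_eq_mul]
    have h1 : ∫ τ in (0 : ℝ)..(((i + 1 : ℕ) : ℝ) * a), f τ ≤ ∫ τ in (0 : ℝ)..1, f τ :=
      intervalIntegral.integral_mono_interval le_rfl (by positivity) (hsub i hi)
        (Eventually.of_forall hf) h01
    have h2 : (((i + 1 : ℕ) : ℝ))⁻¹ ≤ 1 :=
      inv_le_one_of_one_le₀ (by push_cast; linarith [i.cast_nonneg (α := ℝ)])
    have h3 : 0 ≤ ∫ τ in (0 : ℝ)..(((i + 1 : ℕ) : ℝ) * a), f τ :=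
      intervalIntegral.integral_nonneg (by positivity) fun _ _ => hf _
    exact (mul_le_of_le_one_left h3 h2).trans h1
  have h4 : ∫ τ in (0 : ℝ)..a, A ≤
      ∫ τ in (0 : ℝ)..a, K * ∑ i ∈ range n, f (((i + 1 : ℕ) : ℝ) * τ) := by
    refine intervalIntegral.integral_mono_on_of_le_Ioo ha0.le intervalIntegrable_const ?_ h
    exact (IntervalIntegrable.sum _ hi2).const_mul K |>.congr fun x _ => by simp
  rw [intervalIntegral.integral_const, intervalIntegral.integral_const_mul,
    intervalIntegral.integral_finsetSum hi2, sub_zero, smul_eq_mul] at h4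
  rw [integral_Icc_eq_integral_Ioc, ← intervalIntegral.integral_of_le zero_le_one]
  have h5 : a * A ≤ K * (n * ∫ τ in (0 : ℝ)..1, f τ) := by
    refine h4.trans (mul_le_mul_of_nonneg_left ((Finset.sum_le_card_nsmul _ _ _ hi3).trans ?_) hK)
    simp
  calc ℓ * A = n * (a * A) := by rw [ha]; field_simp
    _ ≤ n * (K * (n * ∫ τ in (0 : ℝ)..1, f τ)) := by gcongr
    _ = _ := by ring

/-- Here `1 - 2 * v` is the sign of the inward direction at the end point `v`; the case `v = 1` is
reduced to `v = 0` by reflection. -/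
theorem mul_le_integral_of_forall_le_sum' {f : ℝ → ℝ} (hf : ∀ x, 0 ≤ f x)
    (hint : IntegrableOn f (Set.Icc 0 1)) {n : ℕ} (hn : 0 < n) {ℓ A K v : ℝ} (hℓ : 0 < ℓ)
    (hℓ1 : ℓ ≤ 1) (hK : 0 ≤ K) (hv : v = 0 ∨ v = 1)
    (h : ∀ τ ∈ Set.Ioo 0 (ℓ / n), A ≤
      K * ∑ i ∈ range n, f (v + ((i + 1 : ℕ) : ℝ) * ((1 - 2 * v) * τ))) :
    ℓ * A ≤ K * n ^ 2 * ∫ τ in Set.Icc (0 : ℝ) 1, f τ := by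
  rcases hv with rfl | rfl
  · simp only [mul_zero, sub_zero, one_mul, zero_add] at h
    exact mul_le_integral_of_forall_le_sum hf hint hn hℓ hℓ1 hK h
  · have h01 : IntervalIntegrable f volume 0 1 :=
      (intervalIntegrable_iff_integrableOn_Icc_of_le zero_le_one).2 hint
    have h1 : IntegrableOn (fun τ => f (1 - τ)) (Set.Icc 0 1) := by
      rw [← intervalIntegrable_iff_integrableOn_Icc_of_le zero_le_one]
      have := (h01.comp_sub_left 1).symm
      simpa using this
    have h2 := mul_le_integral_of_forall_le_sum (f := fun τ => f (1 - τ)) (A := A)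
      (fun _ => hf _) h1 hn hℓ hℓ1 hK fun τ hτ => (h τ hτ).trans_eq (by
        congr 1
        refine sum_congr rfl fun i _ => ?_
        congr 1
        ring)
    rw [integral_Icc_eq_integral_Ioc, ← intervalIntegral.integral_of_le zero_le_one] at h2 ⊢
    rwa [intervalIntegral.integral_comp_sub_left, sub_self, sub_zero] at h2

/-- The coefficient of `x 0` is ±1, so the relation can be solved for it; then Cauchy-Schwarz. -/
theorem _root_.norm_sq_le_sum_of_sum_choose_eq_zero {F : Type*} [NormedAddCommGroup F]
    [NormedSpace ℝ F] {n : ℕ} {x : ℕ → F}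
    (h : ∑ i ∈ range (n + 1), ((-1 : ℝ) ^ (n - i) * n.choose i) • x i = 0) :
    ‖x 0‖ ^ 2 ≤ (∑ i ∈ range n, (n.choose (i + 1) : ℝ) ^ 2) * ∑ i ∈ range n, ‖x (i + 1)‖ ^ 2 := by
  rw [sum_range_succ', Nat.choose_zero_right, Nat.cast_one, mul_one, add_comm,
    add_eq_zero_iff_eq_neg] at h
  have h1 : ‖x 0‖ ≤ ∑ i ∈ range n, (n.choose (i + 1) : ℝ) * ‖x (i + 1)‖ := by
    have h2 := congrArg norm h
    rw [norm_smul, norm_neg, norm_pow, norm_neg, norm_one, one_pow, one_mul] at h2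
    rw [h2]
    refine (norm_sum_le _ _).trans (Finset.sum_le_sum fun i _ => ?_)
    rw [norm_smul, norm_mul, norm_pow, norm_neg, norm_one, one_pow, one_mul, Real.norm_natCast]
  exact (pow_le_pow_left₀ (norm_nonneg _) h1 2).trans (sum_mul_sq_le_sq_mul_sq _ _ _)

namespace Patch

variable {Q : Patch d} {κ θ : ℝ} {P n : ℕ} {u v : E d → ℝ}

/-- The set is relatively open in the cube, hence an open set intersected with a closed one. -/
theorem measurableSet_reg : MeasurableSet Q.reg := by
  have h : Q.reg = interior (Q.reg ∪ (cube d)ᶜ) ∩ cube d := by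
    ext ξ
    constructor
    · intro hξ
      refine ⟨mem_interior_iff_mem_nhds.2 ?_, hξ.1⟩
      have h1 := mem_nhdsWithin_iff_exists_mem_nhds_inter.1 (Q.reg_mem_nhdsWithin hξ)
      obtain ⟨U, hU, hU'⟩ := h1
      refine mem_of_superset hU fun ζ hζ => ?_
      by_cases hζ' : ζ ∈ cube d
      · exact Or.inl (hU' ⟨hζ, hζ'⟩)
      · exact Or.inr hζ'
    · rintro ⟨h1, h2⟩
      rcases interior_subset h1 with h3 | h3
      · exact h3
      · exact absurd h2 h3
  rw [h]
  exact isOpen_interior.measurableSet.inter isCompact_cube.isClosed.measurableSet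

variable (Q) in
-- The normal coordinate is 0 or 1, which `reg` admits; only tangential knots are bad, and they form
-- a null set in the side.
theorem ae_embed_mem_reg (s : Side d) : ∀ᵐ η ∂volume.restrict s.box, s.embed η ∈ Q.reg := by
  filter_upwards [ae_restrict_mem s.measurableSet_box, s.ae_forall_ne_knot Q.kv] with η h1 h2
  refine Q.mem_reg (s.embed_mem_set h1).1 fun ι => ?_
  by_cases h : ι = s.1
  · subst h
    rw [s.embed_eq_join, s.join_same]
    rcases s.val_eq with h | h <;> simp [h]
  · rw [s.embed_eq_join, s.join_ne _ _ h]
    exact Or.inr (Or.inr (h2 ⟨ι, h⟩))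

/-- Essential boundedness is stable under products, so all integrability questions on a side reduce
to it. -/
theorem memLp_top_comp_embed {F : Type*} [NormedAddCommGroup F] [SecondCountableTopology F]
    (s : Side d) {f : E d → F} (hf : ContinuousOn f Q.reg) {C : ℝ} (hC : ∀ ξ ∈ Q.reg, ‖f ξ‖ ≤ C) :
    MemLp (fun η => f (s.embed η)) ⊤ (volume.restrict s.box) := by
  refine memLp_top_of_bound ?_ C ?_
  · have h1 : MeasurableSet (s.embed ⁻¹' Q.reg) := s.continuous_embed.measurable measurableSet_reg
    have h2 : AEStronglyMeasurable (fun η => f (s.embed η)) (volume.restrict (s.embed ⁻¹' Q.reg)) :=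
      (hf.comp s.continuous_embed.continuousOn (mapsTo_preimage _ _)).aestronglyMeasurable h1
    have h3 : (volume.restrict s.box).restrict (s.embed ⁻¹' Q.reg) = volume.restrict s.box :=
      Measure.restrict_eq_self_of_ae_mem (Q.ae_embed_mem_reg s)
    rw [← h3, Measure.restrict_restrict h1]
    exact h2.mono_measure (Measure.restrict_mono inter_subset_left le_rfl)
  · filter_upwards [Q.ae_embed_mem_reg s] with η hη using hC _ hη

instance (s : Side d) : IsFiniteMeasure (volume.restrict s.box) :=
  ⟨by rw [Measure.restrict_apply_univ]; exact s.volume_box_lt_top⟩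

/-- The constant of the discrete inverse trace inequality for splines of order `n`. -/
noncomputable def diffConst (n : ℕ) : ℝ := (∑ i ∈ range n, (n.choose (i + 1) : ℝ) ^ 2) * n ^ 2

theorem diffConst_nonneg (n : ℕ) : 0 ≤ diffConst n := by unfold diffConst; positivity

/-- The inverse trace inequality on the parameter domain, where `ℓ` is a lower bound for the
lengths of the nonempty knot spans. -/
theorem IsCellwise.integral_embed_le {f : E d → ℝ} (hf : Q.IsCellwise n f) (hn : 0 < n) {ℓ : ℝ}
    (hℓ : 0 < ℓ) (hℓ' : ∀ ι i, (Q.kv ι).knot i < (Q.kv ι).knot (i + 1) →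
      ℓ ≤ (Q.kv ι).knot (i + 1) - (Q.kv ι).knot i) (s : Side d) :
    ℓ * ∫ η in s.box, ‖fderivWithin ℝ f (cube d) (s.embed η)‖ ^ 2 ≤
      diffConst n * ∫ ξ in cube d, ‖fderivWithin ℝ f (cube d) ξ‖ ^ 2 := by
  have hint := hf.integrableOn_fderivWithin
  obtain ⟨C, hC⟩ := hf.bounded_fderivWithin
  have h1 : Integrable (fun η => ‖fderivWithin ℝ f (cube d) (s.embed η)‖ ^ 2)
      (volume.restrict s.box) :=
    (memLp_top_comp_embed s (f := fun ξ => ‖fderivWithin ℝ f (cube d) ξ‖ ^ 2) (C := C ^ 2)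
      (hf.continuousOn_fderivWithin.norm.pow 2) fun ξ hξ => by
        rw [Real.norm_of_nonneg (by positivity)]
        exact pow_le_pow_left₀ (norm_nonneg _) (hC ξ hξ) 2).integrable le_top
  rw [s.setIntegral_cube hint, ← integral_const_mul, ← integral_const_mul]
  refine integral_mono_ae (h1.const_mul _) ((s.integrableOn_integral_join hint).const_mul _) ?_
  filter_upwards [ae_restrict_mem s.measurableSet_box, s.ae_forall_ne_knot Q.kv,
    s.ae_integrableOn_join hint, Q.ae_embed_mem_reg s] with η hη hη' hη'' hreg
  obtain ⟨c, hc, hξc, hcn⟩ := Q.exists_cell (s.embed_mem_set hη).1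
  have hcn' : Q.cell c ∈ 𝓝[cube d] (s.embed η) := by
    refine hcn fun ι => ?_
    by_cases h : ι = s.1
    · subst h
      rw [s.embed_eq_join, s.join_same]
      rcases s.val_eq with h | h <;> simp [h]
    · rw [s.embed_eq_join, s.join_ne _ _ h]
      exact Or.inr (Or.inr (hη' ⟨ι, h⟩))
  obtain ⟨g, hg, hg'⟩ := hf c hc
  set a := (Q.kv s.1).knot (c s.1) with ha
  set b := (Q.kv s.1).knot ((c s.1 : ℕ) + 1) with hb
  have hab : ℓ ≤ b - a := hℓ' s.1 _ (hc s.1)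
  have ha0 : 0 ≤ a := (Q.kv s.1).knot_nonneg _
  have hb1 : b ≤ 1 := (Q.kv s.1).knot_le_one _
  have hs : s.val ∈ Set.Icc a b := by
    have := hξc s.1
    rwa [s.embed_eq_join, s.join_same] at this
  -- Along the normal line through a generic point of the side, one smooth piece `g` gives the
  -- derivative on the whole first span.
  have hopen : ∀ t ∈ Set.Ioo a b, fderivWithin ℝ f (cube d) (s.join η t) =
      fderiv ℝ g (s.join η t) := by
    intro t ht
    have h2 : s.join η t ∈ {ξ : E d | ∀ ι, ξ ι ∈
        Set.Ioo ((Q.kv ι).knot (c ι)) ((Q.kv ι).knot ((c ι : ℕ) + 1))} := by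
      intro ι
      by_cases h : ι = s.1
      · subst h; rwa [s.join_same]
      · have h3 := hξc ι
        rw [s.embed_eq_join, s.join_ne _ _ h] at h3
        rw [s.join_ne _ _ h]
        exact ⟨h3.1.lt_of_ne (hη' ⟨ι, h⟩ _).symm, h3.2.lt_of_ne (hη' ⟨ι, h⟩ _)⟩
    have h3 : Q.cell c ∈ 𝓝 (s.join η t) := mem_of_superset ((isOpen_openBox _ _).mem_nhds h2)
      fun ζ hζ ι => Ioo_subset_Icc_self (hζ ι)
    exact IsCellwise.fderivWithin_of_eqOn (mem_nhdsWithin_of_mem_nhds h3)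
      (Q.openCell_subset_reg hc h2).1.1 (hg.differentiable _) hg'
  refine (mul_le_integral_of_forall_le_sum' (v := s.val)
    (f := fun τ => ‖fderivWithin ℝ f (cube d) (s.join η τ)‖ ^ 2)
    (fun _ => by positivity) hη'' hn hℓ (by linarith) (by positivity) s.val_eq
    fun τ hτ => ?_)
  -- The samples start on the side and step inwards by `τ`; since `τ < ℓ / n`, all of them remain in
  -- the span.
  have h2 := norm_sq_le_sum_of_sum_choose_eq_zero (x := fun i : ℕ =>
    fderiv ℝ g (s.embed η + ((i : ℝ) * ((1 - 2 * s.val) * τ)) •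
      EuclideanSpace.single s.1 (1 : ℝ))) (hg.diff_fderiv s.1 (s.embed η) ((1 - 2 * s.val) * τ))
  simp only [Nat.cast_zero, zero_mul, zero_smul, add_zero] at h2
  rw [IsCellwise.fderivWithin_of_eqOn hcn' hreg.1 (hg.differentiable _) hg']
  refine h2.trans_eq ?_
  congr 1
  refine sum_congr rfl fun i hi => ?_
  have h3 : ((i + 1 : ℕ) : ℝ) * τ < ℓ := by
    have h4 : ((i + 1 : ℕ) : ℝ) ≤ n := Nat.cast_le.2 (Finset.mem_range.1 hi)
    have h5 := hτ.2
    rw [lt_div_iff₀ (Nat.cast_pos.2 hn)] at h5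
    nlinarith [hτ.1]
  have h4 : 0 < ((i + 1 : ℕ) : ℝ) * τ := mul_pos (by positivity) hτ.1
  rw [s.embed_eq_join, ← s.join_add, hopen]
  rcases s.val_eq with h | h <;> rw [h] at hs ⊢
  · constructor <;> linarith [hs.1, hs.2]
  · constructor <;> linarith [hs.1, hs.2]

/-- The length is that of the shortest nonempty span over all directions, so quasi-uniformity bounds
every span by `θ` times it. -/
theorem QuasiUniform.exists_length (hθ : Q.QuasiUniform θ) (hd : 0 < d) : ∃ ℓ : ℝ, 0 < ℓ ∧
    (∀ ι i, (Q.kv ι).knot i < (Q.kv ι).knot (i + 1) →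
      ℓ ≤ (Q.kv ι).knot (i + 1) - (Q.kv ι).knot i) ∧
    ∀ ι i, (Q.kv ι).knot (i + 1) - (Q.kv ι).knot i ≤ θ * ℓ := by
  classical
  obtain ⟨c, hc⟩ := Q.exists_mem_cell
  let S : Finset ((ι : Fin d) × Fin (Q.kv ι).n) :=
    univ.filter fun p => (Q.kv p.1).knot p.2 < (Q.kv p.1).knot ((p.2 : ℕ) + 1)
  have hS : S.Nonempty := ⟨⟨⟨0, hd⟩, c ⟨0, hd⟩⟩, mem_filter.2 ⟨mem_univ _, hc _⟩⟩
  obtain ⟨p, hp, hp'⟩ := S.exists_min_image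
    (fun p => (Q.kv p.1).knot ((p.2 : ℕ) + 1) - (Q.kv p.1).knot p.2) hS
  have hp2 := (mem_filter.1 hp).2
  refine ⟨_, sub_pos.2 hp2, fun ι i hi => ?_, fun ι i => hθ p.1 ι p.2 i hp2⟩
  exact hp' ⟨ι, ⟨i, (Q.kv ι).lt_n_of_knot_lt hi⟩⟩ (mem_filter.2 ⟨mem_univ _, hi⟩)

/-- The constant of the inverse trace inequality. -/
noncomputable def traceConst (d n : ℕ) (κ θ : ℝ) : ℝ :=
  κ * √d * θ * (κ ^ 2 * ((d - 1).factorial * κ ^ (d - 1)) * diffConst n *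
    (κ ^ 2 * (d.factorial * κ ^ d)))

theorem GeometryRegular.memLp_surfaceElement (h : Q.GeometryRegular κ) (hd : 0 < d) (s : Side d) :
    MemLp (fun η => Q.surfaceElement s (s.embed η)) ⊤ (volume.restrict s.box) :=
  memLp_top_comp_embed s (continuousOn_surfaceElement s) fun ξ hξ => by
    rw [Real.norm_of_nonneg (surfaceElement_nonneg s ξ)]
    exact h.surfaceElement_le hd s hξ

theorem GeometryRegular.memLp_normalDeriv (h : Q.GeometryRegular κ) (hd : 0 < d)
    (hu : Q.IsCellwise n (u ∘ Q.G)) (s : Side d) :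
    MemLp (fun η => Q.normalDeriv s u (Q.G (s.embed η))) ⊤ (volume.restrict s.box) := by
  obtain ⟨C, hC⟩ := h.bounded_grad hd hu
  exact memLp_top_comp_embed s (f := fun ξ => Q.normalDeriv s u (Q.G ξ))
    ((h.continuousOn_grad hd hu).inner (h.continuousOn_normal hd s))
    fun ξ hξ => (abs_normalDeriv_le s u _).trans (hC ξ hξ)

/-- The inverse trace inequality on a side of a patch. -/
theorem GeometryRegular.sideIntegral_normalDeriv_le (h : Q.GeometryRegular κ) (hd : 0 < d)
    (hθ : Q.QuasiUniform θ) (hu : Q.IsCellwise n (u ∘ Q.G)) (hn : 0 < n) (s : Side d) :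
    Q.h * Q.sideIntegral s (fun x => Q.normalDeriv s u x ^ 2) ≤
      traceConst d n κ θ * ∫ x in Q.Ω, inner ℝ (Q.grad u x) (Q.grad u x) := by
  obtain ⟨ℓ, hℓ, hℓ1, hℓ2⟩ := hθ.exists_length hd
  have hκ := h.pos hd
  have hH := Q.H_pos hd
  -- The sign of `θ` is not assumed either: `θ * ℓ` bounds a span length, which is nonnegative.
  have hθℓ : 0 ≤ θ * ℓ := (sub_nonneg.2 ((Q.kv ⟨0, hd⟩).mono (Nat.zero_le 1))).trans
    (hℓ2 ⟨0, hd⟩ 0)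
  have hθ0 : 0 ≤ θ := nonneg_of_mul_nonneg_left hθℓ hℓ
  set S := Q.sideIntegral s (fun x => Q.normalDeriv s u x ^ 2) with hSdef
  set D := ∫ η in s.box, ‖fderivWithin ℝ (u ∘ Q.G) (cube d) (s.embed η)‖ ^ 2 with hDdef
  set B := ∫ ξ in cube d, ‖fderivWithin ℝ (u ∘ Q.G) (cube d) ξ‖ ^ 2 with hBdef
  set A := ∫ x in Q.Ω, inner ℝ (Q.grad u x) (Q.grad u x) with hAdef
  have hS0 : 0 ≤ S := integral_nonneg fun η => mul_nonneg (sq_nonneg _) (surfaceElement_nonneg _ _)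
  have h1 : S ≤ (κ / Q.H) ^ 2 * ((d - 1).factorial * (κ * Q.H) ^ (d - 1)) * D := by
    rw [hSdef, hDdef, ← integral_const_mul]
    have hm := (h.memLp_normalDeriv hd hu s)
    have i1 : Integrable (fun η => Q.normalDeriv s u (Q.G (s.embed η)) ^ 2 *
        Q.surfaceElement s (s.embed η)) (volume.restrict s.box) := by
      have := ((hm.mul (r := ⊤) hm).mul (r := ⊤) (h.memLp_surfaceElement hd s)).integrable le_top
      refine this.congr (Eventually.of_forall fun η => ?_)
      simp only [Pi.mul_apply]
      ring
    obtain ⟨C, hC⟩ := hu.bounded_fderivWithin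
    have i2 : Integrable (fun η => ‖fderivWithin ℝ (u ∘ Q.G) (cube d) (s.embed η)‖ ^ 2)
        (volume.restrict s.box) :=
      (memLp_top_comp_embed s (f := fun ξ => ‖fderivWithin ℝ (u ∘ Q.G) (cube d) ξ‖ ^ 2)
        (C := C ^ 2) (hu.continuousOn_fderivWithin.norm.pow 2) fun ξ hξ => by
          rw [Real.norm_of_nonneg (by positivity)]
          exact pow_le_pow_left₀ (norm_nonneg _) (hC ξ hξ) 2).integrable le_top
    refine integral_mono_ae i1 (i2.const_mul _) ?_
    filter_upwards [Q.ae_embed_mem_reg s] with η hη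
    have h2 := (abs_normalDeriv_le s u (Q.G (s.embed η))).trans (h.norm_grad_le hd hu hη)
    have h3 := h.surfaceElement_le hd s hη
    have h4 := surfaceElement_nonneg (Q := Q) s (s.embed η)
    rw [← sq_abs]
    calc |Q.normalDeriv s u (Q.G (s.embed η))| ^ 2 * Q.surfaceElement s (s.embed η)
        ≤ (κ / Q.H * ‖fderivWithin ℝ (u ∘ Q.G) (cube d) (s.embed η)‖) ^ 2 *
          ((d - 1).factorial * (κ * Q.H) ^ (d - 1)) := by
            gcongr
      _ = _ := by ring
  have h2 : ℓ * D ≤ diffConst n * B := hu.integral_embed_le hn hℓ hℓ1 s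
  have h3 : Q.H ^ d * B ≤ (κ * Q.H) ^ 2 * (d.factorial * κ ^ d) * A :=
    h.integral_fderivWithin_le hd hu
  have h4 : Q.h ≤ κ * Q.H * (√d * (θ * ℓ)) := h.h_le hd hθℓ hℓ2
  obtain ⟨m, rfl⟩ : ∃ m, d = m + 1 := ⟨d - 1, by omega⟩
  have hc := diffConst_nonneg n
  have h5 : Q.H * B ≤ Q.H ^ 2 * (κ ^ 2 * ((m + 1).factorial * κ ^ (m + 1)) * A) / Q.H ^ m := by
    rw [le_div_iff₀ (by positivity)]
    calc Q.H * B * Q.H ^ m = Q.H ^ (m + 1) * B := by ring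
      _ ≤ _ := h3
      _ = _ := by ring
  simp only [Nat.add_sub_cancel] at h1
  -- With `d = m + 1` the powers of `H` are `1` from the mesh size, `-2` from the gradients, `m`
  -- from the surface and `1 - m` from the energy; they cancel.
  calc Q.h * S ≤ κ * Q.H * (√(m + 1 : ℕ) * (θ * ℓ)) *
        ((κ / Q.H) ^ 2 * (m.factorial * (κ * Q.H) ^ m) * D) := by gcongr
    _ = κ * √(m + 1 : ℕ) * θ * ((κ / Q.H) ^ 2 * (m.factorial * (κ * Q.H) ^ m)) *
        Q.H * (ℓ * D) := by ring
    _ ≤ κ * √(m + 1 : ℕ) * θ * ((κ / Q.H) ^ 2 * (m.factorial * (κ * Q.H) ^ m)) *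
        Q.H * (diffConst n * B) := by gcongr
    _ = κ * √(m + 1 : ℕ) * θ * ((κ / Q.H) ^ 2 * (m.factorial * (κ * Q.H) ^ m)) *
        diffConst n * (Q.H * B) := by ring
    _ ≤ κ * √(m + 1 : ℕ) * θ * ((κ / Q.H) ^ 2 * (m.factorial * (κ * Q.H) ^ m)) *
        diffConst n * (Q.H ^ 2 * (κ ^ 2 * ((m + 1).factorial * κ ^ (m + 1)) * A) / Q.H ^ m) := by
          gcongr
    _ = _ := by
      unfold traceConst
      simp only [Nat.add_sub_cancel, mul_pow]
      field_simp

end Patch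

end IgA

namespace IgA

open Set Filter Topology

variable {d : ℕ}

/-! ### Transition between two patches with a common side -/

namespace Side

variable (s t : Side d)

/-- The unit vector in the direction of the normal of the side. -/
noncomputable def dir : E d := EuclideanSpace.single s.1 (1 : ℝ)

/-- The projection that removes the normal coordinate. -/
noncomputable def tang : E d →L[ℝ] E d :=
  ContinuousLinearMap.id ℝ (E d) - (EuclideanSpace.proj (𝕜 := ℝ) s.1).smulRight s.dir

/-- The projection to the hyperplane that contains the side. -/
noncomputable def flat (ξ : E d) : E d := s.tang ξ + s.val • s.dir

@[simp] theorem dir_same : s.dir s.1 = 1 := by simp [dir]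

theorem dir_ne {j : Fin d} (h : j ≠ s.1) : s.dir j = 0 := by simp [dir, h]

theorem tang_apply (ξ : E d) : s.tang ξ = ξ - ξ s.1 • s.dir := rfl

@[simp] theorem tang_same (ξ : E d) : s.tang ξ s.1 = 0 := by simp [tang_apply]

theorem tang_ne (ξ : E d) {j : Fin d} (h : j ≠ s.1) : s.tang ξ j = ξ j := by
  simp [tang_apply, s.dir_ne h]

@[simp] theorem flat_same (ξ : E d) : s.flat ξ s.1 = s.val := by simp [flat]

theorem flat_ne (ξ : E d) {j : Fin d} (h : j ≠ s.1) : s.flat ξ j = ξ j := by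
  simp [flat, s.tang_ne _ h, s.dir_ne h]

theorem tang_add_smul (ξ : E d) (a : ℝ) : s.tang (ξ + a • s.dir) = s.tang ξ := by
  ext j
  by_cases h : j = s.1
  · subst h; simp
  · simp [s.tang_ne _ h, s.dir_ne h]

theorem tang_flat (ξ : E d) : s.tang (s.flat ξ) = s.tang ξ := by
  ext j
  by_cases h : j = s.1
  · subst h; simp
  · simp [s.tang_ne _ h, s.flat_ne _ h]

theorem tang_add_self (ξ : E d) : s.tang ξ + ξ s.1 • s.dir = ξ := by simp [tang_apply]

theorem flat_eq_self {ξ : E d} (h : ξ ∈ s.set) : s.flat ξ = ξ := by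
  rw [flat, ← h.2, tang_add_self]

theorem flat_mem_set {ξ : E d} (h : ξ ∈ cube d) : s.flat ξ ∈ s.set := by
  refine ⟨fun j => ?_, s.flat_same ξ⟩
  by_cases hj : j = s.1
  · subst hj; rw [flat_same]; exact s.val_mem
  · rw [s.flat_ne _ hj]; exact h j

theorem hasFDerivAt_flat (ξ : E d) : HasFDerivAt s.flat s.tang ξ :=
  s.tang.hasFDerivAt.add_const _

/-- The linear map that acts like `B` between the tangent spaces of the two sides and maps the
normal direction of `t` to the normal direction of `s`. -/
noncomputable def transition (B : E d →L[ℝ] E d) : E d →L[ℝ] E d :=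
  (s.tang.comp B).comp t.tang + (EuclideanSpace.proj (𝕜 := ℝ) t.1).smulRight s.dir

/-- Up to a null set, the tangential coordinates of a point of the cube are not knots. -/
theorem ae_ne_knot (kv : Fin d → KnotVector) :
    ∀ᵐ y ∂(volume : Measure (E d)), ∀ j, j ≠ s.1 → ∀ i, y j ≠ (kv j).knot i := by
  simp only [ae_all_iff]
  exact fun j _ i => measure_eq_zero_iff_ae_notMem.1 (volume_hyperplane j _)

end Side

namespace Patch

variable {Q R : Patch d} {κ : ℝ} {s t : Side d}

theorem mem_reg_of_mem_side {z : E d} (hz : z ∈ s.set)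
    (h : ∀ j, j ≠ s.1 → ∀ i, z j ≠ (Q.kv j).knot i) : z ∈ Q.reg := by
  refine Q.mem_reg hz.1 fun j => ?_
  by_cases hj : j = s.1
  · subst hj
    rw [hz.2]
    rcases s.val_eq with h | h <;> simp [h]
  · exact Or.inr (Or.inr (h j hj))

/-- The points `z` and `ζ` in the relative interior of the sides `s` and `t` have the same image,
and there the transition map between the sides is regular. -/
structure Transversal (Q R : Patch d) (s t : Side d) (z ζ : E d) : Prop where
  mem_reg : z ∈ Q.reg
  mem_set : z ∈ s.set
  mem_reg' : ζ ∈ R.reg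
  mem_set' : ζ ∈ t.set
  mem_Ioo : ∀ j, j ≠ t.1 → ζ j ∈ Ioo (0 : ℝ) 1
  eq : Q.G z = R.G ζ
  det_ne_zero : (s.transition t ((Q.DG z).inverse.comp (R.DG ζ))).det ≠ 0

/-- The transition map from `t` to `s` is extended to the cube by carrying the normal coordinate
along, which gives a map `Θ` that covers the cube and is differentiable on the sets `A c`. Points
over knots of `R` have null image, as differentiable maps preserve null sets, and critical points
have null image by Sard's theorem; almost every `y` avoids both. -/
theorem GeometryRegular.ae_transversal (h : Q.GeometryRegular κ) (hd : 0 < d)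
    (hst : Q.G '' s.set = R.G '' t.set) :
    ∀ᵐ y ∂volume.restrict (cube d), ∃ ζ, Transversal Q R s t (s.flat y) ζ := by
  obtain ⟨P, hP⟩ := R.exists_deg_le
  choose! g hg hg' using R.isCellwise_G hP
  let Z : E d → E d := fun ξ => Q.Ginv (R.G (t.flat ξ))
  let Θ : E d → E d := fun ξ => s.tang (Z ξ) + ξ t.1 • s.dir
  have hZ : ∀ ξ ∈ cube d, Z ξ ∈ s.set ∧ Q.G (Z ξ) = R.G (t.flat ξ) := by
    intro ξ hξ
    have h1 : R.G (t.flat ξ) ∈ Q.G '' s.set := hst ▸ mem_image_of_mem _ (t.flat_mem_set hξ)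
    obtain ⟨z, hz, hz'⟩ := h1
    have h2 : Z ξ = z := by
      change Q.Ginv _ = _
      rw [← hz', Q.Ginv_G hz.1]
    rw [h2]
    exact ⟨hz, hz'⟩
  have hsurj : ∀ y ∈ cube d, ∃ ξ ∈ cube d, Θ ξ = y ∧ Z ξ = s.flat y := by
    intro y hy
    have h1 : Q.G (s.flat y) ∈ R.G '' t.set := hst ▸ mem_image_of_mem _ (s.flat_mem_set hy)
    obtain ⟨ζ, hζ, hζ'⟩ := h1
    have h2 : t.flat (t.tang ζ + y s.1 • t.dir) = ζ := by
      rw [← t.flat_eq_self hζ, t.tang_flat]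
      simp only [Side.flat]
      rw [t.tang_add_smul, Side.tang_apply t (t.tang ζ)]
      simp
    have h3 : Z (t.tang ζ + y s.1 • t.dir) = s.flat y := by
      change Q.Ginv _ = _
      rw [h2, hζ', Q.Ginv_G (s.flat_mem_set hy).1]
    refine ⟨t.tang ζ + y s.1 • t.dir, fun j => ?_, ?_, h3⟩
    · by_cases hj : j = t.1
      · subst hj; simpa using hy s.1
      · simpa [t.tang_ne _ hj, t.dir_ne hj] using hζ.1 j
    · change s.tang (Z _) + _ = _
      rw [h3, s.tang_flat]
      simp [s.tang_add_self]
  -- For `y` in `S`, the point `s.flat y` is regular for `Q`, which makes `Q.Ginv` differentiable at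
  -- its image.
  let S : Set (E d) := {y | ∀ j, j ≠ s.1 → ∀ i, y j ≠ (Q.kv j).knot i}
  let A : MultiIndex R.kv → Set (E d) := fun c =>
    {ξ | ξ ∈ cube d ∧ t.flat ξ ∈ R.cell c ∧ Θ ξ ∈ S}
  have hreg : ∀ ξ ∈ cube d, Θ ξ ∈ S → Z ξ ∈ Q.reg := by
    intro ξ hξ hS
    refine mem_reg_of_mem_side (hZ ξ hξ).1 fun j hj i => ?_
    have := hS j hj i
    simpa [Θ, s.tang_ne _ hj, s.dir_ne hj] using this
  let Θ' : MultiIndex R.kv → E d → E d →L[ℝ] E d := fun c ξ =>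
    s.transition t ((Q.DG (Z ξ)).inverse.comp (fderiv ℝ (g c) (t.flat ξ)))
  have hder : ∀ c, R.Proper c → ∀ ξ ∈ A c, HasFDerivWithinAt Θ (Θ' c ξ) (A c) ξ := by
    rintro c hc ξ ⟨hξ, hξc, hξS⟩
    have h1 : HasFDerivWithinAt (fun ξ => R.G (t.flat ξ))
        ((fderiv ℝ (g c) (t.flat ξ)).comp t.tang) (A c) ξ := by
      have h2 := ((hg c hc).differentiable (t.flat ξ)).hasFDerivAt.comp ξ (t.hasFDerivAt_flat ξ)
      exact h2.hasFDerivWithinAt.congr (fun ζ hζ => hg' c hc hζ.2.1) (hg' c hc hξc)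
    have h3 := h.hasFDerivWithinAt_Ginv hd (hreg ξ hξ hξS)
    rw [(hZ ξ hξ).2] at h3
    have h4 : HasFDerivWithinAt Z _ (A c) ξ := h3.comp ξ h1 fun ζ hζ => by
      rw [← (hZ ζ hζ.1).2]
      exact Q.G_mem_Ωbar (hZ ζ hζ.1).1.1
    have h5 := s.tang.hasFDerivAt.comp_hasFDerivWithinAt ξ h4
    have h6 : HasFDerivAt (fun ξ : E d => ξ t.1 • s.dir)
        ((EuclideanSpace.proj (𝕜 := ℝ) t.1).smulRight s.dir) ξ :=
      ((EuclideanSpace.proj (𝕜 := ℝ) t.1).smulRight s.dir).hasFDerivAt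
    exact h5.add h6.hasFDerivWithinAt
  have hnull1 : ∀ c, R.Proper c →
      volume (Θ '' {ξ ∈ A c | ¬ ∀ j, j ≠ t.1 → ∀ i, ξ j ≠ (R.kv j).knot i}) = 0 := by
    intro c hc
    refine addHaar_image_eq_zero_of_differentiableOn_of_addHaar_eq_zero volume (fun ξ hξ =>
      ((hder c hc ξ hξ.1).mono fun _ h => h.1).differentiableWithinAt) ?_
    exact measure_mono_null (fun ξ hξ => hξ.2) (t.ae_ne_knot R.kv)
  have hnull2 : ∀ c, R.Proper c → volume (Θ '' {ξ ∈ A c | (Θ' c ξ).det = 0}) = 0 := by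
    intro c hc
    exact addHaar_image_eq_zero_of_det_fderivWithin_eq_zero volume (f' := Θ' c)
      (fun ξ hξ => (hder c hc ξ hξ.1).mono fun _ h => h.1) fun ξ hξ => hξ.2
  have hae1 : ∀ᵐ y ∂volume.restrict (cube d), ∀ c, R.Proper c →
      y ∉ Θ '' {ξ ∈ A c | ¬ ∀ j, j ≠ t.1 → ∀ i, ξ j ≠ (R.kv j).knot i} := by
    refine ae_restrict_of_ae ?_
    simp only [ae_all_iff]
    exact fun c hc => measure_eq_zero_iff_ae_notMem.1 (hnull1 c hc)
  have hae2 : ∀ᵐ y ∂volume.restrict (cube d), ∀ c, R.Proper c →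
      y ∉ Θ '' {ξ ∈ A c | (Θ' c ξ).det = 0} := by
    refine ae_restrict_of_ae ?_
    simp only [ae_all_iff]
    exact fun c hc => measure_eq_zero_iff_ae_notMem.1 (hnull2 c hc)
  filter_upwards [hae1, hae2, ae_restrict_of_ae (s.ae_ne_knot Q.kv),
    ae_restrict_mem isCompact_cube.isClosed.measurableSet] with y h1 h2 hyS hy
  obtain ⟨ξ, hξ, hξy, hξZ⟩ := hsurj y hy
  have hflat := t.flat_mem_set hξ
  obtain ⟨c, hc, hξc, hcn⟩ := R.exists_cell hflat.1
  have hA : ξ ∈ A c := ⟨hξ, hξc, by rw [hξy]; exact hyS⟩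
  have h3 : ∀ j, j ≠ t.1 → ∀ i, ξ j ≠ (R.kv j).knot i := by
    by_contra h4
    exact h1 c hc ⟨ξ, ⟨hA, h4⟩, hξy⟩
  have h4 : (Θ' c ξ).det ≠ 0 := fun h4 => h2 c hc ⟨ξ, ⟨hA, h4⟩, hξy⟩
  have h5 : ∀ j, j ≠ t.1 → ∀ i, t.flat ξ j ≠ (R.kv j).knot i := by
    intro j hj i
    rw [t.flat_ne _ hj]
    exact h3 j hj i
  have hcn' : R.cell c ∈ 𝓝[cube d] (t.flat ξ) := by
    refine hcn fun j => ?_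
    by_cases hj : j = t.1
    · subst hj
      rw [t.flat_same]
      rcases t.val_eq with h | h <;> simp [h]
    · exact Or.inr (Or.inr (h5 j hj))
  refine ⟨t.flat ξ, ⟨hξZ ▸ hreg ξ hξ hA.2.2, s.flat_mem_set hy, mem_reg_of_mem_side hflat h5,
    hflat, fun j hj => ?_, ?_, ?_⟩⟩
  · have h6 := hflat.1 j
    refine ⟨h6.1.lt_of_ne fun h7 => h5 j hj 0 ?_, h6.2.lt_of_ne fun h7 => h5 j hj (R.kv j).n ?_⟩
    · rw [(R.kv j).knot_first 0 (Nat.zero_le _), h7]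
    · rw [(R.kv j).knot_last _ le_rfl, h7]
  · rw [← hξZ]; exact (hZ ξ hξ).2
  · have h6 : R.DG (t.flat ξ) = fderiv ℝ (g c) (t.flat ξ) :=
      IsCellwise.fderivWithin_of_eqOn hcn' hflat.1 ((hg c hc).differentiable _) (hg' c hc)
    rw [h6, ← hξZ]
    exact h4

end Patch

end IgA

/-! ### Overlap of patches at a common side: each side has at most one neighbor. -/

namespace IgA

open Set Filter Topology

variable {d : ℕ}

theorem exists_equiv_of_injective {A : E d →L[ℝ] E d} (hA : ∀ v, A v = 0 → v = 0) :
    ∃ B : E d ≃L[ℝ] E d, (B : E d →L[ℝ] E d) = A := by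
  have h1 : Function.Injective (A : E d →ₗ[ℝ] E d) := by
    rw [← LinearMap.ker_eq_bot, LinearMap.ker_eq_bot']
    exact hA
  refine ⟨(LinearEquiv.ofInjectiveEndo _ h1).toContinuousLinearEquiv, ?_⟩
  ext1 v
  rfl

/-- The normal coordinate of `v` is zero by the `s.dir` component, and on such vectors the map
considered here is the transition map. -/
theorem Side.eq_zero_of_det_transition_ne_zero {s t : Side d} {B : E d →L[ℝ] E d}
    (h : (s.transition t B).det ≠ 0) {v : E d} (hv : s.tang (B v) + v t.1 • s.dir = 0) : v = 0 := by
  have h1 : v t.1 = 0 := by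
    have := congrArg (fun ξ : E d => ξ s.1) hv
    simpa using this
  have h2 : s.transition t B v = 0 := by
    have h3 : t.tang v = v := by rw [Side.tang_apply, h1]; simp
    change s.tang (B (t.tang v)) + v t.1 • s.dir = 0
    rw [h3, hv]
  have h4 : Function.Injective (s.transition t B : E d →ₗ[ℝ] E d) :=
    (LinearMap.equivOfDetNeZero _ h).injective
  exact h4 (h2.trans (map_zero _).symm)

namespace Patch

variable {Q R : Patch d} {κ : ℝ} {s t : Side d} {z ζ : E d}

/-- Near a transversal point of a common side, a patch disjoint from `Q` covers the outward normal
segment in the coordinates of `Q`. -/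
theorem Transversal.exists_segment (T : Transversal Q R s t z ζ) (h : Q.GeometryRegular κ)
    (hd : 0 < d) (hdisj : Disjoint R.Ω Q.Ωbar) {c : MultiIndex Q.kv} (hc : Q.cell c ∈ 𝓝[cube d] z)
    {n : ℕ} {G' : E d → E d} (hG : IsPiece n G') (hG' : EqOn Q.G G' (Q.cell c)) :
    ∃ r₀ > 0, ∀ r ∈ Ioo 0 r₀, G' (z - ((1 - 2 * s.val) * r) • s.dir) ∈ R.Ω := by
  obtain ⟨A, hA⟩ := h.exists_equiv hd T.mem_reg
  have hA' : (A : E d →L[ℝ] E d) = fderiv ℝ G' z := by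
    rw [hA]
    exact IsCellwise.fderivWithin_of_eqOn hc T.mem_reg.1 (hG.differentiable z) hG'
  have hGs : HasStrictFDerivAt G' (A : E d →L[ℝ] E d) z := by
    rw [hA']
    exact hG.contDiff.contDiffAt.hasStrictFDerivAt (by simp)
  obtain ⟨P, hP⟩ := R.exists_deg_le
  obtain ⟨_, b, hb, hb'⟩ := id T.mem_reg'
  obtain ⟨F, hF, hF'⟩ := R.isCellwise_G hP b hb
  have hFs : HasStrictFDerivAt F (R.DG ζ) ζ := by
    rw [DG, IsCellwise.fderivWithin_of_eqOn hb' T.mem_reg'.1 (hF.differentiable ζ) hF']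
    exact hF.contDiff.contDiffAt.hasStrictFDerivAt (by simp)
  have hFG : F ζ = G' z := by
    rw [← hG' (mem_of_mem_nhdsWithin T.mem_reg.1 hc), T.eq,
      hF' (mem_of_mem_nhdsWithin T.mem_reg'.1 hb')]
  -- The smooth piece `G'` is inverted on a full neighborhood, so `g` expresses points of `R` in
  -- coordinates of `Q` beyond the side.
  let e := hGs.toOpenPartialHomeomorph G'
  let g : E d → E d := fun ξ => e.symm (F ξ)
  have hgζ : g ζ = z := by
    change e.symm (F ζ) = z
    rw [hFG]
    exact e.left_inv hGs.mem_toOpenPartialHomeomorph_source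
  have hgs : HasStrictFDerivAt g ((A.symm : E d →L[ℝ] E d).comp (R.DG ζ)) ζ := by
    have h1 := hGs.to_localInverse
    rw [← hFG] at h1
    exact h1.comp ζ hFs
  let Φ : E d → E d := fun ξ => s.tang (g ξ) + ξ t.1 • s.dir
  have hΦ : HasStrictFDerivAt Φ (s.tang.comp ((A.symm : E d →L[ℝ] E d).comp (R.DG ζ)) +
      (EuclideanSpace.proj (𝕜 := ℝ) t.1).smulRight s.dir) ζ :=
    (s.tang.hasStrictFDerivAt.comp ζ hgs).add
      ((EuclideanSpace.proj (𝕜 := ℝ) t.1).smulRight s.dir).hasStrictFDerivAt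
  obtain ⟨B, hB⟩ := exists_equiv_of_injective (A := s.tang.comp
      ((A.symm : E d →L[ℝ] E d).comp (R.DG ζ)) +
      (EuclideanSpace.proj (𝕜 := ℝ) t.1).smulRight s.dir) fun v hv => by
    have h1 := T.det_ne_zero
    rw [← hA, ContinuousLinearMap.inverse_equiv] at h1
    exact Side.eq_zero_of_det_transition_ne_zero h1 hv
  rw [← hB] at hΦ
  let eΦ := hΦ.toOpenPartialHomeomorph Φ
  -- A curve in the parameter domain of `R`: it leaves `ζ` inwards while the tangential coordinates
  -- with respect to `Q` stay fixed.
  let ρ : ℝ → E d := fun τ => eΦ.symm (Φ ζ + ((1 - 2 * t.val) * τ) • s.dir)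
  have hρ0 : ρ 0 = ζ := by
    change eΦ.symm _ = ζ
    rw [mul_zero, zero_smul, add_zero]
    exact eΦ.left_inv hΦ.mem_toOpenPartialHomeomorph_source
  have hline : Continuous fun τ : ℝ => Φ ζ + ((1 - 2 * t.val) * τ) • s.dir := by fun_prop
  have hline0 : Φ ζ + ((1 - 2 * t.val) * 0) • s.dir = Φ ζ := by simp
  have htarget : ∀ᶠ τ in 𝓝 (0 : ℝ), Φ ζ + ((1 - 2 * t.val) * τ) • s.dir ∈ eΦ.target := by
    refine hline.continuousAt.eventually (eΦ.open_target.mem_nhds ?_)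
    change Φ ζ + ((1 - 2 * t.val) * 0) • s.dir ∈ eΦ.target
    rw [hline0]
    exact hΦ.image_mem_toOpenPartialHomeomorph_target
  have hρc : ∀ τ, Φ ζ + ((1 - 2 * t.val) * τ) • s.dir ∈ eΦ.target → ContinuousAt ρ τ :=
    fun τ hτ => (eΦ.continuousAt_symm hτ).comp (f := fun τ : ℝ =>
      Φ ζ + ((1 - 2 * t.val) * τ) • s.dir) hline.continuousAt
  have hρΦ : ∀ τ, Φ ζ + ((1 - 2 * t.val) * τ) • s.dir ∈ eΦ.target →
      Φ (ρ τ) = Φ ζ + ((1 - 2 * t.val) * τ) • s.dir := fun τ hτ => eΦ.right_inv hτ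
  have hgc : ContinuousAt g ζ := hgs.hasFDerivAt.continuousAt
  have hnear : ∀ᶠ ξ in 𝓝 ζ, F ξ ∈ e.target ∧ (ξ ∈ cube d → ξ ∈ R.cell b) ∧
      (g ξ ∈ cube d → g ξ ∈ Q.cell c) ∧ (∀ j, j ≠ t.1 → ξ j ∈ Ioo (0 : ℝ) 1) ∧
      g ξ s.1 ∈ Ioo (s.val - 1) (s.val + 1) := by
    refine Filter.Eventually.and ?_ (Filter.Eventually.and ?_ (Filter.Eventually.and ?_
      (Filter.Eventually.and ?_ ?_)))
    · refine hF.contDiff.continuous.continuousAt.eventually (e.open_target.mem_nhds ?_)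
      rw [hFG]
      exact hGs.image_mem_toOpenPartialHomeomorph_target
    · exact eventually_nhdsWithin_iff.1 hb'
    · refine hgc.eventually (p := fun w => w ∈ cube d → w ∈ Q.cell c) ?_
      rw [hgζ]
      exact eventually_nhdsWithin_iff.1 hc
    · refine eventually_all.2 fun j => ?_
      by_cases hj : j = t.1
      · exact Filter.Eventually.of_forall fun _ h => absurd hj h
      · filter_upwards [(continuous_coord j).continuousAt.eventually
          (isOpen_Ioo.mem_nhds (T.mem_Ioo j hj))] with ξ hξ _ using hξ
    · refine ((continuous_coord s.1).continuousAt.comp hgc).eventually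
        (isOpen_Ioo.mem_nhds ?_)
      simp only [Function.comp_apply, hgζ]
      rw [T.mem_set.2]
      constructor <;> linarith
  have hρ0c : ContinuousAt ρ 0 := hρc 0 htarget.self_of_nhds
  have hnear' := hρ0c.eventually (p := fun ξ => F ξ ∈ e.target ∧ (ξ ∈ cube d → ξ ∈ R.cell b) ∧
      (g ξ ∈ cube d → g ξ ∈ Q.cell c) ∧ (∀ j, j ≠ t.1 → ξ j ∈ Ioo (0 : ℝ) 1) ∧
      g ξ s.1 ∈ Ioo (s.val - 1) (s.val + 1)) (by rw [hρ0]; exact hnear)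
  obtain ⟨ε, hε, hball⟩ := Metric.eventually_nhds_iff_ball.1 (htarget.and hnear')
  -- Half the radius allows a closed interval; the bound 1/2 keeps the normal coordinate off the
  -- opposite side of `R`.
  let ε' := min (ε / 2) (1 / 2)
  have hε' : 0 < ε' := lt_min (by linarith) (by norm_num)
  have hε1 : ε' ≤ 1 / 2 := min_le_right _ _
  have hprop : ∀ τ ∈ Icc 0 ε', _ := fun τ hτ => hball τ (by
    have : ε' ≤ ε / 2 := min_le_left _ _
    rw [Metric.mem_ball, Real.dist_eq, sub_zero, abs_of_nonneg hτ.1]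
    linarith [hτ.2])
  have hgρ : ∀ τ ∈ Icc 0 ε', g (ρ τ) = z + (g (ρ τ) s.1 - s.val) • s.dir ∧
      ρ τ t.1 = t.val + (1 - 2 * t.val) * τ := by
    intro τ hτ
    have h1 := hρΦ τ (hprop τ hτ).1
    have h2 : s.tang (g (ρ τ)) + ρ τ t.1 • s.dir =
      s.tang (g ζ) + ζ t.1 • s.dir + ((1 - 2 * t.val) * τ) • s.dir := h1
    rw [hgζ, T.mem_set'.2] at h2
    have h3 : ρ τ t.1 = t.val + (1 - 2 * t.val) * τ := by
      have := congrArg (fun ξ : E d => ξ s.1) h2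
      simpa using this
    refine ⟨?_, h3⟩
    rw [h3, add_assoc, ← add_smul] at h2
    have h4 := add_right_cancel h2
    rw [← s.tang_add_self (g (ρ τ)), h4]
    nth_rewrite 2 [← s.tang_add_self z]
    rw [T.mem_set.2, add_assoc, ← add_smul]
    simp
  have hv := s.val_eq
  have hw := t.val_eq
  -- The signed outward distance from the side `s`, in coordinates of `Q`.
  let f : ℝ → ℝ := fun τ => -(1 - 2 * s.val) * (g (ρ τ) s.1 - s.val)
  have hfeq : ∀ τ ∈ Icc 0 ε', z - ((1 - 2 * s.val) * f τ) • s.dir = g (ρ τ) := by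
    intro τ hτ
    rw [(hgρ τ hτ).1, sub_eq_add_neg, ← neg_smul]
    congr 2
    simp only [f]
    rcases hv with hv | hv <;> rw [hv] <;> ring
  have hfG : ∀ τ ∈ Icc 0 ε', G' (g (ρ τ)) = F (ρ τ) := fun τ hτ => e.right_inv (hprop τ hτ).2.1
  have hmem : ∀ τ ∈ Ioc 0 ε', ρ τ ∈ openCube d := by
    intro τ hτ j
    by_cases hj : j = t.1
    · subst hj
      rw [(hgρ τ ⟨hτ.1.le, hτ.2⟩).2]
      rcases hw with hw | hw <;> rw [hw] <;> constructor <;> linarith [hτ.1, hτ.2]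
    · exact (hprop τ ⟨hτ.1.le, hτ.2⟩).2.2.2.2.1 j hj
  have hΩ : ∀ τ ∈ Ioc 0 ε', G' (g (ρ τ)) ∈ R.Ω := by
    intro τ hτ
    have h1 := hmem τ hτ
    rw [hfG τ ⟨hτ.1.le, hτ.2⟩, ← hF' ((hprop τ ⟨hτ.1.le, hτ.2⟩).2.2.1 (openCube_subset_cube h1))]
    exact mem_image_of_mem _ h1
  -- If the curve did not move outwards, its point would lie in the cube of `Q`, and `R.Ω` would
  -- meet the closed patch `Q.Ωbar`.
  have hpos : ∀ τ ∈ Ioc 0 ε', 0 < f τ := by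
    intro τ hτ
    have hτ' : τ ∈ Icc 0 ε' := ⟨hτ.1.le, hτ.2⟩
    obtain ⟨_, _, _, h3, _, h5⟩ := hprop τ hτ'
    by_contra hneg
    have h6 : g (ρ τ) ∈ cube d := by
      intro j
      by_cases hj : j = s.1
      · subst hj
        simp only [f, not_lt] at hneg
        rcases hv with hv | hv <;> rw [hv] at hneg h5 <;> constructor <;>
          linarith [h5.1, h5.2]
      · rw [(hgρ τ hτ').1]
        simpa [s.dir_ne hj] using T.mem_set.1 j
    refine hdisj.le_bot ⟨hΩ τ hτ, ?_⟩
    rw [← hG' (h3 h6)]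
    exact Q.G_mem_Ωbar h6
  have hfc : ContinuousOn f (Icc 0 ε') := by
    intro τ hτ
    obtain ⟨h1, h2, _⟩ := hprop τ hτ
    have h4 : ContinuousAt g (ρ τ) := (e.continuousAt_symm h2).comp (f := F)
      hF.contDiff.continuous.continuousAt
    have h5 : ContinuousAt (fun τ => g (ρ τ)) τ := h4.comp (hρc τ h1)
    have h6 : ContinuousAt (fun τ => g (ρ τ) s.1) τ := (continuous_coord s.1).continuousAt.comp h5
    exact (continuousAt_const.mul (h6.sub continuousAt_const)).continuousWithinAt
  have hf0 : f 0 = 0 := by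
    simp only [f, hρ0, hgζ, T.mem_set.2, sub_self, mul_zero]
  refine ⟨f ε', hpos ε' ⟨hε', le_rfl⟩, fun r hr => ?_⟩
  -- The curve stays on the normal line, so by continuity it sweeps out the whole segment.
  obtain ⟨τ, hτ, hτr⟩ := intermediate_value_Icc hε'.le hfc (by
    rw [hf0]; exact ⟨hr.1.le, hr.2.le⟩)
  have hτ0 : τ ≠ 0 := by
    rintro rfl
    rw [hf0] at hτr
    exact hr.1.ne hτr
  rw [← hτr, hfeq τ hτ]
  exact hΩ τ ⟨hτ.1.lt_of_ne hτ0.symm, hτ.2⟩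

/-- Two disjoint patches cannot both share the side `s` of the patch `Q`. -/
theorem GeometryRegular.not_disjoint (h : Q.GeometryRegular κ) (hd : 0 < d) {R' : Patch d}
    {t' : Side d} (hst : Q.G '' s.set = R.G '' t.set) (hst' : Q.G '' s.set = R'.G '' t'.set)
    (hR : Disjoint R.Ω Q.Ωbar) (hR' : Disjoint R'.Ω Q.Ωbar) : ¬ Disjoint R.Ω R'.Ω := by
  have h1 : (volume.restrict (cube d)) ≠ 0 := by
    rw [Ne, Measure.restrict_eq_zero]
    have := (isOpen_openCube (d := d)).measure_pos volume openCube_nonempty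
    exact (this.trans_le (measure_mono openCube_subset_cube)).ne'
  have : (ae (volume.restrict (cube d))).NeBot := ae_neBot.2 h1
  -- Both neighbors are generic at a common point of the side; near it they cover the same outward
  -- segment.
  obtain ⟨y, ⟨ζ, hy⟩, ⟨ζ', hy'⟩⟩ := ((h.ae_transversal hd hst).and (h.ae_transversal hd hst')).exists
  obtain ⟨P, hP⟩ := Q.exists_deg_le
  obtain ⟨_, c, hc, hc'⟩ := id hy.mem_reg
  obtain ⟨G', hG, hG'⟩ := Q.isCellwise_G hP c hc
  obtain ⟨r, hr, hseg⟩ := hy.exists_segment h hd hR hc' hG hG'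
  obtain ⟨r', hr', hseg'⟩ := hy'.exists_segment h hd hR' hc' hG hG'
  have h2 : 0 < min r r' := lt_min hr hr'
  exact Set.not_disjoint_iff.2 ⟨_,
    hseg (min r r' / 2) ⟨by linarith, by linarith [min_le_left r r']⟩,
    hseg' (min r r' / 2) ⟨by linarith, by linarith [min_le_right r r']⟩⟩

end Patch

namespace MultiPatch

variable {N : ℕ} (M : MultiPatch d N) {k l l' : Fin N} {κ : ℝ}

/-- By matching, a common point of the closed patches lies on a proper facet of each, and
injectivity keeps facets out of the open patch. -/
theorem disjoint_Ω_Ωbar (h : l ≠ k) : Disjoint (M.patch l).Ω (M.patch k).Ωbar := by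
  rw [Set.disjoint_left]
  intro x hx hx'
  obtain ⟨S, T, _, ⟨t, ht⟩, h1, h2⟩ :=
    M.matching k l h.symm x ⟨hx', (M.patch l).Ω_subset_Ωbar hx⟩
  rw [h2] at h1
  obtain ⟨ξ, hξ, rfl⟩ := h1
  have h3 := (M.patch l).Ginv_mem_openCube hx t.1
  rw [(M.patch l).Ginv_G hξ.1, hξ.2 t ht] at h3
  rcases t.val_eq with h4 | h4 <;> rw [h4] at h3
  · exact lt_irrefl _ h3.1
  · exact lt_irrefl _ h3.2

theorem mem_sharedSides {s : Side d} : s ∈ M.sharedSides k l ↔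
    ∃ t : Side d, (M.patch k).G '' s.set = (M.patch l).G '' t.set := by
  simp [sharedSides]

theorem mem_neighbors : l ∈ M.neighbors k ↔ l ≠ k ∧ (M.sharedSides k l).Nonempty := by
  simp [neighbors]

/-- A side of a patch is shared with at most one other patch. -/
theorem eq_of_mem_sharedSides (h : (M.patch k).GeometryRegular κ) (hd : 0 < d) (hl : l ≠ k)
    (hl' : l' ≠ k) {s : Side d} (hs : s ∈ M.sharedSides k l) (hs' : s ∈ M.sharedSides k l') :
    l = l' := by
  by_contra hne
  obtain ⟨t, ht⟩ := M.mem_sharedSides.1 hs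
  obtain ⟨t', ht'⟩ := M.mem_sharedSides.1 hs'
  exact h.not_disjoint hd ht ht' (M.disjoint_Ω_Ωbar hl) (M.disjoint_Ω_Ωbar hl')
    (M.disjoint l l' hne)

end MultiPatch

end IgA

namespace IgA

open Set Filter Topology Finset

variable {d : ℕ}

namespace Patch

variable {Q : Patch d} {κ : ℝ} {n : ℕ} {u v w : E d → ℝ}

/-! ### The Dirichlet form of a patch -/

variable (Q) in
/-- The Dirichlet form on a patch. -/
noncomputable def energy (u v : E d → ℝ) : ℝ := ∫ x in Q.Ω, inner ℝ (Q.grad u x) (Q.grad v x)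

theorem energy_comm : Q.energy u v = Q.energy v u := by
  simp only [energy, real_inner_comm]

theorem energy_self_nonneg : 0 ≤ Q.energy u u :=
  integral_nonneg fun _ => real_inner_self_nonneg

theorem GeometryRegular.energy_add_left (h : Q.GeometryRegular κ) (hd : 0 < d)
    (hu : Q.IsCellwise n (u ∘ Q.G)) (hv : Q.IsCellwise n (v ∘ Q.G))
    (hw : Q.IsCellwise n (w ∘ Q.G)) : Q.energy (u + v) w = Q.energy u w + Q.energy v w := by
  have h1 := integrableOn_Ω_iff.1 (h.integrableOn_inner_grad hd hu hw)
  have h2 := integrableOn_Ω_iff.1 (h.integrableOn_inner_grad hd hv hw)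
  simp only [energy, setIntegral_Ω]
  rw [← integral_add h1 h2]
  refine setIntegral_congr_fun measurableSet_core fun ξ hξ => ?_
  simp only [h.grad_add hd hu hv hξ.1, inner_add_left, mul_add]

theorem GeometryRegular.energy_smul_left (h : Q.GeometryRegular κ) (hd : 0 < d)
    (hu : Q.IsCellwise n (u ∘ Q.G)) (c : ℝ) : Q.energy (c • u) w = c * Q.energy u w := by
  simp only [energy, setIntegral_Ω]
  rw [← integral_const_mul]
  refine setIntegral_congr_fun measurableSet_core fun ξ hξ => ?_
  simp only [h.grad_smul hd hu c hξ.1, real_inner_smul_left]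
  ring

/-! ### Side integrals -/

theorem sideIntegral_congr {s : Side d} {f g : E d → ℝ} (h : ∀ x ∈ Q.G '' s.set, f x = g x) :
    Q.sideIntegral s f = Q.sideIntegral s g := by
  refine setIntegral_congr_fun s.measurableSet_box fun η hη => ?_
  simp only [h _ (mem_image_of_mem _ (s.embed_mem_set hη))]

theorem sideIntegral_const_mul {s : Side d} (c : ℝ) (f : E d → ℝ) :
    Q.sideIntegral s (fun x => c * f x) = c * Q.sideIntegral s f := by
  simp only [sideIntegral, mul_assoc, integral_const_mul]

theorem sideIntegral_nonneg {s : Side d} {f : E d → ℝ} (h : ∀ x, 0 ≤ f x) :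
    0 ≤ Q.sideIntegral s f :=
  integral_nonneg fun _ => mul_nonneg (h _) (surfaceElement_nonneg _ _)

variable (Q) in
/-- The function is measurable and essentially bounded on the side. -/
def SideBounded (s : Side d) (f : E d → ℝ) : Prop :=
  MemLp (fun η => f (Q.G (s.embed η))) ⊤ (volume.restrict s.box)

theorem SideBounded.mul {s : Side d} {f g : E d → ℝ} (hf : Q.SideBounded s f)
    (hg : Q.SideBounded s g) : Q.SideBounded s fun x => f x * g x := by
  have : MemLp _ ⊤ (volume.restrict s.box) := MemLp.mul (r := ⊤) hg hf
  exact this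

theorem SideBounded.sub {s : Side d} {f g : E d → ℝ} (hf : Q.SideBounded s f)
    (hg : Q.SideBounded s g) : Q.SideBounded s fun x => f x - g x :=
  MemLp.sub hf hg

theorem SideBounded.integrable {s : Side d} {f : E d → ℝ} (hf : Q.SideBounded s f)
    (h : Q.GeometryRegular κ) (hd : 0 < d) :
    Integrable (fun η => f (Q.G (s.embed η)) * Q.surfaceElement s (s.embed η))
      (volume.restrict s.box) := by
  have : MemLp _ ⊤ (volume.restrict s.box) := MemLp.mul (r := ⊤) (h.memLp_surfaceElement hd s) hf
  exact this.integrable le_top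

theorem SideBounded.of_continuousOn {s : Side d} {f : E d → ℝ}
    (hf : ContinuousOn f (Q.G '' s.set)) : Q.SideBounded s f := by
  have hbox : IsCompact s.box := by
    have h : s.box = univ.pi fun _ => Set.Icc (0 : ℝ) 1 :=
      Set.ext fun η => ⟨fun h j _ => h j, fun h j => h j (Set.mem_univ j)⟩
    rw [h]
    exact isCompact_univ_pi fun _ => isCompact_Icc
  have h1 : ContinuousOn (fun η => f (Q.G (s.embed η))) s.box := by
    refine hf.comp (Q.continuousOn_G.comp s.continuous_embed.continuousOn ?_) ?_
    · exact fun η hη => (s.embed_mem_set hη).1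
    · exact fun η hη => mem_image_of_mem _ (s.embed_mem_set hη)
  obtain ⟨C, hC⟩ := hbox.exists_bound_of_continuousOn h1
  refine memLp_top_of_bound (h1.aestronglyMeasurable s.measurableSet_box) C ?_
  filter_upwards [ae_restrict_mem s.measurableSet_box] with η hη using hC η hη

theorem sideIntegral_mono (h : Q.GeometryRegular κ) (hd : 0 < d) {s : Side d} {f g : E d → ℝ}
    (hf : Q.SideBounded s f) (hg : Q.SideBounded s g) (hfg : ∀ x, f x ≤ g x) :
    Q.sideIntegral s f ≤ Q.sideIntegral s g :=
  integral_mono (hf.integrable h hd) (hg.integrable h hd) fun _ =>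
    mul_le_mul_of_nonneg_right (hfg _) (surfaceElement_nonneg _ _)

theorem sideIntegral_add (h : Q.GeometryRegular κ) (hd : 0 < d) {s : Side d} {f g : E d → ℝ}
    (hf : Q.SideBounded s f) (hg : Q.SideBounded s g) :
    Q.sideIntegral s (fun x => f x + g x) = Q.sideIntegral s f + Q.sideIntegral s g := by
  simp only [sideIntegral, add_mul]
  exact integral_add (hf.integrable h hd) (hg.integrable h hd)

theorem GeometryRegular.sideIntegral_normalDeriv_add_mul (h : Q.GeometryRegular κ) (hd : 0 < d)
    (hu : Q.IsCellwise n (u ∘ Q.G)) (hv : Q.IsCellwise n (v ∘ Q.G)) {s : Side d} {J : E d → ℝ}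
    (hJ : Q.SideBounded s J) :
    Q.sideIntegral s (fun x => Q.normalDeriv s (u + v) x * J x) =
      Q.sideIntegral s (fun x => Q.normalDeriv s u x * J x) +
        Q.sideIntegral s (fun x => Q.normalDeriv s v x * J x) := by
  rw [← sideIntegral_add h hd (SideBounded.mul (h.memLp_normalDeriv hd hu s) hJ)
    (SideBounded.mul (h.memLp_normalDeriv hd hv s) hJ)]
  refine integral_congr_ae ?_
  filter_upwards [Q.ae_embed_mem_reg s] with η hη
  simp only [normalDeriv, h.grad_add hd hu hv hη, inner_add_left, add_mul]

theorem GeometryRegular.sideIntegral_normalDeriv_smul_mul (h : Q.GeometryRegular κ) (hd : 0 < d)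
    (hu : Q.IsCellwise n (u ∘ Q.G)) (c : ℝ) {s : Side d} {J : E d → ℝ} :
    Q.sideIntegral s (fun x => Q.normalDeriv s (c • u) x * J x) =
      c * Q.sideIntegral s (fun x => Q.normalDeriv s u x * J x) := by
  rw [← sideIntegral_const_mul]
  refine integral_congr_ae ?_
  filter_upwards [Q.ae_embed_mem_reg s] with η hη
  simp only [normalDeriv, h.grad_smul hd hu c hη, real_inner_smul_left]
  ring

end Patch

namespace MultiPatch

variable {N : ℕ} {M : MultiPatch d N} {k l : Fin N} {κ : ℝ} {P : ℕ}

/-! ### The discrete spaces -/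

theorem isCellwise_of_mem_V (hP : ∀ ι, ((M.patch k).kv ι).deg ≤ P) {u : E d → ℝ}
    (hu : u ∈ M.V k) : (M.patch k).IsCellwise (P + 1) (u ∘ (M.patch k).G) := by
  induction hu using Submodule.span_induction with
  | mem u hu =>
    obtain ⟨i, rfl, _⟩ := hu
    refine ((M.patch k).isCellwise_tbspline hP i).congr fun ξ hξ => ?_
    simp only [Function.comp_apply, Patch.basis]
    rw [Set.indicator_of_mem ((M.patch k).G_mem_Ωbar hξ), (M.patch k).Ginv_G hξ]
  | zero => exact Patch.IsCellwise.zero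
  | add u v _ _ hu hv => exact hu.add hv
  | smul c u _ hu => exact hu.clm_comp (c • ContinuousLinearMap.id ℝ ℝ)

theorem eq_zero_of_mem_V {u : E d → ℝ} (hu : u ∈ M.V k) {x : E d}
    (hx : x ∉ (M.patch k).Ωbar) : u x = 0 := by
  induction hu using Submodule.span_induction with
  | mem u hu =>
    obtain ⟨i, rfl, _⟩ := hu
    exact Set.indicator_of_notMem hx _
  | zero => rfl
  | add u v _ _ hu hv => simp [hu, hv]
  | smul c u _ hu => simp [hu]

theorem eq_zero_of_mem_dirichlet {u : E d → ℝ} (hu : u ∈ M.V k) {s : Side d}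
    (hs : s ∈ M.dirichlet k) {x : E d} (hx : x ∈ (M.patch k).G '' s.set) : u x = 0 := by
  induction hu using Submodule.span_induction with
  | mem u hu =>
    obtain ⟨i, _, h⟩ := hu
    exact h s hs x hx
  | zero => rfl
  | add u v _ _ hu hv => simp [hu, hv]
  | smul c u _ hu => simp [hu]

theorem continuousOn_of_mem_V {u : E d → ℝ} (hu : u ∈ M.V k) :
    ContinuousOn u (M.patch k).Ωbar := by
  obtain ⟨P, hP⟩ := (M.patch k).exists_deg_le
  refine ((isCellwise_of_mem_V hP hu).continuousOn.comp (M.patch k).continuousOn_Ginv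
    fun x hx => (M.patch k).Ginv_mem hx).congr fun x hx => ?_
  simp [(M.patch k).G_Ginv hx]

theorem finiteDimensional_V : FiniteDimensional ℝ (M.V k) :=
  FiniteDimensional.span_of_finite ℝ ((finite_range (M.patch k).basis).subset fun u hu => by
    obtain ⟨i, rfl, _⟩ := hu
    exact mem_range_self i)

theorem Vsupp_le_V (A : Set (E d)) : M.Vsupp l A ≤ M.V l :=
  Submodule.span_mono fun _ h => h.1

theorem mem_Vext {u : Fin N → E d → ℝ} : u ∈ M.Vext k ↔ u k ∈ M.V k ∧
    (∀ l ∈ M.neighbors k, u l ∈ M.Vsupp l (M.F l k)) ∧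
    ∀ l, l ≠ k → l ∉ M.neighbors k → u l = 0 := by
  have hk : k ∉ M.neighbors k := fun h => (M.mem_neighbors.1 h).1 rfl
  simp only [Vext, Submodule.mem_pi, Set.mem_univ, true_implies]
  constructor
  · intro h
    refine ⟨by simpa using h k, fun l hl => ?_, fun l hl hl' => ?_⟩
    · have := h l
      rwa [if_neg (fun h : l = k => hk (h ▸ hl)), if_pos hl] at this
    · have := h l
      rwa [if_neg hl, if_neg hl', Submodule.mem_bot] at this
  · rintro ⟨h1, h2, h3⟩ l
    by_cases hl : l = k
    · subst hl; simpa using h1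
    · rw [if_neg hl]
      split_ifs with hl'
      · exact h2 l hl'
      · exact (Submodule.mem_bot ℝ).2 (h3 l hl hl')

theorem W_le_Vext : M.W k ≤ M.Vext k := by
  refine Submodule.pi_mono fun l _ => ?_
  by_cases hl : l = k
  · subst hl
    simpa using Vsupp_le_V _
  · simp [hl]

theorem mem_VI {v : Fin N → E d → ℝ} : v ∈ M.VI k ↔
    v k ∈ M.V k ∧ (∀ x ∈ M.Γ k, v k x = 0) ∧ ∀ l, l ≠ k → v l = 0 := Iff.rfl

theorem image_side_subset_Γ (hl : l ∈ M.neighbors k) {s : Side d} (hs : s ∈ M.sharedSides k l) :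
    (M.patch k).G '' s.set ⊆ M.Γ k := fun _ hx =>
  mem_iUnion₂.2 ⟨l, hl, mem_iUnion₂.2 ⟨s, hs, hx⟩⟩

theorem image_side_subset_Ωbar {s : Side d} (hs : s ∈ M.sharedSides k l) :
    (M.patch k).G '' s.set ⊆ (M.patch l).Ωbar := by
  obtain ⟨t, ht⟩ := M.mem_sharedSides.1 hs
  rw [ht]
  exact image_mono fun _ h => h.1

theorem sideBounded_jump {u : Fin N → E d → ℝ} (hu : u ∈ M.Vext k) (hl : l ∈ M.neighbors k)
    {s : Side d} (hs : s ∈ M.sharedSides k l) :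
    (M.patch k).SideBounded s fun x => u l x - u k x := by
  obtain ⟨h1, h2, _⟩ := mem_Vext.1 hu
  refine Patch.SideBounded.sub (.of_continuousOn ?_) (.of_continuousOn ?_)
  · exact (continuousOn_of_mem_V (Vsupp_le_V _ (h2 l hl))).mono (image_side_subset_Ωbar hs)
  · exact (continuousOn_of_mem_V h1).mono (image_mono fun _ h => h.1)

theorem sub_mem_VI {B : (Fin N → E d → ℝ) → (Fin N → E d → ℝ) → ℝ} {u w : Fin N → E d → ℝ}
    (hu : u ∈ M.Vext k) (hw : M.IsHarmonicExtension B k u w) : w - u ∈ M.VI k := by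
  obtain ⟨h1, _, h3, h4⟩ := hw
  rw [mem_Vext] at hu h1
  refine mem_VI.2 ⟨Submodule.sub_mem _ h1.1 hu.1, fun x hx => by simp [h3 x hx], fun l hl => ?_⟩
  by_cases hl' : l ∈ M.neighbors k
  · simp [h4 l hl']
  · simp [h1.2.2 l hl hl', hu.2.2 l hl hl']

theorem VI_le_Vext : M.VI k ≤ M.Vext k := by
  intro v hv
  obtain ⟨h1, _, h3⟩ := mem_VI.1 hv
  refine mem_Vext.2 ⟨h1, fun l hl => ?_, fun l hl _ => h3 l hl⟩
  rw [h3 l (M.mem_neighbors.1 hl).1]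
  exact Submodule.zero_mem _

/-! ### The bilinear forms -/

variable {α : Fin N → ℝ} {δ : ℝ}

theorem a_eq (u v : Fin N → E d → ℝ) : M.a α k u v = α k * (M.patch k).energy (u k) (v k) := by
  simp only [a, Patch.energy, integral_const_mul]

/-- The part of the consistency form that does not vanish for test functions in `VI`. -/
noncomputable def consistency (M : MultiPatch d N) (α : Fin N → ℝ) (k : Fin N)
    (w v : Fin N → E d → ℝ) : ℝ :=
  ∑ l ∈ M.neighbors k, ∑ s ∈ M.sharedSides k l, α k / 2 * (M.patch k).sideIntegral s
    fun x => (M.patch k).normalDeriv s (v k) x * (w l x - w k x)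

theorem jump_eq_zero_of_mem_VI {v : Fin N → E d → ℝ} (hv : v ∈ M.VI k) (hl : l ∈ M.neighbors k)
    {s : Side d} (hs : s ∈ M.sharedSides k l) {x : E d} (hx : x ∈ (M.patch k).G '' s.set) :
    v l x - v k x = 0 := by
  obtain ⟨_, h2, h3⟩ := mem_VI.1 hv
  rw [h3 l (M.mem_neighbors.1 hl).1, h2 x (image_side_subset_Γ hl hs hx)]
  simp

/-- The other half of the form carries the jump of `v`, which vanishes on the shared sides. -/
theorem s_eq_consistency (w : Fin N → E d → ℝ) {v : Fin N → E d → ℝ} (hv : v ∈ M.VI k) :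
    M.s α k w v = M.consistency α k w v := by
  refine Finset.sum_congr rfl fun l hl => Finset.sum_congr rfl fun σ hσ => ?_
  rw [← Patch.sideIntegral_const_mul]
  refine Patch.sideIntegral_congr fun x hx => ?_
  simp only [jump_eq_zero_of_mem_VI hv hl hσ hx, mul_zero, zero_add]

theorem p_eq_zero (w : Fin N → E d → ℝ) {v : Fin N → E d → ℝ} (hv : v ∈ M.VI k) :
    M.p α δ k w v = 0 := by
  refine Finset.sum_eq_zero fun l hl => Finset.sum_eq_zero fun σ hσ => ?_
  rw [Patch.sideIntegral_congr (g := fun x => 0 * (w l x - w k x)) fun x hx => by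
    simp only [jump_eq_zero_of_mem_VI hv hl hσ hx, mul_zero, zero_mul]]
  rw [Patch.sideIntegral_const_mul, zero_mul]

/-- The first argument enters only through its jumps, and elements of `VI` have none. -/
theorem consistency_add_left (w : Fin N → E d → ℝ) {v v' : Fin N → E d → ℝ} (hv : v ∈ M.VI k) :
    M.consistency α k (w + v) v' = M.consistency α k w v' := by
  refine Finset.sum_congr rfl fun l hl => Finset.sum_congr rfl fun σ hσ => ?_
  congr 1
  refine Patch.sideIntegral_congr fun x hx => ?_
  have := jump_eq_zero_of_mem_VI hv hl hσ hx
  simp only [Pi.add_apply]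
  rw [add_sub_add_comm, this, add_zero]

theorem ae_eq (w : Fin N → E d → ℝ) {v : Fin N → E d → ℝ} (hv : v ∈ M.VI k) :
    M.ae α δ k w v = M.a α k w v + M.consistency α k w v := by
  rw [ae, p_eq_zero w hv, s_eq_consistency w hv, add_zero]

theorem p_add_self (w : Fin N → E d → ℝ) {v : Fin N → E d → ℝ} (hv : v ∈ M.VI k) :
    M.p α δ k (w + v) (w + v) = M.p α δ k w w := by
  refine Finset.sum_congr rfl fun l hl => Finset.sum_congr rfl fun σ hσ => ?_
  refine Patch.sideIntegral_congr fun x hx => ?_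
  have := jump_eq_zero_of_mem_VI hv hl hσ hx
  simp only [Pi.add_apply]
  rw [add_sub_add_comm, this, add_zero]

theorem a_add_left (h : (M.patch k).GeometryRegular κ) (hd : 0 < d) {u v w : Fin N → E d → ℝ}
    (hu : u k ∈ M.V k) (hv : v k ∈ M.V k) (hw : w k ∈ M.V k) : M.a α k (u + v) w = M.a α k u w + M.a α k v w := by
  obtain ⟨P, hP⟩ := (M.patch k).exists_deg_le
  simp only [a_eq, Pi.add_apply]
  rw [h.energy_add_left hd (isCellwise_of_mem_V hP hu) (isCellwise_of_mem_V hP hv)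
    (isCellwise_of_mem_V hP hw), mul_add]

theorem a_smul_left (h : (M.patch k).GeometryRegular κ) (hd : 0 < d) {u w : Fin N → E d → ℝ} (c : ℝ)
    (hu : u k ∈ M.V k) :
    M.a α k (c • u) w = c * M.a α k u w := by
  obtain ⟨P, hP⟩ := (M.patch k).exists_deg_le
  simp only [a_eq, Pi.smul_apply]
  rw [h.energy_smul_left hd (isCellwise_of_mem_V hP hu)]
  ring

end MultiPatch

end IgA

/-! ### Definiteness on the interior space and unique existence of the extensions. -/

namespace IgA

open Set Filter Topology Finset

variable {d : ℕ}

namespace MultiPatch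

variable {N : ℕ} {M : MultiPatch d N} {k l : Fin N} {κ θ : ℝ} {P : ℕ} {α : Fin N → ℝ} {δ : ℝ}

theorem a_comm (u v : Fin N → E d → ℝ) : M.a α k u v = M.a α k v u := by
  rw [a_eq, a_eq, Patch.energy_comm]

theorem a_add_right (h : (M.patch k).GeometryRegular κ) (hd : 0 < d) {u v w : Fin N → E d → ℝ}
    (hu : u k ∈ M.V k) (hv : v k ∈ M.V k) (hw : w k ∈ M.V k) :
    M.a α k w (u + v) = M.a α k w u + M.a α k w v := by
  rw [a_comm, a_add_left h hd hu hv hw, a_comm u, a_comm v]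

theorem a_smul_right (h : (M.patch k).GeometryRegular κ) (hd : 0 < d) {u w : Fin N → E d → ℝ}
    (c : ℝ) (hu : u k ∈ M.V k) : M.a α k w (c • u) = c * M.a α k w u := by
  rw [a_comm, a_smul_left h hd c hu, a_comm]

theorem a_self_nonneg (hα : 0 < α k) (u : Fin N → E d → ℝ) : 0 ≤ M.a α k u u := by
  rw [a_eq]
  exact mul_nonneg hα.le Patch.energy_self_nonneg

/-- The Dirichlet form is definite on the interior space. -/
theorem eq_zero_of_a_self_eq_zero (h : (M.patch k).GeometryRegular κ) (hd : 0 < d)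
    (hne : (M.neighbors k).Nonempty ∨ (M.dirichlet k).Nonempty) (hα : 0 < α k)
    {v : Fin N → E d → ℝ} (hv : v ∈ M.VI k) (h0 : M.a α k v v = 0) : v = 0 := by
  obtain ⟨h1, h2, h3⟩ := mem_VI.1 hv
  obtain ⟨P, hP⟩ := (M.patch k).exists_deg_le
  rw [a_eq, mul_eq_zero, or_iff_right hα.ne'] at h0
  obtain ⟨ξ₀, hξ₀⟩ := openCube_nonempty (d := d)
  have hside : ∀ s : Side d, s.flat ξ₀ ∈ s.set := fun s =>
    s.flat_mem_set (openCube_subset_cube hξ₀)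
  -- An interface or Dirichlet side supplies a zero of the function, which excludes nonzero
  -- constants.
  obtain ⟨y, hy, hy0⟩ : ∃ y ∈ (M.patch k).Ωbar, v k y = 0 := by
    rcases hne with ⟨l, hl⟩ | ⟨s, hs⟩
    · obtain ⟨s, hs⟩ := (M.mem_neighbors.1 hl).2
      exact ⟨_, (M.patch k).G_mem_Ωbar (hside s).1,
        h2 _ (image_side_subset_Γ hl hs (mem_image_of_mem _ (hside s)))⟩
    · exact ⟨_, (M.patch k).G_mem_Ωbar (hside s).1,
        eq_zero_of_mem_dirichlet h1 hs (mem_image_of_mem _ (hside s))⟩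
  ext l x
  by_cases hl : l = k
  · subst hl
    by_cases hx : x ∈ (M.patch l).Ωbar
    · rw [h.eq_of_energy_eq_zero hd (isCellwise_of_mem_V hP h1) h0 hx hy, hy0]
      rfl
    · exact eq_zero_of_mem_V h1 hx
  · rw [h3 l hl]
    rfl

theorem finiteDimensional_VI : FiniteDimensional ℝ (M.VI k) := by
  have := finiteDimensional_V (M := M) (k := k)
  let f : M.VI k →ₗ[ℝ] M.V k :=
    { toFun := fun v => ⟨v.1 k, (mem_VI.1 v.2).1⟩
      map_add' := fun _ _ => rfl
      map_smul' := fun _ _ => rfl }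
  refine FiniteDimensional.of_injective f fun v w hvw => Subtype.ext (funext fun l => ?_)
  by_cases hl : l = k
  · subst hl
    exact congrArg Subtype.val hvw
  · rw [(mem_VI.1 v.2).2.2 l hl, (mem_VI.1 w.2).2.2 l hl]

/-- The Dirichlet form on the interior space. -/
noncomputable def aVI (α : Fin N → ℝ) (h : (M.patch k).GeometryRegular κ) (hd : 0 < d) :
    M.VI k →ₗ[ℝ] M.VI k →ₗ[ℝ] ℝ :=
  LinearMap.mk₂ ℝ (fun v w => M.a α k v.1 w.1)
    (fun u v w => a_add_left h hd (mem_VI.1 u.2).1 (mem_VI.1 v.2).1 (mem_VI.1 w.2).1)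
    (fun c u _ => a_smul_left h hd c (mem_VI.1 u.2).1)
    (fun u v w => a_add_right h hd (mem_VI.1 v.2).1 (mem_VI.1 w.2).1 (mem_VI.1 u.2).1)
    (fun c _ v => a_smul_right h hd c (mem_VI.1 v.2).1)

/-- Unique solvability of the extension problem for a form that coincides with the Dirichlet form
on the interior space. -/
theorem existsUnique_harmonicExtension (h : (M.patch k).GeometryRegular κ) (hd : 0 < d)
    (hne : (M.neighbors k).Nonempty ∨ (M.dirichlet k).Nonempty) (hα : 0 < α k)
    {B : (Fin N → E d → ℝ) → (Fin N → E d → ℝ) → ℝ} {u : Fin N → E d → ℝ} (hu : u ∈ M.Vext k)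
    (L : M.VI k →ₗ[ℝ] ℝ) (hB : ∀ v₀ v : M.VI k, B (u + v₀) v = L v + M.a α k v₀ v) :
    ∃! w, M.IsHarmonicExtension B k u w := by
  have := finiteDimensional_VI (M := M) (k := k)
  have hinj : Function.Injective (aVI α h hd) := by
    rw [← LinearMap.ker_eq_bot, LinearMap.ker_eq_bot']
    intro v hv
    have h1 : M.a α k v.1 v.1 = 0 := LinearMap.congr_fun hv v
    exact Subtype.ext (eq_zero_of_a_self_eq_zero h hd hne hα v.2 h1)
  have hsurj : Function.Surjective (aVI α h hd) :=
    (LinearMap.injective_iff_surjective_of_finrank_eq_finrank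
      (Subspace.dual_finrank_eq (K := ℝ) (V := M.VI k)).symm).1 hinj
  -- The correction solves `a(v₀, ·) = -L` on the interior space, so `u + v₀` is the extension.
  obtain ⟨v₀, hv₀⟩ := hsurj (-L)
  obtain ⟨h1, h2, h3⟩ := mem_VI.1 v₀.2
  refine ⟨u + v₀.1, ⟨Submodule.add_mem _ hu (VI_le_Vext v₀.2), fun v hv => ?_, fun x hx => ?_,
    fun l hl => ?_⟩, fun w hw => ?_⟩
  · have h4 : M.a α k v₀.1 v = -L ⟨v, hv⟩ := LinearMap.congr_fun hv₀ ⟨v, hv⟩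
    rw [hB v₀ ⟨v, hv⟩, h4, add_neg_cancel]
  · simp [h2 x hx]
  · simp [h3 l (M.mem_neighbors.1 hl).1]
  · have h4 := sub_mem_VI hu hw
    have h5 : aVI α h hd ⟨w - u, h4⟩ = -L := by
      ext v
      have h6 := hB ⟨w - u, h4⟩ v
      rw [add_sub_cancel, hw.2.1 v.1 v.2] at h6
      change M.a α k (w - u) v.1 = -L v
      linarith
    have h6 := hinj (h5.trans hv₀.symm)
    rw [← h6]
    simp

theorem consistency_add_right (h : (M.patch k).GeometryRegular κ) (hd : 0 < d)
    {u v w : Fin N → E d → ℝ} (hu : u ∈ M.Vext k) (hv : v k ∈ M.V k) (hw : w k ∈ M.V k) :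
    M.consistency α k u (v + w) = M.consistency α k u v + M.consistency α k u w := by
  obtain ⟨P, hP⟩ := (M.patch k).exists_deg_le
  simp only [consistency]
  rw [← Finset.sum_add_distrib]
  refine Finset.sum_congr rfl fun l hl => ?_
  rw [← Finset.sum_add_distrib]
  refine Finset.sum_congr rfl fun s hs => ?_
  rw [← mul_add, ← h.sideIntegral_normalDeriv_add_mul hd (isCellwise_of_mem_V hP hv)
    (isCellwise_of_mem_V hP hw) (sideBounded_jump hu hl hs)]
  rfl

theorem consistency_smul_right (h : (M.patch k).GeometryRegular κ) (hd : 0 < d)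
    {u v : Fin N → E d → ℝ} (c : ℝ) (hv : v k ∈ M.V k) :
    M.consistency α k u (c • v) = c * M.consistency α k u v := by
  obtain ⟨P, hP⟩ := (M.patch k).exists_deg_le
  simp only [consistency]
  rw [Finset.mul_sum]
  refine Finset.sum_congr rfl fun l _ => ?_
  rw [Finset.mul_sum]
  refine Finset.sum_congr rfl fun s _ => ?_
  rw [mul_left_comm, ← h.sideIntegral_normalDeriv_smul_mul hd (isCellwise_of_mem_V hP hv)]
  rfl

theorem existsUnique_harmonicExtension_a (h : (M.patch k).GeometryRegular κ) (hd : 0 < d)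
    (hne : (M.neighbors k).Nonempty ∨ (M.dirichlet k).Nonempty) (hα : 0 < α k)
    {u : Fin N → E d → ℝ} (hu : u ∈ M.Vext k) :
    ∃! w, M.IsHarmonicExtension (M.a α k) k u w := by
  have huk := (mem_Vext.1 hu).1
  let L : M.VI k →ₗ[ℝ] ℝ :=
    { toFun := fun v => M.a α k u v.1
      map_add' := fun v w => a_add_right h hd (mem_VI.1 v.2).1 (mem_VI.1 w.2).1 huk
      map_smul' := fun c v => a_smul_right h hd c (mem_VI.1 v.2).1 }
  exact existsUnique_harmonicExtension h hd hne hα hu L fun v₀ v =>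
    a_add_left h hd huk (mem_VI.1 v₀.2).1 (mem_VI.1 v.2).1

/-- Corrections in `VI` do not change the consistency term, so it only alters the functional `L`; no
lower bound on `δ` is needed here. -/
theorem existsUnique_harmonicExtension_ae (h : (M.patch k).GeometryRegular κ) (hd : 0 < d)
    (hne : (M.neighbors k).Nonempty ∨ (M.dirichlet k).Nonempty) (hα : 0 < α k)
    {u : Fin N → E d → ℝ} (hu : u ∈ M.Vext k) :
    ∃! w, M.IsHarmonicExtension (M.ae α δ k) k u w := by
  have huk := (mem_Vext.1 hu).1
  let L : M.VI k →ₗ[ℝ] ℝ :=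
    { toFun := fun v => M.a α k u v.1 + M.consistency α k u v.1
      map_add' := fun v w => by
        have h1 := a_add_right (α := α) h hd (mem_VI.1 v.2).1 (mem_VI.1 w.2).1 huk
        have h2 := consistency_add_right (α := α) h hd hu (mem_VI.1 v.2).1 (mem_VI.1 w.2).1
        simp only [Submodule.coe_add, h1, h2]
        ring
      map_smul' := fun c v => by
        have h1 := a_smul_right (α := α) (w := u) h hd c (mem_VI.1 v.2).1
        have h2 := consistency_smul_right (α := α) (u := u) h hd c (mem_VI.1 v.2).1
        simp only [Submodule.coe_smul, h1, h2, RingHom.id_apply, smul_eq_mul]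
        ring }
  refine existsUnique_harmonicExtension h hd hne hα hu L fun v₀ v => ?_
  rw [ae_eq _ v.2, consistency_add_left _ v₀.2,
    a_add_left h hd huk (mem_VI.1 v₀.2).1 (mem_VI.1 v.2).1]
  change _ = M.a α k u v.1 + M.consistency α k u v.1 + _
  ring

/-! ### The estimates -/

theorem hAvg_pos (hd : 0 < d) : 0 < M.hAvg k l := by
  have h1 := (M.patch k).h_pos hd
  have h2 := (M.patch l).h_pos hd
  unfold hAvg
  positivity

theorem hAvg_le (hd : 0 < d) : M.hAvg k l ≤ 2 * (M.patch k).h := by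
  have h1 := (M.patch k).h_pos hd
  have h2 := (M.patch l).h_pos hd
  unfold hAvg
  rw [div_le_iff₀ (by positivity)]
  nlinarith

/-- A sum over the shared sides of all neighbors is bounded by the sum over all sides. -/
theorem sum_sharedSides_le (h : (M.patch k).GeometryRegular κ) (hd : 0 < d) {X : Side d → ℝ}
    (hX : ∀ s, 0 ≤ X s) :
    ∑ l ∈ M.neighbors k, ∑ s ∈ M.sharedSides k l, X s ≤ ∑ s, X s := by
  classical
  rw [← Finset.sum_biUnion]
  · exact Finset.sum_le_sum_of_subset_of_nonneg (Finset.subset_univ _) fun s _ _ => hX s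
  · intro l hl l' hl' hne
    refine Finset.disjoint_left.2 fun s hs hs' => hne ?_
    exact M.eq_of_mem_sharedSides h hd (M.mem_neighbors.1 hl).1 (M.mem_neighbors.1 hl').1 hs hs'

theorem sum_sideIntegral_normalDeriv_le (h : (M.patch k).GeometryRegular κ) (hd : 0 < d)
    (hθ : (M.patch k).QuasiUniform θ) (hP : ∀ ι, ((M.patch k).kv ι).deg ≤ P) {v : E d → ℝ}
    (hv : v ∈ M.V k) :
    (M.patch k).h * ∑ l ∈ M.neighbors k, ∑ s ∈ M.sharedSides k l,
      (M.patch k).sideIntegral s (fun x => (M.patch k).normalDeriv s v x ^ 2) ≤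
    2 * d * Patch.traceConst d (P + 1) κ θ * (M.patch k).energy v v := by
  have hh := (M.patch k).h_pos hd
  refine (mul_le_mul_of_nonneg_left (sum_sharedSides_le h hd fun s =>
    Patch.sideIntegral_nonneg fun x => sq_nonneg _) hh.le).trans ?_
  rw [Finset.mul_sum]
  refine (Finset.sum_le_card_nsmul _ _ _ fun s _ => h.sideIntegral_normalDeriv_le hd hθ
    (isCellwise_of_mem_V hP hv) (Nat.succ_pos P) s).trans_eq ?_
  simp only [Finset.card_univ, Fintype.card_prod, Fintype.card_fin, Fintype.card_bool,
    nsmul_eq_mul, Patch.energy]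
  push_cast
  ring

/-- The sum of the squared `L²`-norms of the jumps. -/
noncomputable def jumpSq (M : MultiPatch d N) (k : Fin N) (w : Fin N → E d → ℝ) : ℝ :=
  ∑ l ∈ M.neighbors k, ∑ s ∈ M.sharedSides k l, (M.patch k).sideIntegral s
    fun x => (w l x - w k x) ^ 2

/-- The harmonic average is at most twice the patch's own mesh size, however coarse or fine the
neighbor is. -/
theorem jumpSq_le_p (hd : 0 < d) (hα : 0 < α k) (hδ : 1 ≤ δ) (w : Fin N → E d → ℝ) :
    α k / (4 * (M.patch k).h) * M.jumpSq k w ≤ M.p α δ k w w := by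
  have hh := (M.patch k).h_pos hd
  simp only [jumpSq, p, faceIntegral, Finset.mul_sum]
  refine Finset.sum_le_sum fun l _ => Finset.sum_le_sum fun s _ => ?_
  rw [Patch.sideIntegral_const_mul]
  simp only [← sq]
  refine mul_le_mul_of_nonneg_right ?_ (Patch.sideIntegral_nonneg fun _ => sq_nonneg _)
  have h1 := hAvg_pos (M := M) (k := k) (l := l) hd
  have h2 := hAvg_le (M := M) (k := k) (l := l) hd
  rw [div_le_div_iff₀ (by positivity) (by positivity)]
  calc α k * (2 * M.hAvg k l) ≤ α k * (2 * (2 * (M.patch k).h)) := by gcongr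
    _ = 1 * α k * (4 * (M.patch k).h) := by ring
    _ ≤ δ * α k * (4 * (M.patch k).h) := by gcongr

/-- Young's inequality on each shared side; `ε` is left free so that it can later be matched to the
mesh size. -/
theorem consistency_le (h : (M.patch k).GeometryRegular κ) (hd : 0 < d) (hα : 0 < α k)
    {ε : ℝ} (hε : 0 < ε) {w v : Fin N → E d → ℝ} (hw : w ∈ M.Vext k) (hv : v k ∈ M.V k) :
    M.consistency α k w v ≤ α k / 2 * (ε / 2 * ∑ l ∈ M.neighbors k, ∑ s ∈ M.sharedSides k l,
      (M.patch k).sideIntegral s (fun x => (M.patch k).normalDeriv s (v k) x ^ 2)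
        + 1 / (2 * ε) * M.jumpSq k w) := by
  obtain ⟨P, hP⟩ := (M.patch k).exists_deg_le
  simp only [consistency, jumpSq, Finset.mul_sum, ← Finset.sum_add_distrib]
  refine Finset.sum_le_sum fun l hl => Finset.sum_le_sum fun s hs => ?_
  refine mul_le_mul_of_nonneg_left ?_ (by positivity)
  have hJ := sideBounded_jump hw hl hs
  have hD : (M.patch k).SideBounded s ((M.patch k).normalDeriv s (v k)) :=
    h.memLp_normalDeriv hd (isCellwise_of_mem_V hP hv) s
  have hJ2 : (M.patch k).SideBounded s fun x => 1 / (2 * ε) * (w l x - w k x) ^ 2 := by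
    simp only [sq]
    exact MemLp.const_mul (hJ.mul hJ) _
  have hD2 : (M.patch k).SideBounded s fun x =>
      ε / 2 * (M.patch k).normalDeriv s (v k) x ^ 2 := by
    simp only [sq]
    exact MemLp.const_mul (hD.mul hD) _
  rw [← Patch.sideIntegral_const_mul, ← Patch.sideIntegral_const_mul,
    ← Patch.sideIntegral_add h hd hD2 hJ2]
  refine Patch.sideIntegral_mono h hd (hD.mul hJ) (MemLp.add hD2 hJ2) fun x => ?_
  set D := (M.patch k).normalDeriv s (v k) x
  set J := w l x - w k x
  have h1 : ε / 2 * D ^ 2 + 1 / (2 * ε) * J ^ 2 - D * J = (ε * D - J) ^ 2 / (2 * ε) := by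
    field_simp
    ring
  have h2 : 0 ≤ (ε * D - J) ^ 2 / (2 * ε) := by positivity
  linarith

/-- The absorption argument: the two extensions differ by an interior function whose energy is
controlled by the penalty term common to both. -/
theorem dForm_estimates (h : (M.patch k).GeometryRegular κ) (hd : 0 < d)
    (hθ : (M.patch k).QuasiUniform θ) (hP : ∀ ι, ((M.patch k).kv ι).deg ≤ P) (hα : 0 < α k)
    (hδ : 1 ≤ δ) {K : ℝ} (hK : 0 < K) (hK' : 2 * d * Patch.traceConst d (P + 1) κ θ ≤ K)
    {u w we : Fin N → E d → ℝ} (hu : u ∈ M.Vext k)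
    (hw : M.IsHarmonicExtension (M.a α k) k u w)
    (hwe : M.IsHarmonicExtension (M.ae α δ k) k u we) :
    M.dForm α δ k w w ≤ M.dForm α δ k we we ∧
      M.dForm α δ k we we ≤ (1 + K) * M.dForm α δ k w w := by
  have hv : w - we ∈ M.VI k := by
    have := Submodule.sub_mem _ (sub_mem_VI hu hw) (sub_mem_VI hu hwe)
    rwa [sub_sub_sub_cancel_right] at this
  have hwek := (mem_Vext.1 hwe.1).1
  have hweq : w = we + (w - we) := by abel
  set v := w - we
  have hvk := (mem_VI.1 hv).1
  have hh := (M.patch k).h_pos hd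
  have hp : M.p α δ k w w = M.p α δ k we we := by rw [hweq, p_add_self we hv]
  have h1 : M.a α k w v = 0 := hw.2.1 v hv
  have h2 : M.a α k we v + M.consistency α k we v = 0 := by
    rw [← ae_eq (δ := δ) we hv]
    exact hwe.2.1 v hv
  have h3 : M.a α k w v = M.a α k we v + M.a α k v v := by
    conv_lhs => rw [hweq]
    exact a_add_left h hd hwek hvk hvk
  have h4 : M.a α k w w = M.a α k we we + 2 * M.a α k we v + M.a α k v v := by
    conv_lhs => rw [hweq]
    have hs : (we + v) k ∈ M.V k := Submodule.add_mem _ hwek hvk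
    rw [a_add_left h hd hwek hvk hs, a_add_right h hd hwek hvk hwek,
      a_add_right h hd hwek hvk hvk, a_comm v we]
    ring
  have h5 : M.a α k v v = M.consistency α k we v := by linarith
  -- This weight makes the trace inequality yield exactly half of `a(v, v)`, while the jumps keep
  -- the factor `α / (4 h)` of `jumpSq_le_p`.
  have h6 := consistency_le h hd hα (ε := 2 * (M.patch k).h / K) (by positivity) hwe.1 hvk
  have h7 := sum_sideIntegral_normalDeriv_le h hd hθ hP hvk
  set S := ∑ l ∈ M.neighbors k, ∑ s ∈ M.sharedSides k l,
    (M.patch k).sideIntegral s (fun x => (M.patch k).normalDeriv s (v k) x ^ 2)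
  have h8 := jumpSq_le_p (M := M) (δ := δ) hd hα hδ we
  have hE : 0 ≤ (M.patch k).energy (v k) (v k) := Patch.energy_self_nonneg
  have h9 : (M.patch k).h * S ≤ K * (M.patch k).energy (v k) (v k) :=
    h7.trans (mul_le_mul_of_nonneg_right hK' hE)
  have h10 : M.a α k v v ≤ M.a α k v v / 2 + K / 2 * M.p α δ k we we := by
    calc M.a α k v v ≤ _ := h5.le.trans h6
      _ = α k / 2 / K * ((M.patch k).h * S) +
          K / 2 * (α k / (4 * (M.patch k).h) * M.jumpSq k we) := by
        field_simp
        ring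
      _ ≤ α k / 2 / K * (K * (M.patch k).energy (v k) (v k)) + K / 2 * M.p α δ k we we := by
        gcongr
      _ = _ := by
        rw [a_eq]
        field_simp
  have h11 : 0 ≤ M.a α k v v := a_self_nonneg hα v
  have h12 : 0 ≤ M.a α k w w := a_self_nonneg hα w
  simp only [dForm, hp]
  constructor
  · linarith
  · nlinarith

end MultiPatch

end IgA

/-! ### The choice of the constants. -/

theorem lemma2 (d : ℕ) (hd : d = 2 ∨ d = 3) (P : ℕ) (κ θ : ℝ) :
    ∃ δ₀ C : ℝ, 0 < δ₀ ∧ 0 < C ∧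
      ∀ (N : ℕ) (M : IgA.MultiPatch d N) (k : Fin N),
        (∀ ι, ((M.patch k).kv ι).deg ≤ P) →
        (M.patch k).GeometryRegular κ → (M.patch k).QuasiUniform θ →
        ((M.neighbors k).Nonempty ∨ (M.dirichlet k).Nonempty) →
        ∀ α : Fin N → ℝ, (∀ l, 0 < α l) → ∀ δ : ℝ, δ₀ ≤ δ →
          ∀ u ∈ M.W k,
            (∃! w, M.IsHarmonicExtension (M.a α k) k u w) ∧
            (∃! w, M.IsHarmonicExtension (M.ae α δ k) k u w) ∧
            ∀ w we, M.IsHarmonicExtension (M.a α k) k u w →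
              M.IsHarmonicExtension (M.ae α δ k) k u we →
              M.dForm α δ k w w ≤ M.dForm α δ k we we ∧
              M.dForm α δ k we we ≤ C * M.dForm α δ k w w := by
  have hd' : 0 < d := by omega
  -- The constants are fixed before any patch is given, when the signs of `κ` and `θ` are unknown;
  -- the absolute value and the added 1 make `K` positive.
  have hK : 0 < |2 * d * IgA.Patch.traceConst d (P + 1) κ θ| + 1 := by positivity
  refine ⟨1, 1 + (|2 * d * IgA.Patch.traceConst d (P + 1) κ θ| + 1), one_pos, by positivity, ?_⟩
  intro N M k hP h hθ hne α hα δ hδ u hu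
  have hu' := IgA.MultiPatch.W_le_Vext hu
  refine ⟨IgA.MultiPatch.existsUnique_harmonicExtension_a h hd' hne (hα k) hu',
    IgA.MultiPatch.existsUnique_harmonicExtension_ae h hd' hne (hα k) hu', fun w we hw hwe => ?_⟩
  exact IgA.MultiPatch.dForm_estimates h hd' hθ hP (hα k) hδ hK
    ((le_abs_self _).trans (by linarith)) hu' hw hwe
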